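/- Let $\mathfrak g$ be a symmetrizable Kac--Moody algebra with finite index set $I$ (with a fixed total order $\prec$), weight lattice $P$ (free of finite rank), linearly independent simple roots $\alpha_i\in P$ and simple coroots $\alpha_i^\vee\in P^\vee=\operatorname{Hom}(P,\mathbb Z)$, fundamental weights $\Lambda_i\in P$ with $\langle\Lambda_i,\alpha_j^\vee\rangle=\delta_{ij}$, $\rho=\sum_i\Lambda_i$, Weyl group $W$, and set $\Phi^+$ of positive real roots. **Crystals.** An abstract crystal is a nonempty set $B$ with maps $e_i,f_i\colon B\to B\sqcup\{0\}$, $\varepsilon_i,\varphi_i\colon B\to\mathbb Z\sqcup\{-\infty\}$, $\mathrm{wt}\colon B\to P$ such that: $\varphi_i(b)=\varepsilon_i(b)+\langle \mathrm{wt}(b),\alpha_i^\vee\rangle$; if $e_ib\ne0$, then $\varepsilon_i,\varphi_i,\mathrm{wt}$ change by $-1,+1,+\alpha_i$; if $f_ib\neq 0$, they change by $+1,-1,-\alpha_i$; $f_ib=b'\iff b=e_ib'$; and $\varphi_i(b)=-\infty$ implies $e_ib=f_ib=0$. A crystal morphism between abstract crystals $B_1$ and $B_2$ is a map $\psi\colon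 B_1\sqcup\{0\}\to B_2\sqcup\{0\}$ with $\psi(0)=0$ that preserves $\mathrm{wt},\varepsilon_i,\varphi_i$ at every $b\in B_1$ with $\psi(b)\neq0$, and satisfies $\psi(e_ib)=e_i\psi(b)$ whenever $\psi(e_ib)\ne0$ and $e_i\psi(b)\ne0$, and likewise for $f_i$ (with $e_i0=f_i0=0$). It is an embedding (surjection) if it is injective (surjective) on $B_1\sqcup\{0\}\to B_2\sqcup\{0\}$. $T_\nu=\{t_\nu\}$ is the crystal with $e_it_\nu=f_it_\nu=0$, $\varepsilon_i(t_\nu)=\varphi_i(t_\nu)=-\infty$, $\mathrm{wt}(t_\nu)=\nu$. On $B_2\otimes B_1=B_2\times B_1$ the operator $e_i$ acts on $b_2$ if $\varepsilon_i(b_2)>\varphi_i(b_1)$ and on $b_1$ otherwise; $f_i$ acts on $b_2$ if $\varepsilon_i(b_2)\ge\varphi_i(b_1)$ and on $b_1$ otherwise; $\varepsilon_i(b_2\otimes b_1)=\max(\varepsilon_i(b_1),\varepsilon_i(b_2)-\langle\mathrm{wt}(b_1),\alpha_i^\vee\rangle)$, $\varphi_i(b_2\otimes b_1)=\max(\varphi_i(b_2),\varphi_i(b_1)+\langle\mathrm{wt}(b_2),\alpha_i^\vee\rangle)$,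 and weights add. **The alcove path model $\mathcal A(\lambda)$.** For dominant $\lambda\in P$ let $R_\lambda=\{(\beta,h)\mid\beta\in\Phi^+,\ h\in\mathbb Z,\ 0\le h<\langle\lambda,\beta^\vee\rangle\}$, totally ordered by comparing the vectors $\frac1{\langle\lambda,\beta^\vee\rangle}(h,c_1,\dots,c_n)$ lexicographically, where $\beta^\vee=\sum_i c_i\alpha_i^\vee$. For $j=(\beta_j,\ell_j)\in R_\lambda$ put $r_j=s_{\beta_j}$ and $\widehat r_j=s_{\beta_j,-\ell_j}$, where $s_{\beta,h}(x)=x-(\langle x,\beta^\vee\rangle-h)\beta$. A finite subset $J=\{j_1<\dots<j_p\}\subseteq R_\lambda$ is admissible if $1\lessdot r_{j_1}\lessdot r_{j_1}r_{j_2}\lessdot\dots\lessdot r_{j_1}\cdots r_{j_p}=:\tau(J)$, where $\lessdot$ is the cover relation of the Bruhat order on $W$. $\mathcal A(\lambda)$ is the set of admissible subsets, with $\mathrm{wt}(J)=-\widehat r_{j_1}\cdots\widehat r_{j_p}(-\lambda)$. For $k\in R_\lambda$ let $\gamma_k=r_{j_1}\cdots r_{j_t}(\beta_k)$ with $t=\max\{a\mid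 j_a<k\}$, and let $I_{\alpha_i}=\{k\mid\gamma_k=\pm\alpha_i\}$, a finite set. Write the signs of the $\gamma_k$, $k\in I_{\alpha_i}\setminus J$, in increasing order of $k$, and cancel pairs $-+$ until none remain. If no $+$ remains, $f_iJ=0$; otherwise let $a$ be the position of the rightmost $+$, $A=\{j\in J\cap I_{\alpha_i}\mid j>a\}$, and $f_iJ=(J\setminus\{\min A\})\cup\{a\}$ (or $J\cup\{a\}$ if $A=\emptyset$). If no $-$ remains, $e_iJ=J\setminus\{\max(J\cap I_{\alpha_i})\}$ if $\langle\tau(J)\rho,\alpha_i^\vee\rangle<0$, and $e_iJ=0$ otherwise; if a $-$ remains, let $a$ be the position of the leftmost $-$, $A=\{j\in J\cap I_{\alpha_i}\mid j<a\}$, and $e_iJ=(J\setminus\{\max A\})\cup\{a\}$ (or $J\cup\{a\}$ if $A=\emptyset$). Finally $\varepsilon_i(J)=\max\{n\mid e_i^nJ\ne0\}$ and $\varphi_i(J)=\max\{n\mid f_i^nJ\neq0\}$. **Statement.** Let $\lambda\in P$ be dominant, let $\mu\in P$, and suppose that $\mu+\lambda=k\lambda$ for some $k\in\mathbb Q_{\ge0}$.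 Define $S_\mu\colon\mathcal A(\lambda)\sqcup\{0\}\to(T_{-\mu}\otimes\mathcal A(\lambda+\mu))\sqcup\{0\}$ by $S_\mu(0)=0$ and $$S_\mu\bigl(\{(\zeta_1,\ell_1),\dots,(\zeta_p,\ell_p)\}\bigr)=t_{-\mu}\otimes\{(\zeta_1,\langle\mu,\zeta_1^\vee\rangle+\ell_1),\dots,(\zeta_p,\langle\mu,\zeta_p^\vee\rangle+\ell_p)\}$$ if the set on the right is an admissible subset of $R_{\lambda+\mu}$, and $S_\mu(J)=0$ otherwise. Then $S_\mu$ is a crystal morphism (between abstract crystals). If $k\ge1$, it is a crystal embedding; if $k\le1$, it is a surjection. -/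

import Mathlib

namespace AlcovePath

/-- The data of a symmetrizable Kac-Moody algebra that enter the theory of abstract crystals:
a weight lattice `P` (free of finite rank, with coweight lattice its dual `Module.Dual ℤ P`),
linearly independent simple roots `αᵢ ∈ P` and simple coroots `αᵢ^∨ ∈ P^∨` whose pairings
`Aᵢⱼ = ⟨αᵢ, αⱼ^∨⟩` form a symmetrizable generalized Cartan matrix, and fundamental weights `Λᵢ ∈ P`.
The pairing `⟨x, f⟩` of `x ∈ P` with `f ∈ P^∨` is written `f x`. -/
structure KacMoodyDatum (I P : Type*) [Fintype I] [AddCommGroup P] where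
  simpleRoot : I → P
  simpleCoroot : I → Module.Dual ℤ P
  fundamentalWeight : I → P
  linearIndependent_simpleRoot : LinearIndependent ℤ simpleRoot
  linearIndependent_simpleCoroot : LinearIndependent ℤ simpleCoroot
  cartan_self : ∀ i, simpleCoroot i (simpleRoot i) = 2
  cartan_nonpos : ∀ i j, i ≠ j → simpleCoroot j (simpleRoot i) ≤ 0
  cartan_zero : ∀ i j, simpleCoroot j (simpleRoot i) = 0 → simpleCoroot i (simpleRoot j) = 0
  symmetrizable : ∃ d : I → ℕ, (∀ i, 0 < d i) ∧
    ∀ i j, (d i : ℤ) * simpleCoroot j (simpleRoot i) = (d j : ℤ) * simpleCoroot i (simpleRoot j)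
  fundamentalWeight_self : ∀ i, simpleCoroot i (fundamentalWeight i) = 1
  fundamentalWeight_ne : ∀ i j, i ≠ j → simpleCoroot j (fundamentalWeight i) = 0

/-! ### Abstract crystals

The disjoint union `B ⊔ {0}` is `Option B`, with `0 = none`; `ℤ ⊔ {-∞}` is `WithBot ℤ`. -/

/-- The structure maps of a crystal on the set `B` (no axioms yet, see `IsAbstractCrystal`). -/
structure CrystalData (I P B : Type*) where
  e : I → B → Option B
  f : I → B → Option B
  ε : I → B → WithBot ℤ
  φ : I → B → WithBot ℤ
  wt : B → P

section Crystal

variable {I P : Type*} [Fintype I] [AddCommGroup P]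

/-- The axioms of an abstract crystal. -/
structure IsAbstractCrystal {B : Type*} (D : KacMoodyDatum I P) (C : CrystalData I P B) :
    Prop where
  nonempty : Nonempty B
  φ_eq : ∀ i b, C.φ i b = C.ε i b + ((D.simpleCoroot i (C.wt b) : ℤ) : WithBot ℤ)
  ε_e : ∀ i b b', C.e i b = some b' → C.ε i b' = C.ε i b + ((-1 : ℤ) : WithBot ℤ)
  φ_e : ∀ i b b', C.e i b = some b' → C.φ i b' = C.φ i b + ((1 : ℤ) : WithBot ℤ)
  wt_e : ∀ i b b', C.e i b = some b' → C.wt b' = C.wt b + D.simpleRoot i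
  ε_f : ∀ i b b', C.f i b = some b' → C.ε i b' = C.ε i b + ((1 : ℤ) : WithBot ℤ)
  φ_f : ∀ i b b', C.f i b = some b' → C.φ i b' = C.φ i b + ((-1 : ℤ) : WithBot ℤ)
  wt_f : ∀ i b b', C.f i b = some b' → C.wt b' = C.wt b - D.simpleRoot i
  f_eq_iff : ∀ i b b', C.f i b = some b' ↔ C.e i b' = some b
  of_φ_eq_bot : ∀ i b, C.φ i b = ⊥ → C.e i b = none ∧ C.f i b = none

/-- A crystal morphism between two abstract crystals, as a map `B₁ ⊔ {0} → B₂ ⊔ {0}`.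
The operators `eᵢ`, `fᵢ` and the map `ψ` are extended by `0 ↦ 0`. -/
structure IsCrystalMorphism {B₁ B₂ : Type*} (D : KacMoodyDatum I P)
    (C₁ : CrystalData I P B₁) (C₂ : CrystalData I P B₂) (ψ : Option B₁ → Option B₂) : Prop where
  source : IsAbstractCrystal D C₁
  target : IsAbstractCrystal D C₂
  map_zero : ψ none = none
  wt : ∀ b b', ψ (some b) = some b' → C₂.wt b' = C₁.wt b
  ε : ∀ i b b', ψ (some b) = some b' → C₂.ε i b' = C₁.ε i b
  φ : ∀ i b b', ψ (some b) = some b' → C₂.φ i b' = C₁.φ i b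
  e : ∀ i b, ψ (C₁.e i b) ≠ none → (ψ (some b)).bind (C₂.e i) ≠ none →
    ψ (C₁.e i b) = (ψ (some b)).bind (C₂.e i)
  f : ∀ i b, ψ (C₁.f i b) ≠ none → (ψ (some b)).bind (C₂.f i) ≠ none →
    ψ (C₁.f i b) = (ψ (some b)).bind (C₂.f i)

/-- A crystal embedding: a morphism that is injective as a map `B₁ ⊔ {0} → B₂ ⊔ {0}`. -/
def IsCrystalEmbedding {B₁ B₂ : Type*} (D : KacMoodyDatum I P)
    (C₁ : CrystalData I P B₁) (C₂ : CrystalData I P B₂) (ψ : Option B₁ → Option B₂) : Prop :=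
  IsCrystalMorphism D C₁ C₂ ψ ∧ Function.Injective ψ

/-- A crystal surjection: a morphism that is surjective as a map `B₁ ⊔ {0} → B₂ ⊔ {0}`. -/
def IsCrystalSurjection {B₁ B₂ : Type*} (D : KacMoodyDatum I P)
    (C₁ : CrystalData I P B₁) (C₂ : CrystalData I P B₂) (ψ : Option B₁ → Option B₂) : Prop :=
  IsCrystalMorphism D C₁ C₂ ψ ∧ Function.Surjective ψ

/-- The tensor product `B₂ ⊗ B₁` (in the convention opposite to Kashiwara's). -/
noncomputable def tensor {B₂ B₁ : Type*} (D : KacMoodyDatum I P)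
    (C₂ : CrystalData I P B₂) (C₁ : CrystalData I P B₁) : CrystalData I P (B₂ × B₁) where
  e i b := if C₁.φ i b.2 < C₂.ε i b.1
    then (C₂.e i b.1).map (fun x => (x, b.2)) else (C₁.e i b.2).map (fun y => (b.1, y))
  f i b := if C₁.φ i b.2 ≤ C₂.ε i b.1
    then (C₂.f i b.1).map (fun x => (x, b.2)) else (C₁.f i b.2).map (fun y => (b.1, y))
  ε i b := max (C₁.ε i b.2)
    (C₂.ε i b.1 + ((-D.simpleCoroot i (C₁.wt b.2) : ℤ) : WithBot ℤ))
  φ i b := max (C₂.φ i b.1)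
    (C₁.φ i b.2 + ((D.simpleCoroot i (C₂.wt b.1) : ℤ) : WithBot ℤ))
  wt b := C₂.wt b.1 + C₁.wt b.2

/-- The one-element crystal `T_lam = {t_lam}`. -/
def crystalT (I : Type*) {P : Type*} (lam : P) : CrystalData I P Unit where
  e _ _ := none
  f _ _ := none
  ε _ _ := ⊥
  φ _ _ := ⊥
  wt _ := lam

end Crystal

noncomputable section

namespace KacMoodyDatum

variable {I P : Type*} [Fintype I] [AddCommGroup P] (D : KacMoodyDatum I P)

/-! ### Weyl group, real roots, Bruhat covers -/

/-- The simple reflection `x ↦ x - ⟨x, αᵢ^∨⟩ αᵢ`. -/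
def simpleReflection (i : I) : P ≃ₗ[ℤ] P := Module.reflection (D.cartan_self i)

/-- The Weyl group, acting on `P`. -/
def weylGroup : Subgroup (P ≃ₗ[ℤ] P) := Subgroup.closure (Set.range D.simpleReflection)

/-- The length function with respect to the simple reflections (meaningful on the Weyl group). -/
def length (w : P ≃ₗ[ℤ] P) : ℕ :=
  sInf {n | ∃ l : List I, l.length = n ∧ (l.map D.simpleReflection).prod = w}

/-- `f` is the coroot `w αᵢ^∨` of the real root `β = w αᵢ`;
the Weyl group acts on `P^∨` by `w f = f ∘ w⁻¹`. -/
def IsRootCorootPair (β : P) (f : Module.Dual ℤ P) : Prop :=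
  ∃ w ∈ D.weylGroup, ∃ i, w (D.simpleRoot i) = β ∧
    f = (D.simpleCoroot i).comp (w⁻¹ : P ≃ₗ[ℤ] P).toLinearMap

/-- The positive real roots. -/
def PosRoot : Type _ :=
  {β : P // (∃ w ∈ D.weylGroup, ∃ i, w (D.simpleRoot i) = β) ∧
    ∃ c : I → ℕ, β = ∑ i, c i • D.simpleRoot i}

variable {D}

/-- A positive real root as an element of `P`. -/
def PosRoot.root (β : D.PosRoot) : P := β.1

theorem PosRoot.exists_coroot (β : D.PosRoot) : ∃ f, D.IsRootCorootPair β.root f := by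
  obtain ⟨w, hw, i, h⟩ := β.2.1
  exact ⟨_, w, hw, i, h, rfl⟩

/-- The coroot `β^∨` (it is uniquely determined by `β`). -/
def PosRoot.coroot (β : D.PosRoot) : Module.Dual ℤ P := β.exists_coroot.choose

theorem PosRoot.coroot_spec (β : D.PosRoot) : D.IsRootCorootPair β.root β.coroot :=
  β.exists_coroot.choose_spec

theorem PosRoot.coroot_root (β : D.PosRoot) : β.coroot β.root = 2 := by
  obtain ⟨w, -, i, h, h'⟩ := β.coroot_spec
  rw [h', ← h]
  have : (w⁻¹ : P ≃ₗ[ℤ] P) (w (D.simpleRoot i)) = D.simpleRoot i := by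
    rw [← LinearEquiv.mul_apply, inv_mul_cancel, LinearEquiv.coe_one, id]
  simp only [LinearMap.comp_apply, LinearEquiv.coe_coe, this, D.cartan_self i]

theorem PosRoot.exists_coeff (β : D.PosRoot) :
    ∃ c : I → ℤ, β.coroot = ∑ i, c i • D.simpleCoroot i := by
  have key : ∀ w ∈ D.weylGroup, ∀ f ∈ Submodule.span ℤ (Set.range D.simpleCoroot),
      f.comp (w⁻¹ : P ≃ₗ[ℤ] P).toLinearMap ∈ Submodule.span ℤ (Set.range D.simpleCoroot) := by
    have hs : ∀ i, ∀ f ∈ Submodule.span ℤ (Set.range D.simpleCoroot),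
        f.comp (D.simpleReflection i).toLinearMap ∈
          Submodule.span ℤ (Set.range D.simpleCoroot) := by
      intro i f hf
      have : f.comp (D.simpleReflection i).toLinearMap
          = f - f (D.simpleRoot i) • D.simpleCoroot i := by
        ext x
        simp [simpleReflection, Module.reflection_apply, mul_comm]
      rw [this]
      exact Submodule.sub_mem _ hf
        (Submodule.smul_mem _ _ (Submodule.subset_span ⟨i, rfl⟩))
    intro w hw
    induction hw using Subgroup.closure_induction'' with
    | mem x hx =>
      obtain ⟨i, rfl⟩ := hx
      exact hs i
    | inv_mem x hx =>
      obtain ⟨i, rfl⟩ := hx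
      rw [inv_inv]
      exact hs i
    | one => intro f hf; exact hf
    | mul x y _ _ hx hy =>
      intro f hf
      rw [mul_inv_rev]
      exact hx _ (hy f hf)
  obtain ⟨w, hw, i, -, h'⟩ := β.coroot_spec
  have := key w hw (D.simpleCoroot i) (Submodule.subset_span ⟨i, rfl⟩)
  rw [← h', Submodule.mem_span_range_iff_exists_fun] at this
  obtain ⟨c, hc⟩ := this
  exact ⟨c, hc.symm⟩

/-- The coordinates `(cᵢ)` of `β^∨ = ∑ cᵢ αᵢ^∨` in the basis of simple coroots. -/
def PosRoot.coeff (β : D.PosRoot) : I → ℤ := β.exists_coeff.choose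

/-- The reflection `s_β`, i.e. `x ↦ x - ⟨x, β^∨⟩ β`. -/
def PosRoot.reflection (β : D.PosRoot) : P ≃ₗ[ℤ] P := Module.reflection β.coroot_root

/-- The affine reflection `s_{β,h}` in the hyperplane `⟨x, β^∨⟩ = h`. -/
def PosRoot.affineReflection (β : D.PosRoot) (h : ℤ) (x : P) : P :=
  x - (β.coroot x - h) • β.root

variable (D)

/-- The cover relation `u ⋖ v` of the Bruhat order on the Weyl group: `v = u s_β` for a root `β`,
and `ℓ(v) = ℓ(u) + 1`. -/
def BruhatCover (u v : P ≃ₗ[ℤ] P) : Prop :=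
  (∃ β : D.PosRoot, v = u * β.reflection) ∧ D.length v = D.length u + 1

/-- `ρ`, the sum of the fundamental weights. -/
def rho : P := ∑ i, D.fundamentalWeight i

/-- A weight is dominant if it pairs non-negatively with every simple coroot. -/
def IsDominant (lam : P) : Prop := ∀ i, 0 ≤ D.simpleCoroot i lam

/-! ### The lexicographic `λ`-chain -/

/-- Pairs `(β, h)` of a positive real root and an integer level. -/
def Fold : Type _ := D.PosRoot × ℤ

instance : DecidableEq D.Fold := Classical.decEq _

variable {D}

/-- The root of a folding position. -/
def Fold.posRoot (x : D.Fold) : D.PosRoot := x.1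

/-- The level of a folding position. -/
def Fold.level (x : D.Fold) : ℤ := x.2

variable (D)

/-- The set `R_λ` of pairs `(β, h)` with `0 ≤ h < ⟨λ, β^∨⟩`. -/
def chainSet (lam : P) : Set D.Fold :=
  {x | 0 ≤ x.level ∧ x.level < x.posRoot.coroot lam}

variable [LinearOrder I]

/-- The vector `v_{β,h} = (h, c₁, …, cₙ) / ⟨λ, β^∨⟩`, in the lexicographically ordered space
`ℚ × ℚ^I`; the index set `I` carries the chosen total order of the simple roots. -/
def lexKey (lam : P) (x : D.Fold) : ℚ ×ₗ Lex (I → ℚ) :=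
  toLex ((x.level : ℚ) / (x.posRoot.coroot lam : ℚ),
    toLex fun i => (x.posRoot.coeff i : ℚ) / (x.posRoot.coroot lam : ℚ))

/-- The strict order of the lex `λ`-chain (a strict total order on `R_λ`). -/
def chainLT (lam : P) (x y : D.Fold) : Prop := D.lexKey lam x < D.lexKey lam y

open Classical in
/-- The elements `j₁ < j₂ < ⋯ < j_p` of a finite subset of `R_λ`, listed in increasing order. -/
def sorted (lam : P) (J : Finset D.Fold) : List D.Fold :=
  J.toList.insertionSort fun x y => D.lexKey lam x ≤ D.lexKey lam y

/-! ### Admissible subsets -/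

/-- The product `r_{j₁} r_{j₂} ⋯` of the reflections along a list of folding positions. -/
def reflProd (l : List D.Fold) : P ≃ₗ[ℤ] P := (l.map fun x => x.posRoot.reflection).prod

/-- `J = {j₁ < ⋯ < j_p} ⊆ R_λ` is admissible if
`1 ⋖ r_{j₁} ⋖ r_{j₁} r_{j₂} ⋖ ⋯ ⋖ r_{j₁} ⋯ r_{j_p}`. -/
def IsAdmissible (lam : P) (J : Finset D.Fold) : Prop :=
  (∀ x ∈ J, x ∈ D.chainSet lam) ∧
    ∀ t < J.card, D.BruhatCover (D.reflProd ((D.sorted lam J).take t))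
      (D.reflProd ((D.sorted lam J).take (t + 1)))

/-- The set underlying the alcove path model: all admissible subsets for the lex `λ`-chain. -/
def Al (lam : P) : Type _ := {J : Finset D.Fold // D.IsAdmissible lam J}

/-- `τ(J) = r_{j₁} ⋯ r_{j_p}`. -/
def tau (lam : P) (J : Finset D.Fold) : P ≃ₗ[ℤ] P := D.reflProd (D.sorted lam J)

/-- `wt(J) = -r̂_{j₁} ⋯ r̂_{j_p}(-λ)`, where `r̂_j` is the affine reflection `s_{β_j, -ℓ_j}`. -/
def weight (lam : P) (J : Finset D.Fold) : P :=
  -((D.sorted lam J).foldr (fun j x => j.posRoot.affineReflection (-j.level) x) (-lam))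

open Classical in
/-- The elements of `J` that are smaller than `k`, in increasing order. -/
def before (lam : P) (J : Finset D.Fold) (k : D.Fold) : List D.Fold :=
  (D.sorted lam J).filter fun j => D.chainLT lam j k

/-- `γ_k = r_{j₁} ⋯ r_{j_t}(β_k)` with `t = max {a | j_a < k}`. -/
def gamma (lam : P) (J : Finset D.Fold) (k : D.Fold) : P :=
  D.reflProd (D.before lam J k) k.posRoot.root

/-- `I_{αᵢ}`, the set of positions `k` with `γ_k = ± αᵢ`. -/
def foldSet (lam : P) (J : Finset D.Fold) (i : I) : Set D.Fold :=
  {k | k ∈ D.chainSet lam ∧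
    (D.gamma lam J k = D.simpleRoot i ∨ D.gamma lam J k = -D.simpleRoot i)}

theorem foldSet_finite (lam : P) (J : Finset D.Fold) (i : I) : (D.foldSet lam J i).Finite := by
  classical
  let S : Set P := (fun q : List D.Fold × P => (D.reflProd q.1)⁻¹ q.2) ''
    ({l | l ∈ (D.sorted lam J).sublists} ×ˢ {D.simpleRoot i, -D.simpleRoot i})
  have hS : S.Finite := ((List.finite_toSet _).prod (Set.toFinite _)).image _
  have hT : {β : D.PosRoot | β.root ∈ S}.Finite :=
    hS.preimage (Set.injOn_of_injective Subtype.val_injective)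
  refine (hT.biUnion fun β _ => ((Set.finite_Ico (0 : ℤ) (β.coroot lam)).image
    fun h => ((β, h) : D.Fold))).subset ?_
  rintro ⟨β, h⟩ ⟨⟨h0, h1⟩, hg⟩
  simp only [Set.mem_iUnion]
  refine ⟨β, ⟨(D.before lam J (β, h), D.gamma lam J (β, h)), ⟨?_, ?_⟩, ?_⟩, h, ⟨h0, h1⟩, rfl⟩
  · exact List.mem_sublists.2 List.filter_sublist
  · simpa using hg
  · change (D.reflProd _)⁻¹ (D.reflProd _ β.root) = β.root
    rw [← LinearEquiv.mul_apply, inv_mul_cancel, LinearEquiv.coe_one, id]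

/-! ### Crystal operators -/

/-- Cancels pairs `- +` in a word until none is left. The letters are indexed by `α`,
and `pos x` says that the letter at `x` is `+`. -/
def _root_.AlcovePath.cancelPairs {α : Type*} (pos : α → Prop) [DecidablePred pos] :
    List α → List α
  | [] => []
  | x :: l =>
    match cancelPairs pos l with
    | [] => [x]
    | y :: r => if ¬ pos x ∧ pos y then r else x :: y :: r

open Classical in
/-- The reduced `i`-signature: the surviving positions of the word
`sgn(γ_{d₁}) ⋯ sgn(γ_{d_q})`, where `I_{αᵢ} \ J = {d₁ < ⋯ < d_q}`. -/
def reducedSignature (lam : P) (J : Finset D.Fold) (i : I) : List D.Fold :=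
  cancelPairs (fun k => D.gamma lam J k = D.simpleRoot i)
    (D.sorted lam ((D.foldSet_finite lam J i).toFinset \ J))

open Classical in
/-- The operator `fᵢ` on subsets. If the reduced signature has no `+`, the result is `0`.
Otherwise let `a` be its rightmost `+` and `A = {j ∈ J ∩ I_{αᵢ} | a < j}`; add `a` to `J` and,
if `A` is non-empty, remove `min A`. -/
def fOp (lam : P) (i : I) (J : Finset D.Fold) : Option (Finset D.Fold) :=
  match ((D.reducedSignature lam J i).filter
      fun k => D.gamma lam J k = D.simpleRoot i).getLast? with
  | none => none
  | some a =>
    some (insert a ((((D.sorted lam J).filter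
      fun j => j ∈ D.foldSet lam J i ∧ D.chainLT lam a j).head?).elim J J.erase))

open Classical in
/-- The operator `eᵢ` on subsets. If the reduced signature has no `-`, the result is
`J \ {max (J ∩ I_{αᵢ})}` when `⟨τ(J)ρ, αᵢ^∨⟩ < 0`, and `0` otherwise.
If it has a `-`, let `a` be its leftmost `-` and `A = {j ∈ J ∩ I_{αᵢ} | j < a}`; add `a` to `J`
and, if `A` is non-empty, remove `max A`. -/
def eOp (lam : P) (i : I) (J : Finset D.Fold) : Option (Finset D.Fold) :=
  match ((D.reducedSignature lam J i).filter
      fun k => ¬ D.gamma lam J k = D.simpleRoot i).head? with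
  | none =>
    if D.simpleCoroot i (D.tau lam J D.rho) < 0 then
      some ((((D.sorted lam J).filter fun j => j ∈ D.foldSet lam J i).getLast?).elim J J.erase)
    else none
  | some a =>
    some (insert a ((((D.sorted lam J).filter
      fun j => j ∈ D.foldSet lam J i ∧ D.chainLT lam j a).getLast?).elim J J.erase))

open Classical in
/-- A finite set of folding positions as an element of `Al(λ) ⊔ {0}`: it is `0` if the set is not
admissible. -/
def toAl (lam : P) (J : Finset D.Fold) : Option (D.Al lam) :=
  if h : D.IsAdmissible lam J then some ⟨J, h⟩ else none

/-- `gⁿ b` for a partial operator `g`. -/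
def _root_.AlcovePath.iter {B : Type*} (g : B → Option B) : ℕ → B → Option B
  | 0, b => some b
  | n + 1, b => (iter g n b).bind g

/-- `max {n | gⁿ b ≠ 0}`. -/
def _root_.AlcovePath.stringLength {B : Type*} (g : B → Option B) (b : B) : ℕ :=
  sSup {n | iter g n b ≠ none}

/-- The operator `eᵢ` on `Al(λ)` (`eOp` preserves admissibility, so `toAl` returns `0` only
where `eOp` does). -/
def alE (lam : P) (i : I) (J : D.Al lam) : Option (D.Al lam) :=
  (D.eOp lam i J.1).bind (D.toAl lam)

/-- The operator `fᵢ` on `Al(λ)` (`fOp` preserves admissibility, so `toAl` returns `0` only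
where `fOp` does). -/
def alF (lam : P) (i : I) (J : D.Al lam) : Option (D.Al lam) :=
  (D.fOp lam i J.1).bind (D.toAl lam)

/-- The crystal `Al(λ)`; `εᵢ` and `φᵢ` are determined by regularity. -/
def crystalAl (lam : P) : CrystalData I P (D.Al lam) where
  e := D.alE lam
  f := D.alF lam
  ε i J := ((stringLength (D.alE lam i) J : ℤ) : WithBot ℤ)
  φ i J := ((stringLength (D.alF lam i) J : ℤ) : WithBot ℤ)
  wt J := D.weight lam J.1

/-! ### The shift map -/

/-- `{(ζ₁, ℓ₁), …} ↦ {(ζ₁, ⟨μ, ζ₁^∨⟩ + ℓ₁), …}`. -/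
def shiftSet (mu : P) (J : Finset D.Fold) : Finset D.Fold :=
  J.image fun x => (x.posRoot, x.posRoot.coroot mu + x.level)

/-- The `μ`-shift `S_μ : Al(λ) ⊔ {0} → (T_{-μ} ⊗ Al(λ+μ)) ⊔ {0}`. It sends `0` to `0`, and `J` to
`t_{-μ}` tensor the shifted set if that set is admissible, and to `0` if not. -/
def shift (lam mu : P) (x : Option (D.Al lam)) : Option (Unit × D.Al (lam + mu)) :=
  x.bind fun J => (D.toAl (lam + mu) (D.shiftSet mu J.1)).map fun K => ((), K)

end KacMoodyDatum

end

end AlcovePath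

/-! ### Lengths in the Weyl group; sign of a real root. -/

namespace AlcovePath

namespace KacMoodyDatum

set_option linter.unusedSectionVars false

variable {I P : Type*} [Fintype I] [AddCommGroup P] (D : KacMoodyDatum I P)

/-! ### Words in the simple reflections and the length function -/

/-! Three facts carry the proof: what the operators do to an admissible set, a formula for the
weight, and the behaviour of the lex chain when `λ` is scaled.

Operators. For `k` in `I_{αᵢ}`, the sign of `γ_k` says whether the partial product `w` before `k` is
a left ascent, that is, whether `w⁻¹ αᵢ > 0`. By the lifting property (`IsAscent.of_cover`) an
ascent persists along a chain of Bruhat covers until a fold over `αᵢ` is met. This rigidity forces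
`fᵢ` either to move a fold over `αᵢ` to an earlier position, multiplying the partial products in
between by `sᵢ`, or to add one fold after which there is no other over `αᵢ` (`IsMove`, `IsInsert`).
The relation `IsEdge` records these two shapes together with the signature, and `fᵢ`, `eᵢ` are this
one relation read in its two directions (`fOp_eq_some_iff`, `eOp_eq_some_iff`). Hence `φᵢ` and `εᵢ`
count surviving signs (`posCount`, `negCount`), with one more `-` when `τ(J)` is a descent. The
lifting property rests on strong exchange, and that on the fact that a real root is positive or
negative, obtained by reduction to rank two.

Weight. The identity `φᵢ - εᵢ = ⟨wt, αᵢ^∨⟩` (`simpleCoroot_weight`) is proved by induction on the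
number of folds, removing the last one, `j`. Only the signs at `j` and after it are affected. Those
after it all belong to one root, and their signed number, corrected by the final sign, is an
integral part in a lexicographically ordered group when that root is not the root of `j`. Reflecting
in `j` moves the quantity below the integral part by an integer (`sum_tail_fold`), the one by which
the weight changes. With this, `A(λ)` is an abstract crystal.

Shift. Let `λ + μ = kλ` with `k ≥ 1`. Translation by `μ` replaces the first coordinate `t` of a key
by `(t + k - 1)/k` and divides the others by `k`, so it embeds `R_λ` as a final segment of
`R_{λ+μ}`. A shifted set has no fold in the remaining initial segment, so all signs there are `+`; a
`+` at the front of a word cancels nothing. So the surviving `-`, the element `τ` and the operator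
`eᵢ` are preserved (`IsStretch.eOp_shiftSet`), and edges, hence `fᵢ`, follow. The additional `+` are
compensated by the factor `T_{-μ}`. For `0 < k ≤ 1` the same applies to `-μ`, from `λ + μ` back to
`λ`; for `k = 0` only the empty set is admissible for `λ + μ`. -/

theorem simpleReflection_apply (i : I) (x : P) :
    D.simpleReflection i x = x - D.simpleCoroot i x • D.simpleRoot i :=
  Module.reflection_apply _ _

theorem simpleReflection_self (i : I) (x : P) :
    D.simpleReflection i (D.simpleReflection i x) = x :=
  Module.involutive_reflection _ _

theorem simpleReflection_mul_self (i : I) :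
    D.simpleReflection i * D.simpleReflection i = 1 := by
  ext x; exact D.simpleReflection_self i x

theorem simpleReflection_inv (i : I) : (D.simpleReflection i)⁻¹ = D.simpleReflection i :=
  inv_eq_of_mul_eq_one_left (D.simpleReflection_mul_self i)

theorem simpleReflection_simpleRoot (i : I) :
    D.simpleReflection i (D.simpleRoot i) = -D.simpleRoot i := by
  rw [simpleReflection_apply, D.cartan_self]; module

/-- The product of the simple reflections along a word. -/
noncomputable def wordProd (l : List I) : P ≃ₗ[ℤ] P := (l.map D.simpleReflection).prod

@[simp] theorem wordProd_nil : D.wordProd [] = 1 := rfl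

@[simp] theorem wordProd_cons (i : I) (l : List I) :
    D.wordProd (i :: l) = D.simpleReflection i * D.wordProd l := by simp [wordProd]

theorem wordProd_append (l l' : List I) :
    D.wordProd (l ++ l') = D.wordProd l * D.wordProd l' := by simp [wordProd]

theorem wordProd_reverse (l : List I) : D.wordProd l.reverse = (D.wordProd l)⁻¹ := by
  induction l with
  | nil => simp
  | cons i l ih => simp [wordProd_append, ih, simpleReflection_inv]

theorem simpleReflection_mem (i : I) : D.simpleReflection i ∈ D.weylGroup :=
  Subgroup.subset_closure ⟨i, rfl⟩

theorem wordProd_mem (l : List I) : D.wordProd l ∈ D.weylGroup := by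
  induction l with
  | nil => exact one_mem _
  | cons i l ih => rw [wordProd_cons]; exact mul_mem (D.simpleReflection_mem i) ih

theorem exists_word {w : P ≃ₗ[ℤ] P} (hw : w ∈ D.weylGroup) : ∃ l, D.wordProd l = w := by
  induction hw using Subgroup.closure_induction with
  | mem x hx => obtain ⟨i, rfl⟩ := hx; exact ⟨[i], by simp⟩
  | one => exact ⟨[], rfl⟩
  | mul x y _ _ hx hy =>
    obtain ⟨l, rfl⟩ := hx
    obtain ⟨l', rfl⟩ := hy
    exact ⟨l ++ l', D.wordProd_append l l'⟩
  | inv x _ hx => obtain ⟨l, rfl⟩ := hx; exact ⟨l.reverse, D.wordProd_reverse l⟩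

theorem length_le (l : List I) : D.length (D.wordProd l) ≤ l.length :=
  Nat.sInf_le ⟨l, rfl, rfl⟩

theorem exists_reduced_word {w : P ≃ₗ[ℤ] P} (hw : w ∈ D.weylGroup) :
    ∃ l, D.wordProd l = w ∧ l.length = D.length w := by
  obtain ⟨l, hl⟩ := D.exists_word hw
  have : {n | ∃ l : List I, l.length = n ∧ (l.map D.simpleReflection).prod = w}.Nonempty :=
    ⟨_, l, rfl, hl⟩
  obtain ⟨l', h, h'⟩ := Nat.sInf_mem this
  exact ⟨l', h', h⟩

theorem length_mul_wordProd_le {w : P ≃ₗ[ℤ] P} (hw : w ∈ D.weylGroup) (l : List I) :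
    D.length (w * D.wordProd l) ≤ D.length w + l.length := by
  obtain ⟨l', rfl, h⟩ := D.exists_reduced_word hw
  rw [← wordProd_append, ← h, ← List.length_append]
  exact D.length_le _

theorem length_simpleReflection_mul_le {w : P ≃ₗ[ℤ] P} (hw : w ∈ D.weylGroup) (i : I) :
    D.length (D.simpleReflection i * w) ≤ D.length w + 1 := by
  obtain ⟨l, rfl, h⟩ := D.exists_reduced_word hw
  rw [← wordProd_cons, ← h]
  exact D.length_le (i :: l)

/-! ### Alternating words in two simple reflections -/

section RankTwo

variable {D} {i j : I}

/-- The entry `⟨αⱼ, αᵢ^∨⟩` of the Cartan matrix, with its sign reversed. -/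
def negCartan (D : KacMoodyDatum I P) (i j : I) : ℤ := -D.simpleCoroot i (D.simpleRoot j)

theorem simpleReflection_combination_left (x : P) (p q : ℤ) :
    D.simpleReflection i (x + p • D.simpleRoot i + q • D.simpleRoot j) =
      x + (D.negCartan i j * q - p - D.simpleCoroot i x) • D.simpleRoot i
        + q • D.simpleRoot j := by
  simp only [simpleReflection_apply, map_add, map_smul, D.cartan_self, negCartan]
  module

theorem simpleReflection_combination_right (x : P) (p q : ℤ) :
    D.simpleReflection j (x + p • D.simpleRoot i + q • D.simpleRoot j) =
      x + p • D.simpleRoot i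
        + (D.negCartan j i * p - q - D.simpleCoroot j x) • D.simpleRoot j := by
  simp only [simpleReflection_apply, map_add, map_smul, D.cartan_self, negCartan]
  module

/-- The alternating word of length `n` in `i`, `j` that ends with `j`. -/
def altWord (i j : I) : ℕ → List I
  | 0 => []
  | n + 1 => (if Even n then j else i) :: altWord i j n

@[simp] theorem length_altWord (n : ℕ) : (altWord i j n).length = n := by
  induction n with
  | zero => rfl
  | succ n ih => simp [altWord, ih]

theorem exists_altWord_add (m n : ℕ) :
    ∃ l : List I, l.length = n ∧ altWord i j (n + m) = l ++ altWord i j m := by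
  induction n with
  | zero => exact ⟨[], rfl, by simp⟩
  | succ n ih =>
    obtain ⟨l, hl, h⟩ := ih
    refine ⟨(if Even (n + m) then j else i) :: l, by simp [hl], ?_⟩
    rw [show n + 1 + m = (n + m) + 1 by omega, altWord, h, List.cons_append]

/-- The coordinates of the image of `αᵢ` under the alternating word of length `n`. -/
def altCoeff (A B : ℤ) : ℕ → ℤ × ℤ
  | 0 => (1, 0)
  | n + 1 => if Even n then ((altCoeff A B n).1, B * (altCoeff A B n).1 - (altCoeff A B n).2)
    else (A * (altCoeff A B n).2 - (altCoeff A B n).1, (altCoeff A B n).2)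

theorem wordProd_altWord_simpleRoot (n : ℕ) :
    D.wordProd (altWord i j n) (D.simpleRoot i) =
      (altCoeff (D.negCartan i j) (D.negCartan j i) n).1 • D.simpleRoot i +
      (altCoeff (D.negCartan i j) (D.negCartan j i) n).2 • D.simpleRoot j := by
  induction n with
  | zero => simp [altWord, altCoeff]
  | succ n ih =>
    rw [altWord, wordProd_cons, LinearEquiv.mul_apply, ih, altCoeff]
    split_ifs
    · simpa using simpleReflection_combination_right (D := D) (i := i) (j := j) 0 _ _
    · simpa using simpleReflection_combination_left (D := D) (i := i) (j := j) 0 _ _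

/-- The last two clauses are the invariant that makes the induction work: for coordinates `p`, `q`
one has `Aq ≤ 2p` after an even number of steps and `Bp ≤ 2q` after an odd number. The step uses `4q
≤ ABq ≤ 2Bp`, or its mirror image, and keeps both coordinates nonnegative. -/
theorem altCoeff_nonneg_of_four_le {A B : ℤ} (hA : 0 ≤ A) (hB : 0 ≤ B) (h : 4 ≤ A * B) (n : ℕ) :
    0 ≤ (altCoeff A B n).1 ∧ 0 ≤ (altCoeff A B n).2 ∧
      (Even n → A * (altCoeff A B n).2 ≤ 2 * (altCoeff A B n).1) ∧
      (¬ Even n → B * (altCoeff A B n).1 ≤ 2 * (altCoeff A B n).2) := by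
  induction n with
  | zero => simp [altCoeff]
  | succ n ih =>
    obtain ⟨hp, hq, he, ho⟩ := ih
    rw [altCoeff]
    split_ifs with hn
    · have h1 := he hn
      have h2 : B * (A * (altCoeff A B n).2) ≤ B * (2 * (altCoeff A B n).1) :=
        mul_le_mul_of_nonneg_left h1 hB
      have h3 : 4 * (altCoeff A B n).2 ≤ A * B * (altCoeff A B n).2 :=
        mul_le_mul_of_nonneg_right h hq
      have h4 : 0 ≤ B * (altCoeff A B n).1 := mul_nonneg hB hp
      refine ⟨hp, ?_, fun h => absurd hn (Nat.even_add_one.1 h), fun _ => ?_⟩ <;>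
        simp only <;> linarith
    · have h1 := ho hn
      have h2 : A * (B * (altCoeff A B n).1) ≤ A * (2 * (altCoeff A B n).2) :=
        mul_le_mul_of_nonneg_left h1 hA
      have h3 : 4 * (altCoeff A B n).1 ≤ A * B * (altCoeff A B n).1 :=
        mul_le_mul_of_nonneg_right h hp
      have h4 : 0 ≤ A * (altCoeff A B n).2 := mul_nonneg hA hq
      refine ⟨?_, hq, fun _ => ?_, fun h => absurd (Nat.even_add_one.2 hn) h⟩ <;>
        simp only <;> linarith

/-- The braid relations for orders 2, 3, 4, 6 are stated in the form needed below: the alternating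
word of length `m`, times `sᵢ`, has an expression of length `m - 1`. -/
theorem braid_two (hA : D.negCartan i j = 0) (hB : D.negCartan j i = 0) :
    D.wordProd (altWord i j 2) * D.simpleReflection i = D.wordProd [j] := by
  ext x
  have hx : x = x + (0 : ℤ) • D.simpleRoot i + (0 : ℤ) • D.simpleRoot j := by simp
  rw [hx]
  simp only [altWord, wordProd_cons, wordProd_nil, LinearEquiv.mul_apply, LinearEquiv.coe_one, id,
    Nat.not_even_one, Even.zero, if_true, if_false, simpleReflection_combination_left,
    simpleReflection_combination_right, hA, hB]
  congr 3 <;> ring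

theorem braid_three (hA : D.negCartan i j = 1) (hB : D.negCartan j i = 1) :
    D.wordProd (altWord i j 3) * D.simpleReflection i = D.wordProd [i, j] := by
  ext x
  have hx : x = x + (0 : ℤ) • D.simpleRoot i + (0 : ℤ) • D.simpleRoot j := by simp
  rw [hx]
  simp only [altWord, wordProd_cons, wordProd_nil, LinearEquiv.mul_apply, LinearEquiv.coe_one, id,
    Nat.not_even_one, Even.zero, even_two, if_true, if_false, simpleReflection_combination_left,
    simpleReflection_combination_right, hA, hB]
  congr 3 <;> ring

theorem braid_four {a b : ℤ} (hA : D.negCartan i j = a) (hB : D.negCartan j i = b)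
    (h : (a = 1 ∧ b = 2) ∨ (a = 2 ∧ b = 1)) :
    D.wordProd (altWord i j 4) * D.simpleReflection i = D.wordProd [j, i, j] := by
  ext x
  have hx : x = x + (0 : ℤ) • D.simpleRoot i + (0 : ℤ) • D.simpleRoot j := by simp
  rw [hx]
  simp only [altWord, wordProd_cons, wordProd_nil, LinearEquiv.mul_apply, LinearEquiv.coe_one, id,
    Nat.not_even_one, Even.zero, even_two, if_true, if_false, simpleReflection_combination_left,
    show ¬ Even 3 by decide, simpleReflection_combination_right, hA, hB]
  obtain ⟨rfl, rfl⟩ | ⟨rfl, rfl⟩ := h <;> congr 3 <;> ring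

theorem braid_six {a b : ℤ} (hA : D.negCartan i j = a) (hB : D.negCartan j i = b)
    (h : (a = 1 ∧ b = 3) ∨ (a = 3 ∧ b = 1)) :
    D.wordProd (altWord i j 6) * D.simpleReflection i = D.wordProd [j, i, j, i, j] := by
  ext x
  have hx : x = x + (0 : ℤ) • D.simpleRoot i + (0 : ℤ) • D.simpleRoot j := by simp
  rw [hx]
  simp only [altWord, wordProd_cons, wordProd_nil, LinearEquiv.mul_apply, LinearEquiv.coe_one, id,
    Nat.not_even_one, Even.zero, even_two, if_true, if_false, simpleReflection_combination_left,
    show ¬ Even 3 by decide, show Even 4 by decide, show ¬ Even 5 by decide,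
    simpleReflection_combination_right, hA, hB]
  obtain ⟨rfl, rfl⟩ | ⟨rfl, rfl⟩ := h <;> congr 3 <;> ring

/-- A repeated letter would cancel, against `h₁`, and a final `i` would cancel with `sᵢ`, against
`h₂`. So the letters alternate and the last one is `j`. -/
theorem eq_altWord {x : List I} (hx : ∀ t ∈ x, t = i ∨ t = j)
    (h₁ : ∀ y, D.wordProd y = D.wordProd x → x.length ≤ y.length)
    (h₂ : ∀ y, D.wordProd y = D.wordProd x * D.simpleReflection i → x.length ≤ y.length) :
    x = altWord i j x.length := by
  induction x with
  | nil => rfl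
  | cons t x ih =>
    have ht := hx t (by simp)
    have hx' := ih (fun s hs => hx s (by simp [hs]))
      (fun y hy => by simpa using h₁ (t :: y) (by simp [hy]))
      (fun y hy => by simpa using h₂ (t :: y) (by simp [hy, mul_assoc]))
    rw [List.length_cons, altWord, ← hx']
    congr 1
    rcases hn : x.length with - | n
    · obtain rfl := List.length_eq_zero_iff.1 hn
      rcases ht with rfl | rfl
      · simpa using h₂ [] (by simp [simpleReflection_mul_self])
      · simp
    · rw [hn, altWord] at hx'
      have hne : t ≠ if Even n then j else i := by
        rintro h
        have := h₁ (altWord i j n) (by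
          rw [hx', ← h, wordProd_cons, wordProd_cons, ← mul_assoc, simpleReflection_mul_self,
            one_mul])
        simp only [length_altWord, List.length_cons] at this
        omega
      by_cases he : Even n
      · rw [if_neg (by rwa [Nat.even_add_one, not_not])]
        rw [if_pos he] at hne
        tauto
      · rw [if_pos (Nat.even_add_one.2 he)]
        rw [if_neg he] at hne
        tauto

theorem negCartan_nonneg (hij : i ≠ j) : 0 ≤ D.negCartan i j :=
  neg_nonneg.2 (D.cartan_nonpos j i hij.symm)

/-- The rank two case of positivity. If the product of the two Cartan entries is at least 4, the
coordinates are nonnegative for alternating words of every length. Otherwise the entries lie in a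
short list, a braid relation bounds the length of `x`, and finitely many coordinates are computed.
-/
theorem wordProd_simpleRoot_rankTwo (hij : i ≠ j) {x : List I} (hx : ∀ t ∈ x, t = i ∨ t = j)
    (h₁ : ∀ y, D.wordProd y = D.wordProd x → x.length ≤ y.length)
    (h₂ : ∀ y, D.wordProd y = D.wordProd x * D.simpleReflection i → x.length ≤ y.length) :
    ∃ p q : ℕ, D.wordProd x (D.simpleRoot i) = p • D.simpleRoot i + q • D.simpleRoot j := by
  have hx' := eq_altWord hx h₁ h₂
  set n := x.length with hn
  suffices h : 0 ≤ (altCoeff (D.negCartan i j) (D.negCartan j i) n).1 ∧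
      0 ≤ (altCoeff (D.negCartan i j) (D.negCartan j i) n).2 by
    rw [hx', wordProd_altWord_simpleRoot]
    obtain ⟨⟨p, hp⟩, ⟨q, hq⟩⟩ := And.intro (Int.eq_ofNat_of_zero_le h.1)
      (Int.eq_ofNat_of_zero_le h.2)
    exact ⟨p, q, by rw [hp, hq, natCast_zsmul, natCast_zsmul]⟩
  have hA : 0 ≤ D.negCartan i j := negCartan_nonneg hij
  have hB : 0 ≤ D.negCartan j i := negCartan_nonneg hij.symm
  have hAB : D.negCartan i j = 0 ↔ D.negCartan j i = 0 := by
    simp only [negCartan, neg_eq_zero]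
    exact ⟨D.cartan_zero j i, D.cartan_zero i j⟩
  -- If `n ≥ m`, the last `m` letters of `x` form the alternating word of length `m`; replacing
  -- these letters and `sᵢ` by `l` expresses `x sᵢ` by fewer than `n` letters, against `h₂`.
  have key : ∀ m, ∀ l : List I, l.length < m →
      D.wordProd (altWord i j m) * D.simpleReflection i = D.wordProd l → n < m := by
    intro m l hl h
    by_contra! hmn
    obtain ⟨l', hl', h'⟩ := exists_altWord_add (i := i) (j := j) m (n - m)
    rw [Nat.sub_add_cancel hmn, ← hx'] at h'
    have := h₂ (l' ++ l) (by rw [h', wordProd_append, wordProd_append, mul_assoc, h])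
    simp only [List.length_append] at this
    omega
  by_cases h4 : 4 ≤ D.negCartan i j * D.negCartan j i
  · have := altCoeff_nonneg_of_four_le hA hB h4 n
    exact ⟨this.1, this.2.1⟩
  obtain ⟨A, hA'⟩ : ∃ A, A = D.negCartan i j := ⟨_, rfl⟩
  obtain ⟨B, hB'⟩ : ∃ B, B = D.negCartan j i := ⟨_, rfl⟩
  simp only [← hA', ← hB'] at hA hB hAB h4 ⊢
  rcases eq_or_ne A 0 with h0 | h0
  · have h0' := hAB.1 h0
    have := key 2 [j] (by simp) (braid_two (by omega) (by omega))
    rw [h0, h0']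
    clear_value n
    interval_cases n <;> decide
  · have h0' : B ≠ 0 := fun h => h0 (hAB.2 h)
    have hA1 : 1 ≤ A := by omega
    have hB1 : 1 ≤ B := by omega
    have hA3 : A ≤ 3 := by nlinarith
    have hB3 : B ≤ 3 := by nlinarith
    have hcases : (A = 1 ∧ B = 1) ∨ ((A = 1 ∧ B = 2) ∨ (A = 2 ∧ B = 1)) ∨
        ((A = 1 ∧ B = 3) ∨ (A = 3 ∧ B = 1)) := by
      clear hA' hB' key
      interval_cases A <;> interval_cases B <;> simp at h4 ⊢
    clear_value n
    rcases hcases with ⟨h, h'⟩ | h | h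
    · have := key 3 [i, j] (by simp) (braid_three (by omega) (by omega))
      rw [h, h']
      interval_cases n <;> decide
    · have := key 4 [j, i, j] (by simp) (braid_four hA'.symm hB'.symm h)
      obtain ⟨h, h'⟩ | ⟨h, h'⟩ := h <;> rw [h, h'] <;> interval_cases n <;> decide
    · have := key 6 [j, i, j, i, j] (by simp) (braid_six hA'.symm hB'.symm h)
      obtain ⟨h, h'⟩ | ⟨h, h'⟩ := h <;> rw [h, h'] <;> interval_cases n <;> decide

end RankTwo

/-! ### Real roots are positive or negative -/

/-- Membership in the cone spanned by the simple roots. -/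
def IsNonneg (x : P) : Prop := ∃ c : I → ℕ, x = ∑ i, c i • D.simpleRoot i

theorem isNonneg_simpleRoot (i : I) : D.IsNonneg (D.simpleRoot i) := by
  classical
  exact ⟨Pi.single i 1, by simp [Pi.single_apply, ite_smul]⟩

theorem IsNonneg.add {x y : P} (hx : D.IsNonneg x) (hy : D.IsNonneg y) : D.IsNonneg (x + y) := by
  obtain ⟨c, rfl⟩ := hx
  obtain ⟨c', rfl⟩ := hy
  exact ⟨c + c', by simp [add_smul, Finset.sum_add_distrib]⟩

theorem IsNonneg.nsmul {x : P} (hx : D.IsNonneg x) (n : ℕ) : D.IsNonneg (n • x) := by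
  obtain ⟨c, rfl⟩ := hx
  exact ⟨n • c, by simp [mul_smul, Finset.smul_sum]⟩

/-- Induction on the length. With `j` the last letter of a reduced word of `w`, factor `w = v x`
with `x` a word in `i` and `j`, lengths adding up, and `v` as short as possible. By induction `v αᵢ`
and `v αⱼ` are nonnegative, and `x αᵢ` is a nonnegative combination of `αᵢ` and `αⱼ` by the rank two
case. -/
theorem isNonneg_of_length_le {w : P ≃ₗ[ℤ] P} (hw : w ∈ D.weylGroup) (i : I)
    (h : D.length w ≤ D.length (w * D.simpleReflection i)) : D.IsNonneg (w (D.simpleRoot i)) := by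
  induction hn : D.length w using Nat.strong_induction_on generalizing w i with
  | _ n ih =>
  obtain ⟨l, rfl, hl⟩ := D.exists_reduced_word hw
  rcases List.eq_nil_or_concat l with rfl | ⟨l', j, rfl⟩
  · simpa using D.isNonneg_simpleRoot i
  rw [List.concat_eq_append] at *
  set w := D.wordProd (l' ++ [j]) with hwdef
  -- A reduced word ending in `i` would make `w sᵢ` shorter than `w`.
  have hij : i ≠ j := by
    rintro rfl
    have h2 : w * D.simpleReflection i = D.wordProd l' := by
      rw [hwdef, wordProd_append, mul_assoc, wordProd_cons, wordProd_nil, mul_one,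
        simpleReflection_mul_self, mul_one]
    have := D.length_le l'
    rw [h2] at h
    simp at hl
    omega
  let Q : ℕ → Prop := fun m => ∃ v ∈ D.weylGroup, ∃ x : List I, (∀ t ∈ x, t = i ∨ t = j) ∧
    w = v * D.wordProd x ∧ D.length v + x.length = D.length w ∧ D.length v = m
  have hQ : Q (D.length (D.wordProd l')) := by
    refine ⟨D.wordProd l', D.wordProd_mem _, [j], by simp, D.wordProd_append _ _, ?_, rfl⟩
    have h1 := D.length_le l'
    have h2 := D.length_mul_wordProd_le (D.wordProd_mem l') [j]
    rw [← wordProd_append, ← hwdef] at h2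
    simp at h2 hl ⊢
    omega
  classical
  have hex : ∃ m, Q m := ⟨_, hQ⟩
  obtain ⟨v, hv, x, hx, hwx, hlen, hm⟩ := Nat.find_spec hex
  have hlt : D.length v < n := by
    have h1 := Nat.find_min' hex hQ
    have h2 := D.length_le l'
    simp at hl
    omega
  -- If `v s_t` were shorter, the letter `t` could be moved from `v` to the front of `x`, against
  -- the minimality of `v`.
  have hstep : ∀ t, t = i ∨ t = j → D.length v ≤ D.length (v * D.simpleReflection t) := by
    intro t ht
    by_contra! hcon
    have hmem : v * D.simpleReflection t ∈ D.weylGroup := mul_mem hv (D.simpleReflection_mem t)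
    have hprod : w = v * D.simpleReflection t * D.wordProd (t :: x) := by
      rw [wordProd_cons, mul_assoc, ← mul_assoc (D.simpleReflection t),
        simpleReflection_mul_self, one_mul, hwx]
    have hle := D.length_mul_wordProd_le hmem (t :: x)
    rw [← hprod] at hle
    have := Nat.find_min' hex ⟨v * D.simpleReflection t, hmem, t :: x, ?_, hprod, ?_, rfl⟩
    · omega
    · intro s hs
      rcases List.mem_cons.1 hs with rfl | hs
      · exact ht
      · exact hx s hs
    · simp only [List.length_cons] at hle ⊢
      omega
  -- Since the lengths of `v` and `x` add up to that of `w`, a shorter word for `x` would shorten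
  -- `w`, and a word for `x sᵢ` shorter than `x` would make `w sᵢ` shorter than `w`.
  obtain ⟨p, q, hpq⟩ := wordProd_simpleRoot_rankTwo (D := D) hij hx
    (fun y hy => by
      have := D.length_mul_wordProd_le hv y
      rw [hy, ← hwx] at this
      omega)
    (fun y hy => by
      have := D.length_mul_wordProd_le hv y
      rw [hy, ← mul_assoc, ← hwx] at this
      omega)
  rw [hwx, LinearEquiv.mul_apply, hpq, map_add, map_nsmul, map_nsmul]
  exact ((ih _ hlt hv i (hstep i (.inl rfl)) rfl).nsmul D p).add D
    ((ih _ hlt hv j (hstep j (.inr rfl)) rfl).nsmul D q)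

theorem isNonneg_or_neg {w : P ≃ₗ[ℤ] P} (hw : w ∈ D.weylGroup) (i : I) :
    D.IsNonneg (w (D.simpleRoot i)) ∨ D.IsNonneg (-w (D.simpleRoot i)) := by
  rcases le_total (D.length w) (D.length (w * D.simpleReflection i)) with h | h
  · exact .inl (D.isNonneg_of_length_le hw i h)
  · right
    have := D.isNonneg_of_length_le (mul_mem hw (D.simpleReflection_mem i)) i
      (by rwa [mul_assoc, simpleReflection_mul_self, mul_one])
    rwa [LinearEquiv.mul_apply, simpleReflection_simpleRoot, map_neg] at this

end KacMoodyDatum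

end AlcovePath

/-! ### Roots and coroots, strong exchange, lifting of Bruhat covers. -/

namespace AlcovePath

namespace KacMoodyDatum

set_option linter.unusedSectionVars false

variable {I P : Type*} [Fintype I] [AddCommGroup P] (D : KacMoodyDatum I P)

/-! ### Roots and coroots -/

theorem eq_of_sum_simpleRoot_eq {a b : I → ℤ}
    (h : ∑ i, a i • D.simpleRoot i = ∑ i, b i • D.simpleRoot i) : a = b :=
  funext (Fintype.linearIndependent_iffₛ.1 D.linearIndependent_simpleRoot a b h)

theorem eq_of_sum_simpleCoroot_eq {a b : I → ℤ}
    (h : ∑ i, a i • D.simpleCoroot i = ∑ i, b i • D.simpleCoroot i) : a = b :=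
  funext (Fintype.linearIndependent_iffₛ.1 D.linearIndependent_simpleCoroot a b h)

/-- The positive integers symmetrizing the Cartan matrix. -/
noncomputable def symm : I → ℕ := D.symmetrizable.choose

theorem symm_pos (i : I) : 0 < D.symm i := D.symmetrizable.choose_spec.1 i

theorem symm_mul (i j : I) : (D.symm i : ℤ) * D.simpleCoroot j (D.simpleRoot i) =
    D.symm j * D.simpleCoroot i (D.simpleRoot j) := D.symmetrizable.choose_spec.2 i j

/-- Symmetrizability, transported along a word: the coordinates of `w αᵢ` and of its coroot
determine each other through the symmetrizing integers. This replaces an invariant bilinear form. -/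
theorem exists_coordinates (l : List I) (i : I) : ∃ n c : I → ℤ,
    D.wordProd l (D.simpleRoot i) = ∑ j, n j • D.simpleRoot j ∧
    (D.simpleCoroot i).comp ((D.wordProd l)⁻¹ : P ≃ₗ[ℤ] P).toLinearMap =
      ∑ j, c j • D.simpleCoroot j ∧ ∀ j, D.symm i * n j = c j * D.symm j := by
  classical
  induction l with
  | nil =>
    refine ⟨Pi.single i 1, Pi.single i 1, by simp [Pi.single_apply, ite_smul], ?_, ?_⟩
    · simp only [Pi.single_apply, ite_smul, one_smul, zero_smul, Finset.sum_ite_eq',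
        Finset.mem_univ, if_true]
      rfl
    · intro j
      by_cases h : j = i
      · subst h; simp
      · simp [h]
  | cons t l ih =>
    obtain ⟨n, c, hn, hc, hnc⟩ := ih
    set β := D.wordProd l (D.simpleRoot i)
    set f := (D.simpleCoroot i).comp ((D.wordProd l)⁻¹ : P ≃ₗ[ℤ] P).toLinearMap
    -- The reflection in `α_t` changes only the `t`-th coordinates, by the two pairings here; they
    -- are related as the coordinates must be.
    have hkey : (D.symm i : ℤ) * D.simpleCoroot t β = f (D.simpleRoot t) * D.symm t := by
      rw [hn, hc]
      simp only [map_sum, map_smul, LinearMap.sum_apply, LinearMap.smul_apply, smul_eq_mul,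
        Finset.mul_sum, Finset.sum_mul]
      refine Finset.sum_congr rfl fun j _ => ?_
      rw [← mul_assoc, hnc, mul_assoc, D.symm_mul j t]
      ring
    refine ⟨n - Pi.single t (D.simpleCoroot t β), c - Pi.single t (f (D.simpleRoot t)), ?_, ?_, ?_⟩
    · rw [wordProd_cons, LinearEquiv.mul_apply, simpleReflection_apply]
      simp only [Pi.sub_apply, sub_smul, Finset.sum_sub_distrib, ← hn]
      simp [Pi.single_apply, ite_smul, β]
    · simp only [Pi.sub_apply, sub_smul, Finset.sum_sub_distrib, ← hc]
      rw [wordProd_cons, mul_inv_rev, simpleReflection_inv]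
      ext x
      simp [Pi.single_apply, ite_smul, f, simpleReflection_apply, mul_comm]
    · intro j
      by_cases h : j = t
      · subst h
        simp only [Pi.sub_apply, Pi.single_eq_same, mul_sub, sub_mul, hnc, hkey]
      · simp [h, hnc]

/-- The coordinates of `β` determine those of the coroot up to the factor coming from `αᵢ`, so `f`
and `g` are proportional; both take the value 2 at `β`. -/
theorem isRootCorootPair_unique {β : P} {f g : Module.Dual ℤ P} (hf : D.IsRootCorootPair β f)
    (hg : D.IsRootCorootPair β g) : f = g := by
  obtain ⟨w, hw, i, h1, h2⟩ := hf
  obtain ⟨w', hw', i', h1', h2'⟩ := hg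
  obtain ⟨l, rfl⟩ := D.exists_word hw
  obtain ⟨l', rfl⟩ := D.exists_word hw'
  obtain ⟨n, c, hn, hc, hnc⟩ := D.exists_coordinates l i
  obtain ⟨n', c', hn', hc', hnc'⟩ := D.exists_coordinates l' i'
  have hnn : n = n' := D.eq_of_sum_simpleRoot_eq (by rw [← hn, ← hn', h1, h1'])
  subst hnn
  have hcc : ∀ j, (D.symm i' : ℤ) * c j = D.symm i * c' j := by
    intro j
    have hj : (D.symm j : ℤ) ≠ 0 := by exact_mod_cast (D.symm_pos j).ne'
    apply mul_right_cancel₀ hj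
    rw [mul_assoc, ← hnc, mul_assoc, ← hnc']
    ring
  have hff : (D.symm i' : ℤ) • f = (D.symm i : ℤ) • g := by
    rw [h2, h2', hc, hc', Finset.smul_sum, Finset.smul_sum]
    exact Finset.sum_congr rfl fun j _ => by rw [smul_smul, smul_smul, hcc]
  have hval : ∀ (w : P ≃ₗ[ℤ] P) i, (D.simpleCoroot i).comp (w⁻¹ : P ≃ₗ[ℤ] P).toLinearMap
      (w (D.simpleRoot i)) = 2 := by
    intro w i
    have : (w⁻¹ : P ≃ₗ[ℤ] P) (w (D.simpleRoot i)) = D.simpleRoot i := by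
      rw [← LinearEquiv.mul_apply, inv_mul_cancel, LinearEquiv.coe_one, id]
    simp only [LinearMap.comp_apply, LinearEquiv.coe_coe, this, D.cartan_self i]
  have h2f : f β = 2 := by rw [h2, ← h1, hval]
  have h2g : g β = 2 := by rw [h2', ← h1', hval]
  have hii : (D.symm i' : ℤ) = D.symm i := by
    have := congrArg (fun F : Module.Dual ℤ P => F β) hff
    simp only [LinearMap.smul_apply, h2f, h2g, smul_eq_mul] at this
    linarith
  have hi0 : (D.symm i' : ℤ) ≠ 0 := by exact_mod_cast (D.symm_pos i').ne'
  rw [h2, h2', hc, hc']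
  refine Finset.sum_congr rfl fun j _ => ?_
  have := hcc j
  rw [← hii] at this
  rw [mul_left_cancel₀ hi0 this]

theorem inv_apply_apply (w : P ≃ₗ[ℤ] P) (x : P) : (w⁻¹ : P ≃ₗ[ℤ] P) (w x) = x := by
  rw [← LinearEquiv.mul_apply, inv_mul_cancel, LinearEquiv.coe_one, id]

theorem apply_inv_apply (w : P ≃ₗ[ℤ] P) (x : P) : w ((w⁻¹ : P ≃ₗ[ℤ] P) x) = x := by
  rw [← LinearEquiv.mul_apply, mul_inv_cancel, LinearEquiv.coe_one, id]

variable {D}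

theorem IsRootCorootPair.map {β : P} {f : Module.Dual ℤ P} (h : D.IsRootCorootPair β f)
    {w : P ≃ₗ[ℤ] P} (hw : w ∈ D.weylGroup) :
    D.IsRootCorootPair (w β) (f.comp (w⁻¹ : P ≃ₗ[ℤ] P).toLinearMap) := by
  obtain ⟨u, hu, i, rfl, rfl⟩ := h
  refine ⟨w * u, mul_mem hw hu, i, rfl, ?_⟩
  rw [mul_inv_rev]
  rfl

theorem IsRootCorootPair.neg {β : P} {f : Module.Dual ℤ P} (h : D.IsRootCorootPair β f) :
    D.IsRootCorootPair (-β) (-f) := by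
  obtain ⟨u, hu, i, rfl, rfl⟩ := h
  refine ⟨u * D.simpleReflection i, mul_mem hu (D.simpleReflection_mem i), i, ?_, ?_⟩
  · rw [LinearEquiv.mul_apply, simpleReflection_simpleRoot, map_neg]
  · rw [mul_inv_rev, simpleReflection_inv]
    ext x
    simp [simpleReflection_apply, D.cartan_self]
    ring

theorem isRootCorootPair_simple (i : I) :
    D.IsRootCorootPair (D.simpleRoot i) (D.simpleCoroot i) :=
  ⟨1, one_mem _, i, rfl, by ext; simp⟩

namespace PosRoot

theorem ext_root {β γ : D.PosRoot} (h : β.root = γ.root) : β = γ := Subtype.ext h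

theorem isNonneg (β : D.PosRoot) : D.IsNonneg β.root := β.2.2

theorem reflection_apply (β : D.PosRoot) (x : P) :
    β.reflection x = x - β.coroot x • β.root := Module.reflection_apply _ _

theorem reflection_mul_self (β : D.PosRoot) : β.reflection * β.reflection = 1 := by
  ext x; exact Module.involutive_reflection _ _

theorem reflection_root (β : D.PosRoot) : β.reflection β.root = -β.root := by
  rw [reflection_apply, β.coroot_root]; module

theorem root_ne_zero (β : D.PosRoot) : β.root ≠ 0 := fun h => by
  simpa [h] using β.coroot_root

theorem coroot_eq_sum (β : D.PosRoot) : β.coroot = ∑ i, β.coeff i • D.simpleCoroot i :=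
  β.exists_coeff.choose_spec

theorem exists_coordinates (β : D.PosRoot) : ∃ (d : ℕ) (n : I → ℕ), 0 < d ∧
    β.root = ∑ j, n j • D.simpleRoot j ∧ ∀ j, (d : ℤ) * n j = β.coeff j * D.symm j := by
  obtain ⟨w, hw, i, h, h'⟩ := β.coroot_spec
  obtain ⟨l, rfl⟩ := D.exists_word hw
  obtain ⟨n, c, hn, hc, hnc⟩ := D.exists_coordinates l i
  obtain ⟨m, hm⟩ := β.isNonneg
  have h1 : n = fun j => (m j : ℤ) :=
    D.eq_of_sum_simpleRoot_eq (by rw [← hn, h, hm]; simp)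
  have h2 : c = β.coeff := D.eq_of_sum_simpleCoroot_eq (by rw [← hc, ← h', β.coroot_eq_sum])
  subst h1 h2
  exact ⟨D.symm i, m, D.symm_pos i, hm, hnc⟩

/-- Each coordinate of the coroot is a positive rational multiple of the corresponding coordinate of
the root. -/
theorem coeff_nonneg (β : D.PosRoot) (j : I) : 0 ≤ β.coeff j := by
  obtain ⟨d, n, hd, -, h⟩ := β.exists_coordinates
  have h1 : (0 : ℤ) < D.symm j := by exact_mod_cast D.symm_pos j
  have h2 : 0 ≤ β.coeff j * D.symm j := by rw [← h]; positivity
  exact nonneg_of_mul_nonneg_left h2 h1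

theorem coeff_ne_zero (β : D.PosRoot) : β.coeff ≠ 0 := fun h => by
  have := β.coroot_root
  rw [β.coroot_eq_sum, h] at this
  simp at this

theorem sum_coeff_pos (β : D.PosRoot) : 0 < ∑ j, β.coeff j := by
  obtain ⟨j, hj⟩ := Function.ne_iff.1 β.coeff_ne_zero
  exact Finset.sum_pos' (fun j _ => β.coeff_nonneg j)
    ⟨j, Finset.mem_univ j, lt_of_le_of_ne (β.coeff_nonneg j) (Ne.symm hj)⟩

theorem coroot_nonneg (β : D.PosRoot) {lam : P} (h : D.IsDominant lam) : 0 ≤ β.coroot lam := by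
  rw [β.coroot_eq_sum]
  simp only [LinearMap.sum_apply, LinearMap.smul_apply, smul_eq_mul]
  exact Finset.sum_nonneg fun j _ => mul_nonneg (β.coeff_nonneg j) (h j)

/-- Move `β` to a simple root `αᵢ` by the Weyl group; then `p` is `q` times the `i`-th coordinate of
the image of `γ`, an integer. -/
theorem exists_smul_of_smul_eq (β γ : D.PosRoot) {p q : ℤ}
    (h : p • β.root = q • γ.root) : q ∣ p := by
  classical
  obtain ⟨w, hw, i, hi⟩ := β.2.1
  obtain ⟨w', hw', i', hi'⟩ := γ.2.1
  obtain ⟨l, hl⟩ := D.exists_word (mul_mem (inv_mem hw) hw')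
  obtain ⟨n, c, hn, -, -⟩ := D.exists_coordinates l i'
  have h1 : p • D.simpleRoot i = q • D.wordProd l (D.simpleRoot i') := by
    rw [hl, LinearEquiv.mul_apply, hi', ← map_smul]
    change _ = (w⁻¹ : P ≃ₗ[ℤ] P) (q • γ.root)
    rw [← h]
    change _ = (w⁻¹ : P ≃ₗ[ℤ] P) (p • β.1)
    rw [← hi, map_smul, inv_apply_apply]
  have h2 : Pi.single i p = fun j => q * n j := D.eq_of_sum_simpleRoot_eq (by
    rw [hn] at h1
    simp only [mul_smul, ← Finset.smul_sum, ← h1]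
    simp [Pi.single_apply, ite_smul])
  have := congrFun h2 i
  rw [Pi.single_eq_same] at this
  exact ⟨_, this⟩

theorem eq_of_smul_root_eq {β γ : D.PosRoot} {p q : ℤ} (hp : 0 < p) (hq : 0 < q)
    (h : p • β.root = q • γ.root) : β = γ := by
  obtain rfl : p = q := le_antisymm
    (Int.le_of_dvd hq (exists_smul_of_smul_eq γ β h.symm))
    (Int.le_of_dvd hp (exists_smul_of_smul_eq β γ h))
  obtain ⟨n, hn⟩ := β.isNonneg
  obtain ⟨m, hm⟩ := γ.isNonneg
  apply ext_root
  rw [hn, hm] at h ⊢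
  have : (fun j => p * (n j : ℤ)) = fun j => p * (m j : ℤ) := D.eq_of_sum_simpleRoot_eq (by
    simpa only [mul_smul, ← Finset.smul_sum, natCast_zsmul] using h)
  refine Finset.sum_congr rfl fun j _ => ?_
  have := mul_left_cancel₀ hp.ne' (congrFun this j)
  rw [Nat.cast_inj.1 this]

/-- Proportional coroots have proportional roots, and proportional positive real roots are equal.
This separates different roots in the lex order on the chain. -/
theorem eq_of_smul_coeff_eq {β γ : D.PosRoot} {p q : ℤ} (hp : 0 < p) (hq : 0 < q)
    (h : ∀ j, p * β.coeff j = q * γ.coeff j) : β = γ := by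
  obtain ⟨d, n, hd, hn, hdn⟩ := β.exists_coordinates
  obtain ⟨e, m, he, hm, hem⟩ := γ.exists_coordinates
  refine eq_of_smul_root_eq (p := p * d) (q := q * e) (by positivity) (by positivity) ?_
  rw [hn, hm, Finset.smul_sum, Finset.smul_sum]
  refine Finset.sum_congr rfl fun j _ => ?_
  rw [← natCast_zsmul, ← natCast_zsmul, smul_smul, smul_smul, mul_assoc, mul_assoc, hdn, hem,
    ← mul_assoc, ← mul_assoc, h]

theorem coroot_eq {β : D.PosRoot} {f : Module.Dual ℤ P} (h : D.IsRootCorootPair β.root f) :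
    β.coroot = f := D.isRootCorootPair_unique β.coroot_spec h

theorem coroot_apply_of_map {β γ : D.PosRoot} {w : P ≃ₗ[ℤ] P} (hw : w ∈ D.weylGroup)
    (h : w β.root = γ.root) (x : P) : γ.coroot (w x) = β.coroot x := by
  have := β.coroot_spec.map hw
  rw [h] at this
  rw [coroot_eq this]
  simp

theorem coroot_apply_of_map_neg {β γ : D.PosRoot} {w : P ≃ₗ[ℤ] P} (hw : w ∈ D.weylGroup)
    (h : w β.root = -γ.root) (x : P) : γ.coroot (w x) = -β.coroot x := by
  have := (β.coroot_spec.map hw).neg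
  rw [h, neg_neg] at this
  rw [coroot_eq this]
  simp

theorem mul_reflection_of_map {β γ : D.PosRoot} {w : P ≃ₗ[ℤ] P} (hw : w ∈ D.weylGroup)
    (h : w β.root = γ.root ∨ w β.root = -γ.root) : w * β.reflection = γ.reflection * w := by
  ext x
  simp only [LinearEquiv.mul_apply, reflection_apply, map_sub, map_smul]
  rcases h with h | h
  · rw [coroot_apply_of_map hw h, h]
  · rw [coroot_apply_of_map_neg hw h, h]; simp

end PosRoot

/-- The simple roots are positive real roots. -/
def simplePosRoot (i : I) : D.PosRoot :=
  ⟨D.simpleRoot i, ⟨1, one_mem _, i, rfl⟩, D.isNonneg_simpleRoot i⟩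

@[simp] theorem root_simplePosRoot (i : I) :
    (simplePosRoot i : D.PosRoot).root = D.simpleRoot i := rfl

@[simp] theorem coroot_simplePosRoot (i : I) :
    (simplePosRoot i : D.PosRoot).coroot = D.simpleCoroot i :=
  PosRoot.coroot_eq (isRootCorootPair_simple i)

@[simp] theorem reflection_simplePosRoot (i : I) :
    (simplePosRoot i : D.PosRoot).reflection = D.simpleReflection i := by
  ext x
  rw [PosRoot.reflection_apply, simpleReflection_apply, coroot_simplePosRoot, root_simplePosRoot]

theorem PosRoot.reflection_mem (β : D.PosRoot) : β.reflection ∈ D.weylGroup := by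
  obtain ⟨w, hw, i, h⟩ := β.2.1
  have : w * (simplePosRoot i : D.PosRoot).reflection = β.reflection * w :=
    PosRoot.mul_reflection_of_map hw (.inl h)
  rw [eq_mul_inv_of_mul_eq this.symm]
  exact mul_mem (mul_mem hw (by rw [reflection_simplePosRoot]; exact D.simpleReflection_mem i)) (inv_mem hw)

theorem eq_zero_of_isNonneg {x : P} (h : D.IsNonneg x) (h' : D.IsNonneg (-x)) : x = 0 := by
  obtain ⟨n, hn⟩ := h
  obtain ⟨m, hm⟩ := h'
  have h0 : (fun j => (n j : ℤ)) = fun j => -(m j : ℤ) := D.eq_of_sum_simpleRoot_eq (by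
    simp only [neg_smul, Finset.sum_neg_distrib, natCast_zsmul, ← hn, ← hm, neg_neg])
  rw [hn]
  refine Finset.sum_eq_zero fun j _ => ?_
  have := congrFun h0 j
  have : n j = 0 := by omega
  rw [this, zero_smul]

theorem PosRoot.not_isNonneg_neg (β : D.PosRoot) : ¬ D.IsNonneg (-β.root) := fun h =>
  β.root_ne_zero (eq_zero_of_isNonneg β.isNonneg h)

theorem exists_posRoot {w : P ≃ₗ[ℤ] P} (hw : w ∈ D.weylGroup) (i : I) :
    ∃ β : D.PosRoot, w (D.simpleRoot i) = β.root ∨ w (D.simpleRoot i) = -β.root := by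
  rcases D.isNonneg_or_neg hw i with h | h
  · exact ⟨⟨w (D.simpleRoot i), ⟨w, hw, i, rfl⟩, h⟩, .inl rfl⟩
  · refine ⟨⟨-w (D.simpleRoot i), ⟨w * D.simpleReflection i,
      mul_mem hw (D.simpleReflection_mem i), i, ?_⟩, h⟩, .inr (neg_neg _).symm⟩
    rw [LinearEquiv.mul_apply, simpleReflection_simpleRoot, map_neg]

theorem PosRoot.exists_map {w : P ≃ₗ[ℤ] P} (hw : w ∈ D.weylGroup) (β : D.PosRoot) :
    ∃ γ : D.PosRoot, w β.root = γ.root ∨ w β.root = -γ.root := by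
  obtain ⟨u, hu, i, h⟩ := β.2.1
  obtain ⟨γ, hγ⟩ := exists_posRoot (mul_mem hw hu) i
  rw [LinearEquiv.mul_apply, h] at hγ
  exact ⟨γ, hγ⟩

/-- The reflection `sᵢ` changes only the `i`-th coordinate. If the image were negative, all other
coordinates of `β` would vanish, making `β` a multiple of `αᵢ` and thus equal to it. -/
theorem PosRoot.isNonneg_simpleReflection {β : D.PosRoot} {i : I} (h : β.root ≠ D.simpleRoot i) :
    D.IsNonneg (D.simpleReflection i β.root) := by
  classical
  obtain ⟨γ, hγ | hγ⟩ := PosRoot.exists_map (D.simpleReflection_mem i) β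
  · rw [hγ]; exact γ.isNonneg
  exfalso
  obtain ⟨n, hn⟩ := β.isNonneg
  obtain ⟨m, hm⟩ := γ.isNonneg
  have h0 : (fun j => (n j : ℤ)) =
      (fun j => -(m j : ℤ)) + Pi.single i (D.simpleCoroot i β.root) :=
    D.eq_of_sum_simpleRoot_eq (by
      rw [simpleReflection_apply, sub_eq_iff_eq_add] at hγ
      simp only [Pi.add_apply, add_smul, neg_smul, Finset.sum_add_distrib, Finset.sum_neg_distrib,
        natCast_zsmul, ← hn, ← hm]
      nth_rw 1 [hγ]
      simp [Pi.single_apply, ite_smul])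
  have hz : ∀ j, j ≠ i → n j = 0 := by
    intro j hj
    have := congrFun h0 j
    simp [hj] at this
    omega
  have hni : β.root = n i • D.simpleRoot i := by
    rw [hn]
    exact Finset.sum_eq_single i (fun j _ hj => by rw [hz j hj, zero_smul]) (by simp)
  have hpos : 0 < n i := by
    rcases Nat.eq_zero_or_pos (n i) with h0 | h0
    · rw [h0, zero_smul] at hni
      exact absurd hni β.root_ne_zero
    · exact h0
  apply h
  have : β = simplePosRoot i := PosRoot.eq_of_smul_root_eq (p := 1) (q := n i) one_pos
    (by exact_mod_cast hpos) (by rw [one_smul, natCast_zsmul]; exact hni)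
  rw [this, root_simplePosRoot]

/-! ### The exchange condition and left ascents -/

/-- The strong exchange condition. -/
theorem exists_deletion (l : List I) (β : D.PosRoot)
    (h : D.IsNonneg (-((D.wordProd l)⁻¹ : P ≃ₗ[ℤ] P) β.root)) :
    ∃ l₁ t l₂, l = l₁ ++ t :: l₂ ∧ β.reflection * D.wordProd l = D.wordProd (l₁ ++ l₂) := by
  induction l generalizing β with
  | nil => exact absurd h (by simpa using β.not_isNonneg_neg)
  | cons i l ih =>
    by_cases hi : β.root = D.simpleRoot i
    · obtain rfl : β = simplePosRoot i := PosRoot.ext_root hi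
      exact ⟨[], i, l, rfl, by
        rw [reflection_simplePosRoot, wordProd_cons, ← mul_assoc, simpleReflection_mul_self,
          one_mul, List.nil_append]⟩
    -- Here `sᵢ β` is still positive and is made negative by the rest of the word, so the deleted
    -- letter is found there; conjugation by `sᵢ` carries the result back.
    · obtain ⟨γ, hγ⟩ := PosRoot.exists_map (D.simpleReflection_mem i) β
      have hγ' : D.simpleReflection i β.root = γ.root := by
        rcases hγ with hγ | hγ
        · exact hγ
        · have := PosRoot.isNonneg_simpleReflection hi
          rw [hγ] at this
          exact absurd this γ.not_isNonneg_neg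
      obtain ⟨l₁, t, l₂, rfl, h'⟩ := ih γ (by
        rwa [wordProd_cons, mul_inv_rev, simpleReflection_inv, LinearEquiv.mul_apply, hγ'] at h)
      refine ⟨i :: l₁, t, l₂, rfl, ?_⟩
      have hc := PosRoot.mul_reflection_of_map (D.simpleReflection_mem i) hγ
      have hc' : β.reflection * D.simpleReflection i = D.simpleReflection i * γ.reflection := by
        have h1 : D.simpleReflection i * (D.simpleReflection i * β.reflection) *
          D.simpleReflection i = D.simpleReflection i * (γ.reflection * D.simpleReflection i) *
          D.simpleReflection i := by rw [hc]
        rwa [← mul_assoc, simpleReflection_mul_self, one_mul, mul_assoc, mul_assoc,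
          simpleReflection_mul_self, mul_one] at h1
      rw [wordProd_cons, ← mul_assoc, hc', mul_assoc, h', List.cons_append, wordProd_cons]

variable (D)

/-- `w⁻¹ αᵢ` is a positive root. -/
def IsAscent (i : I) (w : P ≃ₗ[ℤ] P) : Prop :=
  D.IsNonneg ((w⁻¹ : P ≃ₗ[ℤ] P) (D.simpleRoot i))

variable {D} {i : I} {w : P ≃ₗ[ℤ] P}

theorem isAscent_one (i : I) : D.IsAscent i 1 := by
  simpa [IsAscent] using D.isNonneg_simpleRoot i

theorem not_isAscent_iff (hw : w ∈ D.weylGroup) :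
    ¬ D.IsAscent i w ↔ D.IsNonneg (-(w⁻¹ : P ≃ₗ[ℤ] P) (D.simpleRoot i)) := by
  refine ⟨fun h => (D.isNonneg_or_neg (inv_mem hw) i).resolve_left h, fun h h' => ?_⟩
  have h0 := eq_zero_of_isNonneg h' h
  rw [map_eq_zero_iff _ (w⁻¹ : P ≃ₗ[ℤ] P).injective] at h0
  exact (simplePosRoot i : D.PosRoot).root_ne_zero h0

theorem isAscent_simpleReflection_mul (hw : w ∈ D.weylGroup) :
    D.IsAscent i (D.simpleReflection i * w) ↔ ¬ D.IsAscent i w := by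
  rw [not_isAscent_iff hw, IsAscent, mul_inv_rev, simpleReflection_inv, LinearEquiv.mul_apply,
    simpleReflection_simpleRoot, map_neg]

theorem isAscent_of_map_root {β : D.PosRoot} (h : w β.root = D.simpleRoot i) :
    D.IsAscent i w := by
  rw [IsAscent, ← h, inv_apply_apply]
  exact β.isNonneg

theorem not_isAscent_of_map_root {β : D.PosRoot} (h : w β.root = -D.simpleRoot i) :
    ¬ D.IsAscent i w := by
  rw [← neg_eq_iff_eq_neg] at h
  rw [IsAscent, ← h, map_neg, inv_apply_apply]
  exact β.not_isNonneg_neg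

theorem IsAscent.map_root_eq {β : D.PosRoot} (h : D.IsAscent i w)
    (h' : w β.root = D.simpleRoot i ∨ w β.root = -D.simpleRoot i) :
    w β.root = D.simpleRoot i :=
  h'.resolve_right fun h'' => not_isAscent_of_map_root h'' h

theorem length_reflection_mul_lt (hw : w ∈ D.weylGroup) {β : D.PosRoot}
    (h : D.IsNonneg (-(w⁻¹ : P ≃ₗ[ℤ] P) β.root)) : D.length (β.reflection * w) < D.length w := by
  obtain ⟨l, rfl, hl⟩ := D.exists_reduced_word hw
  obtain ⟨l₁, t, l₂, rfl, h'⟩ := exists_deletion l β h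
  rw [h', ← hl]
  have := D.length_le (l₁ ++ l₂)
  simp only [List.length_append, List.length_cons] at this ⊢
  omega

theorem IsAscent.length_eq (hw : w ∈ D.weylGroup) (h : D.IsAscent i w) :
    D.length (D.simpleReflection i * w) = D.length w + 1 := by
  refine le_antisymm (D.length_simpleReflection_mul_le hw i) ?_
  have hs := mul_mem (D.simpleReflection_mem i) hw
  have h1 := length_reflection_mul_lt (β := simplePosRoot i) hs
    ((not_isAscent_iff hs).1 (by rwa [isAscent_simpleReflection_mul hw, not_not]))
  rwa [reflection_simplePosRoot, ← mul_assoc, simpleReflection_mul_self, one_mul] at h1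

theorem length_of_not_isAscent (hw : w ∈ D.weylGroup) (h : ¬ D.IsAscent i w) :
    D.length (D.simpleReflection i * w) + 1 = D.length w := by
  have := IsAscent.length_eq (mul_mem (D.simpleReflection_mem i) hw)
    ((isAscent_simpleReflection_mul hw).2 h)
  rw [← this, ← mul_assoc, simpleReflection_mul_self, one_mul]

/-- A cover `w ⋖ w s_β` sends `β` to a positive root. -/
theorem BruhatCover.exists_map_root (hw : w ∈ D.weylGroup) {β : D.PosRoot}
    (h : D.BruhatCover w (w * β.reflection)) : ∃ γ : D.PosRoot, w β.root = γ.root := by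
  obtain ⟨γ, hγ⟩ := β.exists_map hw
  refine ⟨γ, hγ.resolve_right fun hn => ?_⟩
  have h1 : D.IsNonneg (-(w⁻¹ : P ≃ₗ[ℤ] P) γ.root) := by
    rw [← neg_eq_iff_eq_neg] at hn
    rw [← hn, map_neg, neg_neg, inv_apply_apply]
    exact β.isNonneg
  have h2 := length_reflection_mul_lt hw h1
  rw [← PosRoot.mul_reflection_of_map hw hγ, h.2] at h2
  omega

/-- The lifting property for covers. -/
theorem IsAscent.of_cover (hw : w ∈ D.weylGroup) {β : D.PosRoot}
    (h : D.BruhatCover w (w * β.reflection)) (ha : D.IsAscent i w)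
    (hne : ¬ (w β.root = D.simpleRoot i ∨ w β.root = -D.simpleRoot i)) :
    D.IsAscent i (w * β.reflection) := by
  by_contra hn
  obtain ⟨γ, hγ⟩ := BruhatCover.exists_map_root hw h
  set v := w * β.reflection with hv
  have hvW : v ∈ D.weylGroup := mul_mem hw β.reflection_mem
  have hconj : v = γ.reflection * w := PosRoot.mul_reflection_of_map hw (.inl hγ)
  have hwv : γ.reflection * v = w := by
    rw [hconj, ← mul_assoc, PosRoot.reflection_mul_self, one_mul]
  have hl := length_of_not_isAscent hvW hn
  -- If `v` is a descent, it has a reduced word starting with `i`; by strong exchange `w` arises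
  -- from that word by deleting one letter.
  obtain ⟨l, hlw, hll⟩ := D.exists_reduced_word (mul_mem (D.simpleReflection_mem i) hvW)
  have hlv : D.wordProd (i :: l) = v := by
    rw [wordProd_cons, hlw, ← mul_assoc, simpleReflection_mul_self, one_mul]
  have hneg : D.IsNonneg (-((D.wordProd (i :: l))⁻¹ : P ≃ₗ[ℤ] P) γ.root) := by
    have h1 : v (-β.root) = γ.root := by
      rw [hv, LinearEquiv.mul_apply, map_neg, PosRoot.reflection_root, neg_neg, hγ]
    rw [hlv, ← h1, inv_apply_apply, neg_neg]
    exact β.isNonneg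
  obtain ⟨l₁, t, l₂, hsplit, hdel⟩ := exists_deletion (i :: l) γ hneg
  rw [hlv, hwv] at hdel
  -- If the initial `i` is deleted, the reflection is `sᵢ` and `w β = αᵢ`, which is excluded.
  -- Otherwise `w` keeps the initial `i`, so that `sᵢ w` is shorter than `w`, although `i` is an
  -- ascent of `w`.
  rcases l₁ with - | ⟨i', l₁⟩
  · simp only [List.nil_append, List.cons.injEq] at hsplit
    obtain ⟨rfl, rfl⟩ := hsplit
    rw [List.nil_append, hlw] at hdel
    have hrefl : γ.reflection = D.simpleReflection i := by
      have : γ.reflection * v = D.simpleReflection i * v := by rw [hwv, ← hdel]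
      exact mul_right_cancel this
    have h2 : γ.root = D.simpleRoot i := by
      by_contra h2
      have h3 := PosRoot.isNonneg_simpleReflection h2
      rw [← hrefl, γ.reflection_root] at h3
      exact γ.not_isNonneg_neg h3
    exact hne (.inl (hγ.trans h2))
  · simp only [List.cons_append, List.cons.injEq] at hsplit
    obtain ⟨rfl, rfl⟩ := hsplit
    have h1 := ha.length_eq hw
    rw [hdel, List.cons_append, wordProd_cons, ← mul_assoc, simpleReflection_mul_self, one_mul,
      ← wordProd_cons, ← List.cons_append, ← hdel] at h1
    have h2 := D.length_le (l₁ ++ l₂)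
    have h3 := h.2
    simp only [List.length_append, List.length_cons] at h2 hll
    omega

/-- Multiplying a cover on the left by a simple reflection that is an ascent of both sides. -/
theorem BruhatCover.simpleReflection_mul (hw : w ∈ D.weylGroup) {β : D.PosRoot}
    (h : D.BruhatCover w (w * β.reflection))
    (ha : D.IsAscent i w ↔ D.IsAscent i (w * β.reflection)) :
    D.BruhatCover (D.simpleReflection i * w) (D.simpleReflection i * w * β.reflection) := by
  refine ⟨⟨β, rfl⟩, ?_⟩
  have hv := mul_mem hw β.reflection_mem
  have h2 := h.2
  rw [mul_assoc]
  by_cases hA : D.IsAscent i w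
  · rw [hA.length_eq hw, (ha.1 hA).length_eq hv, h2]
  · have h3 := length_of_not_isAscent hw hA
    have h4 := length_of_not_isAscent hv (mt ha.2 hA)
    omega

theorem simpleReflection_mul_eq (hw : w ∈ D.weylGroup) {β : D.PosRoot}
    (h : w β.root = D.simpleRoot i ∨ w β.root = -D.simpleRoot i) :
    w * β.reflection = D.simpleReflection i * w := by
  simpa using PosRoot.mul_reflection_of_map (γ := simplePosRoot i) hw h

theorem bruhatCover_of_map_root (hw : w ∈ D.weylGroup) {β : D.PosRoot}
    (h : w β.root = D.simpleRoot i) : D.BruhatCover w (w * β.reflection) :=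
  ⟨⟨β, rfl⟩, by
    rw [simpleReflection_mul_eq hw (.inl h), (isAscent_of_map_root h).length_eq hw]⟩

/-- The sign of `⟨w ρ, αᵢ^∨⟩` tells ascents from descents. -/
theorem simpleCoroot_rho_neg_iff (hw : w ∈ D.weylGroup) :
    D.simpleCoroot i (w D.rho) < 0 ↔ ¬ D.IsAscent i w := by
  -- Pairing a coroot with `ρ` gives its height, so the sign of `⟨wρ, αᵢ^∨⟩` is the sign of `w⁻¹
  -- αᵢ`.
  have hrho : ∀ β : D.PosRoot, 0 < β.coroot D.rho := by
    intro β
    have hfw : ∀ j, D.simpleCoroot j D.rho = 1 := by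
      intro j
      rw [rho, map_sum, Finset.sum_eq_single j (fun i _ h => D.fundamentalWeight_ne i j h)
        (by simp), D.fundamentalWeight_self]
    rw [β.coroot_eq_sum]
    simp only [LinearMap.sum_apply, LinearMap.smul_apply, smul_eq_mul, hfw, mul_one]
    exact β.sum_coeff_pos
  obtain ⟨β, hβ⟩ := exists_posRoot (inv_mem hw) i
  rcases hβ with h | h
  · have h1 : w β.root = D.simpleRoot i := by rw [← h, apply_inv_apply]
    have h2 := PosRoot.coroot_apply_of_map (γ := simplePosRoot i) hw h1 D.rho
    rw [coroot_simplePosRoot] at h2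
    have := hrho β
    exact iff_of_false (by omega) (not_not.2 (isAscent_of_map_root h1))
  · have h1 : w β.root = -D.simpleRoot i := by
      rw [← neg_eq_iff_eq_neg, ← map_neg, ← h, apply_inv_apply]
    have h2 := PosRoot.coroot_apply_of_map_neg (γ := simplePosRoot i) hw h1 D.rho
    rw [coroot_simplePosRoot] at h2
    have := hrho β
    exact iff_of_true (by omega) (not_isAscent_of_map_root h1)

end KacMoodyDatum

end AlcovePath

/-! ### Words in `+` and `-`. -/

namespace AlcovePath

/-! ### Cancellation of pairs `- +` -/

section Cancel

variable {α β : Type*} (pos : α → Prop) [DecidablePred pos]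

/-- The uncancelled `+` and the uncancelled `-` of a word. -/
def signature : List α → List α × List α
  | [] => ([], [])
  | x :: l =>
    if pos x then (x :: (signature l).1, (signature l).2)
    else match (signature l).1 with
      | [] => ([], x :: (signature l).2)
      | _ :: r => (r, (signature l).2)

theorem signature_cons_of_pos {x : α} (h : pos x) (l : List α) :
    signature pos (x :: l) = (x :: (signature pos l).1, (signature pos l).2) := by
  rw [signature, if_pos h]

theorem signature_cons_of_neg_of_nil {x : α} (h : ¬ pos x) {l : List α}
    (hl : (signature pos l).1 = []) :
    signature pos (x :: l) = ([], x :: (signature pos l).2) := by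
  rw [signature, if_neg h, hl]

theorem signature_cons_of_neg_of_cons {x y : α} (h : ¬ pos x) {l r : List α}
    (hl : (signature pos l).1 = y :: r) :
    signature pos (x :: l) = (r, (signature pos l).2) := by
  rw [signature, if_neg h, hl]

theorem cancelPairs_eq (l : List α) :
    (∀ x ∈ (signature pos l).1, pos x) ∧ (∀ x ∈ (signature pos l).2, ¬ pos x) ∧
      cancelPairs pos l = (signature pos l).1 ++ (signature pos l).2 := by
  induction l with
  | nil => simp [signature, cancelPairs]
  | cons x l ih =>
    obtain ⟨h1, h2, h3⟩ := ih
    rw [cancelPairs]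
    by_cases hx : pos x
    · rw [signature_cons_of_pos pos hx]
      refine ⟨by simpa [hx] using h1, h2, ?_⟩
      simp only [List.cons_append, ← h3]
      rcases cancelPairs pos l with - | ⟨y, r⟩
      · rfl
      · simp [hx]
    · rcases hP : (signature pos l).1 with - | ⟨y, r⟩
      · rw [signature_cons_of_neg_of_nil pos hx hP]
        refine ⟨by simp, by simpa [hx] using h2, ?_⟩
        rw [hP, List.nil_append] at h3
        rw [h3]
        rcases hM : (signature pos l).2 with - | ⟨y, r⟩
        · rfl
        · have : ¬ pos y := h2 y (by rw [hM]; simp)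
          simp [this]
      · rw [signature_cons_of_neg_of_cons pos hx hP]
        rw [hP] at h1
        refine ⟨fun z hz => h1 z (by simp [hz]), h2, ?_⟩
        rw [h3, hP, List.cons_append]
        simp [hx, h1 y (by simp)]

theorem filter_pos_cancelPairs (l : List α) :
    (cancelPairs pos l).filter (fun x => decide (pos x)) = (signature pos l).1 := by
  obtain ⟨h1, h2, h3⟩ := cancelPairs_eq pos l
  rw [h3, List.filter_append, List.filter_eq_self.2 (by simpa using h1),
    List.filter_eq_nil_iff.2 (by simpa using h2), List.append_nil]

theorem filter_neg_cancelPairs (l : List α) :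
    (cancelPairs pos l).filter (fun x => decide (¬ pos x)) = (signature pos l).2 := by
  obtain ⟨h1, h2, h3⟩ := cancelPairs_eq pos l
  rw [h3, List.filter_append, List.filter_eq_nil_iff.2 (by simpa using h1),
    List.filter_eq_self.2 (by simpa using h2), List.nil_append]

theorem signature_congr {pos' : α → Prop} [DecidablePred pos'] {l : List α}
    (h : ∀ x ∈ l, pos x ↔ pos' x) : signature pos l = signature pos' l := by
  induction l with
  | nil => rfl
  | cons x l ih =>
    rw [signature, signature, ih fun y hy => h y (by simp [hy])]
    simp only [h x (by simp)]

theorem signature_map {pos' : β → Prop} [DecidablePred pos'] (g : α → β) {l : List α}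
    (h : ∀ x ∈ l, pos' (g x) ↔ pos x) :
    signature pos' (l.map g) = ((signature pos l).1.map g, (signature pos l).2.map g) := by
  induction l with
  | nil => rfl
  | cons x l ih =>
    have ih := ih fun y hy => h y (by simp [hy])
    rw [List.map_cons, signature, signature, ih]
    simp only [h x (by simp)]
    split_ifs
    · rfl
    · rcases (signature pos l).1 with - | ⟨y, r⟩ <;> rfl

theorem signature_append_of_pos {l l' : List α} (h : ∀ x ∈ l, pos x) :
    signature pos (l ++ l') = (l ++ (signature pos l').1, (signature pos l').2) := by
  induction l with
  | nil => rfl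
  | cons x l ih =>
    rw [List.cons_append, signature_cons_of_pos pos (h x (by simp)),
      ih fun y hy => h y (by simp [hy])]
    rfl

/-- A cancellation across the boundary would need a `+` surviving in `Y`. -/
theorem signature_append_of_fst_eq_nil {X Y : List α} (h : (signature pos Y).1 = []) :
    signature pos (X ++ Y) = ((signature pos X).1, (signature pos X).2 ++ (signature pos Y).2) := by
  induction X with
  | nil => exact Prod.ext h rfl
  | cons x X ih =>
    rw [List.cons_append, signature, signature, ih]
    split_ifs
    · rfl
    · rcases (signature pos X).1 with - | ⟨y, r⟩ <;> rfl

/-- With no `-` left on its left and no `+` left on its right, the letter `a` survives and is the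
last `+`. Together with `signature_append_neg` this shows what an operator does: changing this one
letter moves it from one side of the reduced word to the other. -/
theorem signature_append_pos {X Y : List α} {a : α} (ha : pos a)
    (hX : (signature pos X).2 = []) (hY : (signature pos Y).1 = []) :
    signature pos (X ++ a :: Y) = ((signature pos X).1 ++ [a], (signature pos Y).2) := by
  induction X with
  | nil => rw [List.nil_append, signature_cons_of_pos pos ha, hY]; rfl
  | cons x X ih =>
    rw [signature] at hX
    rw [List.cons_append, signature, signature]
    split_ifs at hX ⊢ with hx
    · rw [ih hX]; rfl
    · rcases hP : (signature pos X).1 with - | ⟨y, r⟩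
      · simp [hP] at hX
      · rw [hP] at hX
        rw [ih hX, hP]
        rfl

theorem signature_append_neg {X Y : List α} {a : α} (ha : ¬ pos a)
    (hX : (signature pos X).2 = []) (hY : (signature pos Y).1 = []) :
    signature pos (X ++ a :: Y) = ((signature pos X).1, a :: (signature pos Y).2) := by
  have h := signature_cons_of_neg_of_nil pos ha hY
  rw [signature_append_of_fst_eq_nil pos (by rw [h]), h, hX, List.nil_append]

/-- The converse of `signature_append_pos`: the rightmost surviving `+` cuts the word into pieces
that do not interact. -/
theorem exists_split_of_last_pos {S : List α} {a : α}
    (h : (signature pos S).1.getLast? = some a) :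
    ∃ X Y, S = X ++ a :: Y ∧ pos a ∧ (signature pos X).2 = [] ∧ (signature pos Y).1 = [] := by
  induction S with
  | nil => simp [signature] at h
  | cons x S ih =>
    by_cases hx : pos x
    · rw [signature_cons_of_pos pos hx] at h
      rcases hP : (signature pos S).1 with - | ⟨y, r⟩
      · rw [hP] at h
        simp at h
        subst h
        exact ⟨[], S, rfl, hx, rfl, hP⟩
      · rw [hP, List.getLast?_cons_cons, ← hP] at h
        obtain ⟨X, Y, rfl, ha, hX, hY⟩ := ih h
        exact ⟨x :: X, Y, rfl, ha, by rw [signature_cons_of_pos pos hx, hX], hY⟩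
    · rcases hP : (signature pos S).1 with - | ⟨y, r⟩
      · rw [signature_cons_of_neg_of_nil pos hx hP] at h
        simp at h
      · rw [signature_cons_of_neg_of_cons pos hx hP] at h
        have h' : (signature pos S).1.getLast? = some a := by
          rw [hP]
          rcases r with - | ⟨z, r⟩
          · simp at h
          · rwa [List.getLast?_cons_cons]
        obtain ⟨X, Y, rfl, ha, hX, hY⟩ := ih h'
        refine ⟨x :: X, Y, rfl, ha, ?_, hY⟩
        rw [signature_append_pos pos ha hX hY] at hP
        rcases hPX : (signature pos X).1 with - | ⟨z, s⟩
        · rw [hPX] at hP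
          simp at hP
          rw [hP.2] at h
          simp at h
        · rw [signature_cons_of_neg_of_cons pos hx hPX, hX]

theorem exists_split_of_head_neg {S : List α} {a : α}
    (h : (signature pos S).2.head? = some a) :
    ∃ X Y, S = X ++ a :: Y ∧ ¬ pos a ∧ (signature pos X).2 = [] ∧ (signature pos Y).1 = [] := by
  induction S with
  | nil => simp [signature] at h
  | cons x S ih =>
    by_cases hx : pos x
    · rw [signature_cons_of_pos pos hx] at h
      obtain ⟨X, Y, rfl, ha, hX, hY⟩ := ih h
      exact ⟨x :: X, Y, rfl, ha, by rw [signature_cons_of_pos pos hx, hX], hY⟩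
    · rcases hP : (signature pos S).1 with - | ⟨y, r⟩
      · rw [signature_cons_of_neg_of_nil pos hx hP] at h
        simp at h
        subst h
        exact ⟨[], S, rfl, hx, rfl, hP⟩
      · rw [signature_cons_of_neg_of_cons pos hx hP] at h
        obtain ⟨X, Y, rfl, ha, hX, hY⟩ := ih h
        refine ⟨x :: X, Y, rfl, ha, ?_, hY⟩
        rw [signature_append_neg pos ha hX hY] at hP
        rw [signature_cons_of_neg_of_cons pos hx hP, hX]

/-- A leading `+` has nothing on its left to cancel with. Dually, a final `-` has nothing on its
right, which gives `pos_last`. These two remarks determine the neighbours of the letter at which an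
operator acts. -/
theorem not_pos_head {y : α} {Y : List α} (h : (signature pos (y :: Y)).1 = []) : ¬ pos y :=
  fun hy => by simp [signature_cons_of_pos pos hy] at h

theorem pos_last {x : α} {X : List α} (h : (signature pos (X ++ [x])).2 = []) : pos x := by
  by_contra hx
  have h1 : signature pos [x] = ([], [x]) := by simp [signature, hx]
  rw [signature_append_of_fst_eq_nil pos (by rw [h1]), h1] at h
  simp at h

/-- Cancelling a pair `- +` does not change the sum of the signs. -/
theorem signature_length_sub (S : List α) :
    ((signature pos S).1.length : ℤ) - (signature pos S).2.length =
      (S.map fun x => if pos x then (1 : ℤ) else -1).sum := by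
  induction S with
  | nil => rfl
  | cons x S ih =>
    rw [List.map_cons, List.sum_cons, ← ih]
    by_cases hx : pos x
    · rw [signature_cons_of_pos pos hx, if_pos hx]
      push_cast [List.length_cons]
      ring
    · rw [if_neg hx]
      rcases hP : (signature pos S).1 with - | ⟨y, r⟩
      · rw [signature_cons_of_neg_of_nil pos hx hP]
        push_cast [List.length_cons, List.length_nil]
        ring
      · rw [signature_cons_of_neg_of_cons pos hx hP]
        push_cast [List.length_cons]
        ring

end Cancel

end AlcovePath

/-! ### Chains of covers, the order on the chain, and ascents before a position. -/

namespace AlcovePath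

namespace KacMoodyDatum

set_option linter.unusedSectionVars false

variable {I P : Type*} [Fintype I] [AddCommGroup P] (D : KacMoodyDatum I P)

/-! ### Chains of covers along a list of folding positions -/

@[simp] theorem reflProd_nil : D.reflProd [] = 1 := rfl

@[simp] theorem reflProd_cons (x : D.Fold) (l : List D.Fold) :
    D.reflProd (x :: l) = x.posRoot.reflection * D.reflProd l := by simp [reflProd]

@[simp] theorem reflProd_append (l l' : List D.Fold) :
    D.reflProd (l ++ l') = D.reflProd l * D.reflProd l' := by simp [reflProd]

theorem reflProd_mem (l : List D.Fold) : D.reflProd l ∈ D.weylGroup := by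
  induction l with
  | nil => exact one_mem _
  | cons x l ih => rw [reflProd_cons]; exact mul_mem x.posRoot.reflection_mem ih

/-- `u ⋖ u r_{j₁} ⋖ u r_{j₁} r_{j₂} ⋖ ⋯` along the list. -/
def CoverChain : (P ≃ₗ[ℤ] P) → List D.Fold → Prop
  | _, [] => True
  | u, x :: l => D.BruhatCover u (u * x.posRoot.reflection) ∧
      CoverChain (u * x.posRoot.reflection) l

/-- `u β = ± αᵢ`. -/
def Hits (i : I) (u : P ≃ₗ[ℤ] P) (β : D.PosRoot) : Prop :=
  u β.root = D.simpleRoot i ∨ u β.root = -D.simpleRoot i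

/-- No root `β` of the list satisfies `u r_{j₁} ⋯ r_{j_t} β = ± αᵢ` when it is reached. -/
def NoFold (i : I) : (P ≃ₗ[ℤ] P) → List D.Fold → Prop
  | _, [] => True
  | u, x :: l => ¬ D.Hits i u x.posRoot ∧ NoFold i (u * x.posRoot.reflection) l

variable {D} {i : I} {u : P ≃ₗ[ℤ] P}

theorem coverChain_append {l l' : List D.Fold} :
    D.CoverChain u (l ++ l') ↔ D.CoverChain u l ∧ D.CoverChain (u * D.reflProd l) l' := by
  induction l generalizing u with
  | nil => simp [CoverChain]
  | cons x l ih => simp [CoverChain, ih, and_assoc, mul_assoc]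

theorem coverChain_iff {l : List D.Fold} :
    D.CoverChain u l ↔ ∀ t < l.length, D.BruhatCover (u * D.reflProd (l.take t))
      (u * D.reflProd (l.take (t + 1))) := by
  induction l generalizing u with
  | nil => simp [CoverChain]
  | cons x l ih =>
    rw [CoverChain, ih]
    constructor
    · rintro ⟨h, h'⟩ (- | t) ht
      · simpa using h
      · simpa [mul_assoc] using h' t (by simpa using ht)
    · refine fun h => ⟨by simpa using h 0 (by simp), fun t ht => ?_⟩
      simpa [mul_assoc] using h (t + 1) (by simpa using ht)

theorem noFold_iff {l : List D.Fold} :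
    D.NoFold i u l ↔
      ∀ p x q, l = p ++ x :: q → ¬ D.Hits i (u * D.reflProd p) x.posRoot := by
  induction l generalizing u with
  | nil => simp [NoFold]
  | cons y l ih =>
    rw [NoFold, ih]
    constructor
    · rintro ⟨h, h'⟩ (- | ⟨z, p⟩) x q hl
      · simp only [List.nil_append, List.cons.injEq] at hl
        rw [← hl.1]
        simpa using h
      · simp only [List.cons_append, List.cons.injEq] at hl
        rw [← hl.1, reflProd_cons, ← mul_assoc]
        exact h' p x q hl.2
    · refine fun h => ⟨by simpa using h [] y l rfl, fun p x q hl => ?_⟩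
      simpa [mul_assoc] using h (y :: p) x q (by rw [hl]; rfl)

/-- The reflection `sᵢ` exchanges `αᵢ` and `-αᵢ`; this is why the set `I_{αᵢ}` survives the
operators. -/
theorem hits_simpleReflection_mul {β : D.PosRoot} :
    D.Hits i (D.simpleReflection i * u) β ↔ D.Hits i u β := by
  have h : ∀ x, D.simpleReflection i x = -D.simpleRoot i ↔ x = D.simpleRoot i := fun x => by
    rw [← simpleReflection_simpleRoot, (D.simpleReflection i).injective.eq_iff]
  have h' : ∀ x, D.simpleReflection i x = D.simpleRoot i ↔ x = -D.simpleRoot i := fun x => by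
    rw [← (D.simpleReflection i).injective.eq_iff (b := -D.simpleRoot i), map_neg,
      simpleReflection_simpleRoot, neg_neg]
  rw [Hits, Hits, LinearEquiv.mul_apply, h, h', or_comm]

theorem noFold_simpleReflection_mul {l : List D.Fold} :
    D.NoFold i (D.simpleReflection i * u) l ↔ D.NoFold i u l := by
  simp only [noFold_iff, mul_assoc, hits_simpleReflection_mul]

/-- The lifting property, applied cover by cover. -/
theorem CoverChain.isAscent (hu : u ∈ D.weylGroup) {l : List D.Fold} (h : D.CoverChain u l)
    (hn : D.NoFold i u l) (ha : D.IsAscent i u) : D.IsAscent i (u * D.reflProd l) := by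
  induction l generalizing u with
  | nil => simpa using ha
  | cons x l ih =>
    rw [reflProd_cons, ← mul_assoc]
    exact ih (mul_mem hu x.posRoot.reflection_mem) h.2 hn.2 (ha.of_cover hu h.1 hn.1)

/-- All partial products are ascents, so left multiplication by `sᵢ` raises every length by one and
covers remain covers. -/
theorem CoverChain.simpleReflection_mul (hu : u ∈ D.weylGroup) {l : List D.Fold}
    (h : D.CoverChain u l) (hn : D.NoFold i u l) (ha : D.IsAscent i u) :
    D.CoverChain (D.simpleReflection i * u) l := by
  induction l generalizing u with
  | nil => trivial
  | cons x l ih =>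
    have h1 := ha.of_cover hu h.1 hn.1
    refine ⟨h.1.simpleReflection_mul hu (iff_of_true ha h1), ?_⟩
    rw [mul_assoc]
    exact ih (mul_mem hu x.posRoot.reflection_mem) h.2 hn.2 h1

/-- Ascents persist, so a descent at the end forces descents all along; left multiplication by `sᵢ`
then lowers every length by one. -/
theorem CoverChain.simpleReflection_mul_of_not (hu : u ∈ D.weylGroup) {l : List D.Fold}
    (h : D.CoverChain u l) (hn : D.NoFold i u l) (ha : ¬ D.IsAscent i (u * D.reflProd l)) :
    D.CoverChain (D.simpleReflection i * u) l := by
  induction l generalizing u with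
  | nil => trivial
  | cons x l ih =>
    rw [reflProd_cons, ← mul_assoc] at ha
    have hv := mul_mem hu x.posRoot.reflection_mem
    have h1 : ¬ D.IsAscent i (u * x.posRoot.reflection) := fun h' => ha (h.2.isAscent hv hn.2 h')
    refine ⟨h.1.simpleReflection_mul hu
      (iff_of_false (fun h' => h1 (h'.of_cover hu h.1 hn.1)) h1), ?_⟩
    rw [mul_assoc]
    exact ih hv h.2 hn.2 ha

/-! ### The order of the chain and sorted lists -/

theorem root_ext {x y : D.Fold} (h : x.posRoot = y.posRoot) (h' : x.level = y.level) : x = y :=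
  Prod.ext h h'

variable [LinearOrder I] {lam : P}

theorem coroot_pos_of_mem {x : D.Fold} (hx : x ∈ D.chainSet lam) : 0 < x.posRoot.coroot lam :=
  hx.1.trans_lt hx.2

/-- The last coordinates make the two coroots proportional, hence the roots equal; the first
coordinate then fixes the level. -/
theorem lexKey_injOn {x y : D.Fold} (hx : x ∈ D.chainSet lam) (hy : y ∈ D.chainSet lam)
    (h : D.lexKey lam x = D.lexKey lam y) : x = y := by
  have h1 := coroot_pos_of_mem hx
  have h2 := coroot_pos_of_mem hy
  have h1' : (0 : ℚ) < x.posRoot.coroot lam := by exact_mod_cast h1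
  have h2' : (0 : ℚ) < y.posRoot.coroot lam := by exact_mod_cast h2
  have ha := congrArg Prod.fst (toLex.injective h)
  have hb := toLex.injective (congrArg Prod.snd (toLex.injective h))
  have hr : x.posRoot = y.posRoot := by
    refine PosRoot.eq_of_smul_coeff_eq h2 h1 fun j => ?_
    have : (x.posRoot.coeff j : ℚ) / x.posRoot.coroot lam =
      y.posRoot.coeff j / y.posRoot.coroot lam := congrFun hb j
    rw [div_eq_div_iff h1'.ne' h2'.ne'] at this
    have := (by exact_mod_cast this : x.posRoot.coeff j * y.posRoot.coroot lam =
      y.posRoot.coeff j * x.posRoot.coroot lam)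
    linarith
  refine root_ext hr ?_
  simp only [hr] at ha
  rw [div_left_inj' h2'.ne'] at ha
  exact_mod_cast ha

theorem chainLT_trans {x y z : D.Fold} (h : D.chainLT lam x y) (h' : D.chainLT lam y z) :
    D.chainLT lam x z := lt_trans h h'

theorem chainLT_asymm {x y : D.Fold} (h : D.chainLT lam x y) : ¬ D.chainLT lam y x :=
  lt_asymm h

theorem chainLT_irrefl (x : D.Fold) : ¬ D.chainLT lam x x := lt_irrefl _

theorem chainLT_of_not_of_ne {x y : D.Fold} (hx : x ∈ D.chainSet lam) (hy : y ∈ D.chainSet lam)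
    (h : ¬ D.chainLT lam x y) (hne : x ≠ y) : D.chainLT lam y x :=
  lt_of_le_of_ne (not_lt.1 h) fun h' => hne (lexKey_injOn hx hy h'.symm)

theorem mem_sorted {J : Finset D.Fold} {x : D.Fold} : x ∈ D.sorted lam J ↔ x ∈ J := by
  classical
  rw [sorted, (List.perm_insertionSort _ _).mem_iff, Finset.mem_toList]

theorem nodup_sorted (J : Finset D.Fold) : (D.sorted lam J).Nodup :=
  (List.perm_insertionSort _ _).nodup_iff.2 J.nodup_toList

theorem length_sorted (J : Finset D.Fold) : (D.sorted lam J).length = J.card := by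
  rw [sorted, List.length_insertionSort, Finset.length_toList]

theorem pairwise_le_sorted (J : Finset D.Fold) :
    (D.sorted lam J).Pairwise fun x y => D.lexKey lam x ≤ D.lexKey lam y := by
  classical
  have : Std.Total fun x y : D.Fold => D.lexKey lam x ≤ D.lexKey lam y :=
    ⟨fun x y => le_total _ _⟩
  have : IsTrans D.Fold fun x y : D.Fold => D.lexKey lam x ≤ D.lexKey lam y :=
    ⟨fun x y z => le_trans⟩
  exact List.pairwise_insertionSort _ _

theorem pairwise_sorted {J : Finset D.Fold} (hJ : ∀ x ∈ J, x ∈ D.chainSet lam) :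
    (D.sorted lam J).Pairwise (D.chainLT lam) := by
  have h := (pairwise_le_sorted (lam := lam) J).and (nodup_sorted (lam := lam) J)
  refine h.imp_of_mem fun {x y} hx hy hxy => ?_
  exact lt_of_le_of_ne hxy.1 fun h' => hxy.2
    (lexKey_injOn (hJ x (mem_sorted.1 hx)) (hJ y (mem_sorted.1 hy)) h')

theorem nodup_of_pairwise {L : List D.Fold} (h : L.Pairwise (D.chainLT lam)) : L.Nodup :=
  h.imp fun {x y} hxy hne => by subst hne; exact chainLT_irrefl x hxy

theorem sorted_eq {J : Finset D.Fold} {L : List D.Fold} (hJ : ∀ x ∈ J, x ∈ D.chainSet lam)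
    (hL : L.Pairwise (D.chainLT lam)) (h : ∀ x, x ∈ L ↔ x ∈ J) : D.sorted lam J = L := by
  have hp : (D.sorted lam J).Perm L :=
    (List.perm_ext_iff_of_nodup (nodup_sorted J) (nodup_of_pairwise hL)).2 fun x => by
      rw [mem_sorted, h]
  refine hp.eq_of_pairwise (fun a b _ _ hab hba => absurd hba (chainLT_asymm hab))
    (pairwise_sorted hJ) hL

theorem isAdmissible_iff {J : Finset D.Fold} : D.IsAdmissible lam J ↔
    (∀ x ∈ J, x ∈ D.chainSet lam) ∧ D.CoverChain 1 (D.sorted lam J) := by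
  rw [IsAdmissible, coverChain_iff, length_sorted]
  simp only [one_mul]

section Filter

open Classical in
theorem filter_lt_eq_self {L : List D.Fold} {k : D.Fold} (h : ∀ x ∈ L, D.chainLT lam x k) :
    (L.filter fun x => D.chainLT lam x k) = L :=
  List.filter_eq_self.2 (by simpa using h)

open Classical in
theorem filter_lt_eq_nil {L : List D.Fold} {k : D.Fold} (h : ∀ x ∈ L, ¬ D.chainLT lam x k) :
    (L.filter fun x => D.chainLT lam x k) = [] :=
  List.filter_eq_nil_iff.2 (by simpa using h)

open Classical in
theorem eq_filter_append {L : List D.Fold} (hL : L.Pairwise (D.chainLT lam)) (k : D.Fold) :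
    L = (L.filter fun x => D.chainLT lam x k) ++ L.filter fun x => ¬ D.chainLT lam x k := by
  induction L with
  | nil => rfl
  | cons y L ih =>
    rw [List.pairwise_cons] at hL
    by_cases hy : D.chainLT lam y k
    · simp only [List.filter_cons, hy, decide_true, not_true, decide_false, if_true,
        List.cons_append]
      simpa using ih hL.2
    · have h : ∀ x ∈ y :: L, ¬ D.chainLT lam x k := by
        intro x hx
        rcases List.mem_cons.1 hx with rfl | hx
        · exact hy
        · exact fun h' => hy (chainLT_trans (hL.1 x hx) h')
      rw [filter_lt_eq_nil h, List.nil_append, List.filter_eq_self.2 (by simpa using h)]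

theorem before_of_split {J : Finset D.Fold} {A B : List D.Fold} {k : D.Fold}
    (h : D.sorted lam J = A ++ B) (hA : ∀ x ∈ A, D.chainLT lam x k)
    (hB : ∀ x ∈ B, ¬ D.chainLT lam x k) : D.before lam J k = A := by
  rw [before, h, List.filter_append, filter_lt_eq_self hA, filter_lt_eq_nil hB, List.append_nil]

open Classical in
theorem sorted_eq_before_append {J : Finset D.Fold} (hJ : ∀ x ∈ J, x ∈ D.chainSet lam)
    (k : D.Fold) : D.sorted lam J =
      D.before lam J k ++ (D.sorted lam J).filter fun x => ¬ D.chainLT lam x k :=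
  eq_filter_append (pairwise_sorted hJ) k

theorem mem_before {J : Finset D.Fold} {k x : D.Fold} :
    x ∈ D.before lam J k ↔ x ∈ J ∧ D.chainLT lam x k := by
  simp [before, mem_sorted]

theorem before_of_mem_split {J : Finset D.Fold} (hJ : ∀ x ∈ J, x ∈ D.chainSet lam)
    {A B : List D.Fold} {k : D.Fold} (h : D.sorted lam J = A ++ k :: B) :
    D.before lam J k = A := by
  have hp := pairwise_sorted hJ
  rw [h, List.pairwise_append, List.pairwise_cons] at hp
  refine before_of_split h (fun x hx => hp.2.2 x hx k (by simp)) fun x hx => ?_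
  rcases List.mem_cons.1 hx with rfl | hx
  · exact chainLT_irrefl x
  · exact chainLT_asymm (hp.2.1.1 x hx)

end Filter

theorem mem_foldSet_iff {J : Finset D.Fold} {k : D.Fold} : k ∈ D.foldSet lam J i ↔
    k ∈ D.chainSet lam ∧ D.Hits i (D.reflProd (D.before lam J k)) k.posRoot := Iff.rfl

theorem IsAdmissible.mem {J : Finset D.Fold} (h : D.IsAdmissible lam J) :
    ∀ x ∈ J, x ∈ D.chainSet lam := h.1

theorem IsAdmissible.coverChain {J : Finset D.Fold} (h : D.IsAdmissible lam J) :
    D.CoverChain 1 (D.sorted lam J) := (isAdmissible_iff.1 h).2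

theorem noFold_of_not_mem {J : Finset D.Fold} (hJ : ∀ x ∈ J, x ∈ D.chainSet lam)
    {A M B : List D.Fold} (h : D.sorted lam J = A ++ M ++ B)
    (hM : ∀ x ∈ M, x ∉ D.foldSet lam J i) : D.NoFold i (D.reflProd A) M := by
  rw [noFold_iff]
  rintro p x q rfl hx
  refine hM x (by simp) ⟨hJ x ((mem_sorted (lam := lam)).1 (by rw [h]; simp)), ?_⟩
  have : D.before lam J x = A ++ p :=
    before_of_mem_split hJ (B := q ++ B) (by rw [h]; simp)
  rw [gamma, this, reflProd_append]
  exact hx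

theorem isAscent_of_split {J : Finset D.Fold} (hJ : D.IsAdmissible lam J)
    {A M B : List D.Fold} (h : D.sorted lam J = A ++ M ++ B)
    (hM : ∀ x ∈ M, x ∉ D.foldSet lam J i) (ha : D.IsAscent i (D.reflProd A)) :
    D.IsAscent i (D.reflProd (A ++ M)) := by
  have hc := hJ.coverChain
  rw [h, coverChain_append, coverChain_append, one_mul] at hc
  rw [reflProd_append]
  exact hc.1.2.isAscent (D.reflProd_mem A) (noFold_of_not_mem hJ.mem h hM) ha

/-- In terms of signs: after a `+`, the sign remains `+` as long as no fold over `αᵢ` intervenes.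
The existence of edges rests on this. -/
theorem isAscent_before_of_isAscent_before {J : Finset D.Fold} (hJ : D.IsAdmissible lam J)
    {x k : D.Fold} (hxk : D.chainLT lam x k)
    (hM : ∀ j ∈ J, ¬ D.chainLT lam j x → D.chainLT lam j k → j ∉ D.foldSet lam J i)
    (ha : D.IsAscent i (D.reflProd (D.before lam J x))) :
    D.IsAscent i (D.reflProd (D.before lam J k)) := by
  classical
  have h1 := sorted_eq_before_append hJ.mem k
  have h2 := eq_filter_append ((pairwise_sorted hJ.mem).filter
    (fun j => decide (D.chainLT lam j k))) x
  have h3 : ((D.before lam J k).filter fun j => D.chainLT lam j x) = D.before lam J x := by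
    rw [before, before, List.filter_filter]
    refine List.filter_congr fun j _ => ?_
    simpa using fun h => chainLT_trans h hxk
  change D.before lam J k = ((D.before lam J k).filter _) ++ ((D.before lam J k).filter _) at h2
  rw [h3] at h2
  rw [h2] at h1 ⊢
  refine isAscent_of_split hJ h1 (fun j hj => ?_) ha
  rw [List.mem_filter, mem_before] at hj
  exact hM j hj.1.1 (by simpa using hj.2) hj.1.2

theorem isAscent_tau_of_isAscent_before {J : Finset D.Fold} (hJ : D.IsAdmissible lam J)
    {x : D.Fold} (hM : ∀ j ∈ J, ¬ D.chainLT lam j x → j ∉ D.foldSet lam J i)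
    (ha : D.IsAscent i (D.reflProd (D.before lam J x))) : D.IsAscent i (D.tau lam J) := by
  classical
  have h1 := sorted_eq_before_append hJ.mem x
  rw [tau, h1]
  refine isAscent_of_split hJ (B := []) (by rw [List.append_nil]; exact h1) (fun j hj => ?_) ha
  rw [List.mem_filter, mem_sorted] at hj
  exact hM j hj.1 (by simpa using hj.2)

theorem isAscent_before {J : Finset D.Fold} (hJ : D.IsAdmissible lam J) {k : D.Fold}
    (hM : ∀ j ∈ J, D.chainLT lam j k → j ∉ D.foldSet lam J i) :
    D.IsAscent i (D.reflProd (D.before lam J k)) := by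
  classical
  have := isAscent_of_split hJ (A := []) (M := D.before lam J k)
    (sorted_eq_before_append hJ.mem k) (i := i) (fun j hj => ?_) (by simpa using isAscent_one i)
  · simpa using this
  · rw [mem_before] at hj
    exact hM j hj.1 hj.2

theorem isAscent_tau {J : Finset D.Fold} (hJ : D.IsAdmissible lam J)
    (hM : ∀ j ∈ J, j ∉ D.foldSet lam J i) : D.IsAscent i (D.tau lam J) := by
  have := isAscent_of_split hJ (A := []) (M := D.sorted lam J) (B := []) (by simp) (i := i)
    (fun j hj => hM j (mem_sorted.1 hj)) (by simpa using isAscent_one i)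
  rwa [List.nil_append] at this

/-- A fold of an admissible set goes up in Bruhat order, so its root is sent to a positive root; the
sign `-` is excluded. -/
theorem IsAdmissible.gamma_of_mem {J : Finset D.Fold} (hJ : D.IsAdmissible lam J) {j : D.Fold}
    (hj : j ∈ J) (hjI : j ∈ D.foldSet lam J i) : D.gamma lam J j = D.simpleRoot i := by
  obtain ⟨A, B, hAB⟩ := List.append_of_mem (mem_sorted (lam := lam).2 hj)
  have hb := before_of_mem_split hJ.mem hAB
  have hc := hJ.coverChain
  rw [hAB, coverChain_append, one_mul] at hc
  obtain ⟨γ, hγ⟩ := BruhatCover.exists_map_root (D.reflProd_mem A) hc.2.1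
  refine hjI.2.resolve_right fun h => ?_
  rw [gamma, hb, hγ] at h
  exact (simplePosRoot i : D.PosRoot).not_isNonneg_neg (h ▸ γ.isNonneg)

theorem gamma_eq_iff_isAscent {J : Finset D.Fold} {k : D.Fold} (hk : k ∈ D.foldSet lam J i) :
    D.gamma lam J k = D.simpleRoot i ↔ D.IsAscent i (D.reflProd (D.before lam J k)) :=
  ⟨fun h => isAscent_of_map_root h, fun h => h.map_root_eq hk.2⟩

end KacMoodyDatum

end AlcovePath

/-! ### The two shapes of an edge: moving a fold over `αᵢ`, or adding one. -/

namespace AlcovePath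

theorem _root_.List.exists_first_split {α : Type*} (p : α → Prop) (L : List α) (h : ∃ x ∈ L, p x) :
    ∃ A x B, L = A ++ x :: B ∧ p x ∧ ∀ y ∈ A, ¬ p y := by
  induction L with
  | nil => simp at h
  | cons y L ih =>
    by_cases hy : p y
    · exact ⟨[], y, L, rfl, hy, by simp⟩
    · obtain ⟨A, x, B, rfl, hx, hA⟩ := ih (by
        obtain ⟨x, hx, hp⟩ := h
        rcases List.mem_cons.1 hx with rfl | hx
        · exact absurd hp hy
        · exact ⟨x, hx, hp⟩)
      refine ⟨y :: A, x, B, rfl, hx, fun z hz => ?_⟩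
      rcases List.mem_cons.1 hz with rfl | hz
      · exact hy
      · exact hA z hz

theorem _root_.List.exists_last_split {α : Type*} (p : α → Prop) (L : List α) (h : ∃ x ∈ L, p x) :
    ∃ A x B, L = A ++ x :: B ∧ p x ∧ ∀ y ∈ B, ¬ p y := by
  obtain ⟨A, x, B, hL, hx, hA⟩ := List.exists_first_split p L.reverse (by simpa using h)
  refine ⟨B.reverse, x, A.reverse, ?_, hx, by simpa using hA⟩
  rw [← List.reverse_reverse L, hL]
  simp

namespace KacMoodyDatum

set_option linter.unusedSectionVars false

variable {I P : Type*} [Fintype I] [AddCommGroup P] {D : KacMoodyDatum I P}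
  [LinearOrder I] {lam : P} {i : I}

/-! ### Moving one fold across a simple reflection -/

theorem affineReflection_sub (β : D.PosRoot) (h : ℤ) (x y : P) :
    β.affineReflection h (x - y) = β.affineReflection h x - β.reflection y := by
  simp only [PosRoot.affineReflection, PosRoot.reflection_apply, map_sub]
  module

/-- The product of the affine reflections along a list of folding positions. -/
noncomputable def affineProd (L : List D.Fold) (x : P) : P :=
  L.foldr (fun j x => j.posRoot.affineReflection (-j.level) x) x

theorem affineProd_append (L L' : List D.Fold) (x : P) :
    affineProd (L ++ L') x = affineProd L (affineProd L' x) := by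
  simp [affineProd, List.foldr_append]

theorem affineProd_cons (j : D.Fold) (L : List D.Fold) (x : P) :
    affineProd (j :: L) x = j.posRoot.affineReflection (-j.level) (affineProd L x) := rfl

theorem affineProd_sub (L : List D.Fold) (x y : P) :
    affineProd L (x - y) = affineProd L x - D.reflProd L y := by
  induction L with
  | nil => rfl
  | cons j L ih =>
    rw [affineProd_cons, ih, affineReflection_sub, reflProd_cons]
    rfl

/-- The multiple is left open on purpose: it is determined later by pairing with `αᵢ^∨`, see
`IsEdge.weight_eq`. -/
theorem exists_affineProd_insert {L : List D.Fold} {a : D.Fold}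
    (h : D.reflProd L a.posRoot.root = D.simpleRoot i) (x : P) :
    ∃ n : ℤ, affineProd L (affineProd [a] x) = affineProd L x + n • D.simpleRoot i := by
  refine ⟨-(a.posRoot.coroot x - -a.level), ?_⟩
  rw [affineProd_cons, PosRoot.affineReflection, affineProd_sub, map_smul, h]
  simp only [affineProd, List.foldr_nil]
  module

theorem weight_eq {J : Finset D.Fold} : D.weight lam J = -affineProd (D.sorted lam J) (-lam) := rfl

/-- `J'` arises from `J` by replacing the fold at `m` by a fold at the earlier position `a`,
where both positions lie over `αᵢ` and no fold in between does. -/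
structure IsMove (lam : P) (i : I) (J J' : Finset D.Fold) (L₁ L₂ L₃ : List D.Fold)
    (a m : D.Fold) : Prop where
  mem : ∀ x ∈ J, x ∈ D.chainSet lam
  mem' : ∀ x ∈ J', x ∈ D.chainSet lam
  sorted_eq : D.sorted lam J = L₁ ++ (L₂ ++ m :: L₃)
  sorted_eq' : D.sorted lam J' = L₁ ++ a :: (L₂ ++ L₃)
  lt : D.chainLT lam a m
  map_left : D.reflProd L₁ a.posRoot.root = D.simpleRoot i
  map_right : D.reflProd (L₁ ++ L₂) m.posRoot.root = D.simpleRoot i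
  noFold : D.NoFold i (D.reflProd L₁) L₂

/-- `J'` arises from `J` by adding a fold at `a` over `αᵢ`, after which `J` has no fold
over `αᵢ`. -/
structure IsInsert (lam : P) (i : I) (J J' : Finset D.Fold) (L₁ L₂ : List D.Fold)
    (a : D.Fold) : Prop where
  mem : ∀ x ∈ J, x ∈ D.chainSet lam
  mem' : ∀ x ∈ J', x ∈ D.chainSet lam
  sorted_eq : D.sorted lam J = L₁ ++ L₂
  sorted_eq' : D.sorted lam J' = L₁ ++ a :: L₂
  map_left : D.reflProd L₁ a.posRoot.root = D.simpleRoot i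
  noFold : D.NoFold i (D.reflProd L₁) L₂

theorem reflProd_insert {L M : List D.Fold} {a : D.Fold}
    (h : D.reflProd L a.posRoot.root = D.simpleRoot i) :
    D.reflProd (L ++ a :: M) = D.simpleReflection i * D.reflProd (L ++ M) := by
  rw [reflProd_append, reflProd_cons, ← mul_assoc, simpleReflection_mul_eq (D.reflProd_mem L)
    (.inl h), mul_assoc, ← reflProd_append]

section Order

variable {L₁ L₂ L₃ : List D.Fold} {a m : D.Fold} {J J' : Finset D.Fold}

theorem before_eq_of_le {R R' : List D.Fold} {k : D.Fold} (h : D.sorted lam J = L₁ ++ R)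
    (h' : D.sorted lam J' = L₁ ++ R') (hR : ∀ x ∈ R, ¬ D.chainLT lam x k)
    (hR' : ∀ x ∈ R', ¬ D.chainLT lam x k) : D.before lam J' k = D.before lam J k := by
  rw [before, before, h, h', List.filter_append, List.filter_append, filter_lt_eq_nil hR,
    filter_lt_eq_nil hR']

theorem reflProd_before_insert {T T' : List D.Fold} {k : D.Fold}
    (h : D.sorted lam J = L₁ ++ (L₂ ++ T)) (h' : D.sorted lam J' = L₁ ++ a :: (L₂ ++ T'))
    (hL : ∀ x ∈ L₁, D.chainLT lam x a) (hak : D.chainLT lam a k)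
    (hT : ∀ x ∈ T, ¬ D.chainLT lam x k) (hT' : ∀ x ∈ T', ¬ D.chainLT lam x k)
    (ha : D.reflProd L₁ a.posRoot.root = D.simpleRoot i) :
    D.reflProd (D.before lam J' k) = D.simpleReflection i * D.reflProd (D.before lam J k) := by
  have hL' : ∀ x ∈ L₁, D.chainLT lam x k := fun x hx => chainLT_trans (hL x hx) hak
  rw [before, before, h, h', List.filter_append, List.filter_append, filter_lt_eq_self hL',
    List.filter_cons_of_pos (by simpa using hak), List.filter_append, List.filter_append,
    filter_lt_eq_nil hT, filter_lt_eq_nil hT', reflProd_insert ha]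

namespace IsMove

theorem order (h : IsMove lam i J J' L₁ L₂ L₃ a m) :
    (∀ x ∈ L₁, D.chainLT lam x a) ∧ (∀ x ∈ L₂, D.chainLT lam a x) ∧
      (∀ x ∈ L₂, D.chainLT lam x m) ∧ (∀ x ∈ L₃, D.chainLT lam m x) := by
  have h1 := pairwise_sorted h.mem
  have h2 := pairwise_sorted h.mem'
  rw [h.sorted_eq, List.pairwise_append, List.pairwise_append, List.pairwise_cons] at h1
  rw [h.sorted_eq', List.pairwise_append, List.pairwise_cons] at h2
  exact ⟨fun x hx => h2.2.2 x hx a (by simp), fun x hx => h2.2.1.1 x (by simp [hx]),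
    fun x hx => h1.2.1.2.2 x hx m (by simp), fun x hx => h1.2.1.2.1.1 x hx⟩

/-- Either fold amounts to a factor `sᵢ` on the left, so past `m` the two partial products agree. -/
theorem reflProd_right (h : IsMove lam i J J' L₁ L₂ L₃ a m) (M : List D.Fold) :
    D.reflProd (L₁ ++ a :: (L₂ ++ M)) = D.reflProd (L₁ ++ (L₂ ++ m :: M)) := by
  rw [reflProd_insert h.map_left, ← List.append_assoc, ← List.append_assoc,
    reflProd_insert h.map_right]

theorem before_eq (h : IsMove lam i J J' L₁ L₂ L₃ a m) {k : D.Fold} (hk : ¬ D.chainLT lam a k) :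
    D.before lam J' k = D.before lam J k := by
  obtain ⟨h1, h2, h3, h4⟩ := h.order
  refine before_eq_of_le h.sorted_eq h.sorted_eq' (fun x hx hxk => hk ?_) fun x hx hxk => hk ?_
  · simp only [List.mem_append, List.mem_cons] at hx
    rcases hx with hx | rfl | hx
    · exact chainLT_trans (h2 x hx) hxk
    · exact chainLT_trans h.lt hxk
    · exact chainLT_trans h.lt (chainLT_trans (h4 x hx) hxk)
  · simp only [List.mem_append, List.mem_cons] at hx
    rcases hx with rfl | hx | hx
    · exact hxk
    · exact chainLT_trans (h2 x hx) hxk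
    · exact chainLT_trans h.lt (chainLT_trans (h4 x hx) hxk)

theorem reflProd_before_between (h : IsMove lam i J J' L₁ L₂ L₃ a m) {k : D.Fold}
    (hak : D.chainLT lam a k) (hk : ¬ D.chainLT lam m k) :
    D.reflProd (D.before lam J' k) = D.simpleReflection i * D.reflProd (D.before lam J k) := by
  obtain ⟨h1, h2, h3, h4⟩ := h.order
  have h5 : ∀ x ∈ L₃, ¬ D.chainLT lam x k := fun x hx hxk => hk (chainLT_trans (h4 x hx) hxk)
  refine reflProd_before_insert h.sorted_eq h.sorted_eq' h1 hak (fun x hx => ?_) h5 h.map_left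
  rcases List.mem_cons.1 hx with rfl | hx
  · exact hk
  · exact h5 x hx

theorem reflProd_before_right (h : IsMove lam i J J' L₁ L₂ L₃ a m) {k : D.Fold}
    (hk : D.chainLT lam m k) :
    D.reflProd (D.before lam J' k) = D.reflProd (D.before lam J k) := by
  obtain ⟨h1, h2, h3, h4⟩ := h.order
  have hak := chainLT_trans h.lt hk
  have hL₁ : ∀ x ∈ L₁, D.chainLT lam x k := fun x hx => chainLT_trans (h1 x hx) hak
  have hL₂ : ∀ x ∈ L₂, D.chainLT lam x k := fun x hx => chainLT_trans (h3 x hx) hk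
  rw [before, before, h.sorted_eq, h.sorted_eq', List.filter_append, List.filter_append,
    filter_lt_eq_self hL₁, List.filter_cons_of_pos (by simpa using hak), List.filter_append,
    List.filter_append, filter_lt_eq_self hL₂, List.filter_cons_of_pos (by simpa using hk),
    h.reflProd_right]

theorem foldSet_eq (h : IsMove lam i J J' L₁ L₂ L₃ a m) :
    D.foldSet lam J' i = D.foldSet lam J i := by
  ext k
  rw [mem_foldSet_iff, mem_foldSet_iff]
  by_cases hak : D.chainLT lam a k
  · by_cases hmk : D.chainLT lam m k
    · rw [h.reflProd_before_right hmk]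
    · rw [h.reflProd_before_between hak hmk, hits_simpleReflection_mul]
  · rw [h.before_eq hak]

theorem gamma_eq (h : IsMove lam i J J' L₁ L₂ L₃ a m) {k : D.Fold}
    (hk : ¬ D.chainLT lam a k ∨ D.chainLT lam m k) : D.gamma lam J' k = D.gamma lam J k := by
  rcases hk with hk | hk
  · rw [gamma, gamma, h.before_eq hk]
  · rw [gamma, gamma, h.reflProd_before_right hk]

theorem before_left (h : IsMove lam i J J' L₁ L₂ L₃ a m) : D.before lam J' a = L₁ :=
  before_of_mem_split h.mem' h.sorted_eq'

theorem before_right (h : IsMove lam i J J' L₁ L₂ L₃ a m) : D.before lam J m = L₁ ++ L₂ :=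
  before_of_mem_split h.mem (by rw [h.sorted_eq, List.append_assoc])

theorem gamma_left (h : IsMove lam i J J' L₁ L₂ L₃ a m) :
    D.gamma lam J' a = D.simpleRoot i := by rw [gamma, h.before_left, h.map_left]

theorem gamma_right (h : IsMove lam i J J' L₁ L₂ L₃ a m) :
    D.gamma lam J m = D.simpleRoot i := by rw [gamma, h.before_right, h.map_right]

theorem gamma_right' (h : IsMove lam i J J' L₁ L₂ L₃ a m) :
    D.gamma lam J' m = -D.simpleRoot i := by
  rw [gamma, h.reflProd_before_between h.lt (chainLT_irrefl m), LinearEquiv.mul_apply]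
  change D.simpleReflection i (D.gamma lam J m) = _
  rw [h.gamma_right, simpleReflection_simpleRoot]

theorem tau_eq (h : IsMove lam i J J' L₁ L₂ L₃ a m) : D.tau lam J' = D.tau lam J := by
  rw [tau, tau, h.sorted_eq, h.sorted_eq', h.reflProd_right]

/-- The fold at `a` is a cover since `αᵢ` is an ascent there. Between `a` and `m` the chain is
multiplied by `sᵢ`, which preserves covers because the ascent persists. After `m` nothing has
changed. -/
theorem coverChain (h : IsMove lam i J J' L₁ L₂ L₃ a m)
    (hc : D.CoverChain 1 (D.sorted lam J)) : D.CoverChain 1 (D.sorted lam J') := by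
  have ha := isAscent_of_map_root h.map_left
  have hr := simpleReflection_mul_eq (D.reflProd_mem L₁) (.inl h.map_left)
  have h' := h.reflProd_right []
  rw [h.sorted_eq, coverChain_append, coverChain_append, one_mul] at hc
  rw [h.sorted_eq', coverChain_append, one_mul, CoverChain, coverChain_append, hr]
  refine ⟨hc.1, ?_, hc.2.1.simpleReflection_mul (D.reflProd_mem L₁) h.noFold ha, ?_⟩
  · rw [← hr]; exact bruhatCover_of_map_root (D.reflProd_mem L₁) h.map_left
  · convert hc.2.2.2 using 1
    simp only [reflProd_append, reflProd_cons, reflProd_nil, mul_one] at h'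
    rw [← hr, mul_assoc, h', mul_assoc]

theorem coverChain_symm (h : IsMove lam i J J' L₁ L₂ L₃ a m)
    (hc : D.CoverChain 1 (D.sorted lam J')) : D.CoverChain 1 (D.sorted lam J) := by
  have hr := simpleReflection_mul_eq (D.reflProd_mem L₁) (.inl h.map_left)
  have h' := h.reflProd_right []
  have hs := mul_mem (D.simpleReflection_mem i) (D.reflProd_mem L₁)
  rw [h.sorted_eq', coverChain_append, one_mul, CoverChain, coverChain_append, hr] at hc
  rw [h.sorted_eq, coverChain_append, coverChain_append, one_mul]
  -- In `J'` the partial product at `m` is a descent; read backwards along `L₂`, this is what allows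
  -- the factor `sᵢ` to be removed.
  have hn : ¬ D.IsAscent i (D.simpleReflection i * D.reflProd L₁ * D.reflProd L₂) := by
    rw [mul_assoc, ← reflProd_append, isAscent_simpleReflection_mul (D.reflProd_mem _), not_not]
    exact isAscent_of_map_root h.map_right
  have h1 := hc.2.2.1.simpleReflection_mul_of_not hs (noFold_simpleReflection_mul.2 h.noFold) hn
  rw [← mul_assoc, simpleReflection_mul_self, one_mul] at h1
  refine ⟨hc.1, h1, ?_, ?_⟩
  · rw [← reflProd_append]
    exact bruhatCover_of_map_root (D.reflProd_mem _) h.map_right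
  · convert hc.2.2.2 using 1
    simp only [reflProd_append, reflProd_cons, reflProd_nil, mul_one] at h'
    rw [← hr, mul_assoc, mul_assoc, h']

theorem exists_weight (h : IsMove lam i J J' L₁ L₂ L₃ a m) :
    ∃ n : ℤ, D.weight lam J' = D.weight lam J + n • D.simpleRoot i := by
  rw [weight_eq, weight_eq, h.sorted_eq, h.sorted_eq']
  have e1 : L₁ ++ a :: (L₂ ++ L₃) = L₁ ++ ([a] ++ (L₂ ++ L₃)) := rfl
  have e2 : L₁ ++ (L₂ ++ m :: L₃) = (L₁ ++ L₂) ++ ([m] ++ L₃) := by simp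
  rw [e1, e2, affineProd_append L₁, affineProd_append [a], affineProd_append L₂,
    affineProd_append (L₁ ++ L₂), affineProd_append [m]]
  obtain ⟨n, hn⟩ := exists_affineProd_insert h.map_left (affineProd L₂ (affineProd L₃ (-lam)))
  obtain ⟨n', hn'⟩ := exists_affineProd_insert h.map_right (affineProd L₃ (-lam))
  rw [hn, hn', affineProd_append]
  exact ⟨n' - n, by module⟩

end IsMove

namespace IsInsert

theorem order (h : IsInsert lam i J J' L₁ L₂ a) :
    (∀ x ∈ L₁, D.chainLT lam x a) ∧ (∀ x ∈ L₂, D.chainLT lam a x) := by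
  have h2 := pairwise_sorted h.mem'
  rw [h.sorted_eq', List.pairwise_append, List.pairwise_cons] at h2
  exact ⟨fun x hx => h2.2.2 x hx a (by simp), fun x hx => h2.2.1.1 x hx⟩

theorem before_eq (h : IsInsert lam i J J' L₁ L₂ a) {k : D.Fold} (hk : ¬ D.chainLT lam a k) :
    D.before lam J' k = D.before lam J k := by
  obtain ⟨h1, h2⟩ := h.order
  have h3 : ∀ x ∈ L₂, ¬ D.chainLT lam x k := fun x hx hxk => hk (chainLT_trans (h2 x hx) hxk)
  refine before_eq_of_le h.sorted_eq h.sorted_eq' h3 fun x hx => ?_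
  rcases List.mem_cons.1 hx with rfl | hx
  · exact hk
  · exact h3 x hx

theorem reflProd_before (h : IsInsert lam i J J' L₁ L₂ a) {k : D.Fold}
    (hak : D.chainLT lam a k) :
    D.reflProd (D.before lam J' k) = D.simpleReflection i * D.reflProd (D.before lam J k) :=
  reflProd_before_insert (T := []) (T' := []) (by rw [List.append_nil, h.sorted_eq])
    (by rw [List.append_nil, h.sorted_eq']) h.order.1 hak (by simp) (by simp) h.map_left

theorem foldSet_eq (h : IsInsert lam i J J' L₁ L₂ a) :
    D.foldSet lam J' i = D.foldSet lam J i := by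
  ext k
  rw [mem_foldSet_iff, mem_foldSet_iff]
  by_cases hak : D.chainLT lam a k
  · rw [h.reflProd_before hak, hits_simpleReflection_mul]
  · rw [h.before_eq hak]

theorem gamma_eq (h : IsInsert lam i J J' L₁ L₂ a) {k : D.Fold}
    (hk : ¬ D.chainLT lam a k) : D.gamma lam J' k = D.gamma lam J k := by
  rw [gamma, gamma, h.before_eq hk]

theorem gamma_left (h : IsInsert lam i J J' L₁ L₂ a) :
    D.gamma lam J' a = D.simpleRoot i := by
  rw [gamma, before_of_mem_split h.mem' h.sorted_eq', h.map_left]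

theorem tau_eq (h : IsInsert lam i J J' L₁ L₂ a) :
    D.tau lam J' = D.simpleReflection i * D.tau lam J := by
  rw [tau, tau, h.sorted_eq, h.sorted_eq', reflProd_insert h.map_left]

theorem coverChain (h : IsInsert lam i J J' L₁ L₂ a)
    (hc : D.CoverChain 1 (D.sorted lam J)) : D.CoverChain 1 (D.sorted lam J') := by
  have ha := isAscent_of_map_root h.map_left
  have hr := simpleReflection_mul_eq (D.reflProd_mem L₁) (.inl h.map_left)
  rw [h.sorted_eq, coverChain_append, one_mul] at hc
  rw [h.sorted_eq', coverChain_append, one_mul, CoverChain]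
  refine ⟨hc.1, bruhatCover_of_map_root (D.reflProd_mem L₁) h.map_left, ?_⟩
  rw [hr]
  exact hc.2.simpleReflection_mul (D.reflProd_mem L₁) h.noFold ha

theorem isAscent (h : IsInsert lam i J J' L₁ L₂ a)
    (hc : D.CoverChain 1 (D.sorted lam J)) : D.IsAscent i (D.tau lam J) := by
  rw [h.sorted_eq, coverChain_append, one_mul] at hc
  rw [tau, h.sorted_eq, reflProd_append]
  exact hc.2.isAscent (D.reflProd_mem L₁) h.noFold (isAscent_of_map_root h.map_left)

theorem coverChain_symm (h : IsInsert lam i J J' L₁ L₂ a)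
    (hc : D.CoverChain 1 (D.sorted lam J')) (hn : ¬ D.IsAscent i (D.tau lam J')) :
    D.CoverChain 1 (D.sorted lam J) := by
  have hr := simpleReflection_mul_eq (D.reflProd_mem L₁) (.inl h.map_left)
  have hs := mul_mem (D.simpleReflection_mem i) (D.reflProd_mem L₁)
  rw [tau, h.sorted_eq', reflProd_append, reflProd_cons, ← mul_assoc, hr] at hn
  rw [h.sorted_eq', coverChain_append, one_mul, CoverChain, hr] at hc
  rw [h.sorted_eq, coverChain_append, one_mul]
  have h1 := hc.2.2.simpleReflection_mul_of_not hs (noFold_simpleReflection_mul.2 h.noFold) hn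
  rw [← mul_assoc, simpleReflection_mul_self, one_mul] at h1
  exact ⟨hc.1, h1⟩

theorem exists_weight (h : IsInsert lam i J J' L₁ L₂ a) :
    ∃ n : ℤ, D.weight lam J' = D.weight lam J + n • D.simpleRoot i := by
  rw [weight_eq, weight_eq, h.sorted_eq, h.sorted_eq']
  have e1 : L₁ ++ a :: L₂ = L₁ ++ ([a] ++ L₂) := rfl
  rw [e1, affineProd_append L₁, affineProd_append [a], affineProd_append L₁]
  obtain ⟨n, hn⟩ := exists_affineProd_insert h.map_left (affineProd L₂ (-lam))
  rw [hn]
  exact ⟨-n, by module⟩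

end IsInsert

end Order

end KacMoodyDatum

end AlcovePath

/-! ### Edges of the crystal graph and the operator `fᵢ`. -/

namespace AlcovePath

namespace KacMoodyDatum

set_option linter.unusedSectionVars false

variable {I P : Type*} [Fintype I] [AddCommGroup P] (D : KacMoodyDatum I P)
  [LinearOrder I] (lam : P) (i : I)

/-! ### Crystal operators through signatures -/

/-- The positions of `I_{αᵢ} \ J`, in increasing order. -/
noncomputable def openFolds (J : Finset D.Fold) : List D.Fold :=
  D.sorted lam ((D.foldSet_finite lam J i).toFinset \ J)

open Classical in
/-- The uncancelled `+` and `-` of a list of positions. -/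
noncomputable def sig (J : Finset D.Fold) (L : List D.Fold) : List D.Fold × List D.Fold :=
  signature (fun k => D.gamma lam J k = D.simpleRoot i) L

variable {D lam i} {J J' : Finset D.Fold}

theorem mem_openFolds {x : D.Fold} :
    x ∈ D.openFolds lam i J ↔ x ∈ D.foldSet lam J i ∧ x ∉ J := by
  rw [openFolds, mem_sorted, Finset.mem_sdiff, Set.Finite.mem_toFinset]

theorem pairwise_openFolds : (D.openFolds lam i J).Pairwise (D.chainLT lam) :=
  pairwise_sorted fun x hx => by
    rw [Finset.mem_sdiff, Set.Finite.mem_toFinset] at hx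
    exact hx.1.1

theorem openFolds_eq {L : List D.Fold} (hL : L.Pairwise (D.chainLT lam))
    (h : ∀ x, x ∈ L ↔ x ∈ D.foldSet lam J i ∧ x ∉ J) : D.openFolds lam i J = L :=
  sorted_eq (fun x hx => by
    rw [Finset.mem_sdiff, Set.Finite.mem_toFinset] at hx
    exact hx.1.1) hL fun x => by rw [h, Finset.mem_sdiff, Set.Finite.mem_toFinset]

theorem sig_congr {L : List D.Fold} (h : ∀ x ∈ L, D.gamma lam J' x = D.gamma lam J x) :
    D.sig lam i J' L = D.sig lam i J L :=
  by classical exact signature_congr _ fun x hx => by rw [h x hx]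

theorem tau_mem (J : Finset D.Fold) : D.tau lam J ∈ D.weylGroup := D.reflProd_mem _

theorem simpleRoot_ne_neg : -D.simpleRoot i ≠ D.simpleRoot i := fun h => by
  have := (simplePosRoot i : D.PosRoot).not_isNonneg_neg
  rw [root_simplePosRoot, h] at this
  exact this (D.isNonneg_simpleRoot i)

theorem sig_append_pos {X Y : List D.Fold} {a : D.Fold} (ha : D.gamma lam J a = D.simpleRoot i)
    (hX : (D.sig lam i J X).2 = []) (hY : (D.sig lam i J Y).1 = []) :
    D.sig lam i J (X ++ a :: Y) = ((D.sig lam i J X).1 ++ [a], (D.sig lam i J Y).2) :=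
  by classical exact signature_append_pos _ ha hX hY

theorem sig_append_neg {X Y : List D.Fold} {a : D.Fold} (ha : D.gamma lam J a = -D.simpleRoot i)
    (hX : (D.sig lam i J X).2 = []) (hY : (D.sig lam i J Y).1 = []) :
    D.sig lam i J (X ++ a :: Y) = ((D.sig lam i J X).1, a :: (D.sig lam i J Y).2) :=
  by classical exact signature_append_neg _ (by rw [ha]; exact simpleRoot_ne_neg) hX hY

open Classical in
theorem fOp_eq : D.fOp lam i J =
    match (D.sig lam i J (D.openFolds lam i J)).1.getLast? with
    | none => none
    | some a => some (insert a ((((D.sorted lam J).filter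
        fun j => j ∈ D.foldSet lam J i ∧ D.chainLT lam a j).head?).elim J J.erase)) := by
  rw [sig, ← filter_pos_cancelPairs]
  rfl

open Classical in
theorem eOp_eq : D.eOp lam i J =
    match (D.sig lam i J (D.openFolds lam i J)).2.head? with
    | none =>
      if D.simpleCoroot i (D.tau lam J D.rho) < 0 then
        some ((((D.sorted lam J).filter fun j => j ∈ D.foldSet lam J i).getLast?).elim J J.erase)
      else none
    | some a =>
      some (insert a ((((D.sorted lam J).filter
        fun j => j ∈ D.foldSet lam J i ∧ D.chainLT lam j a).getLast?).elim J J.erase)) := by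
  rw [sig, ← filter_neg_cancelPairs]
  rfl

/-- The edges `J → J' = fᵢ J` of the crystal graph. -/
inductive IsEdge (lam : P) (i : I) (J J' : Finset D.Fold) : Prop
  | move (L₁ L₂ L₃ X Y : List D.Fold) (a m : D.Fold)
      (h : IsMove lam i J J' L₁ L₂ L₃ a m) (hJ : D.openFolds lam i J = X ++ a :: Y)
      (hJ' : D.openFolds lam i J' = X ++ m :: Y) (hX : (D.sig lam i J X).2 = [])
      (hY : (D.sig lam i J Y).1 = []) (hc : D.IsAdmissible lam J) (hc' : D.IsAdmissible lam J')
  | insert (L₁ L₂ X : List D.Fold) (a : D.Fold)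
      (h : IsInsert lam i J J' L₁ L₂ a) (hJ : D.openFolds lam i J = X ++ [a])
      (hJ' : D.openFolds lam i J' = X) (hX : (D.sig lam i J X).2 = [])
      (hc : D.IsAdmissible lam J) (hc' : D.IsAdmissible lam J')

theorem IsEdge.left (h : IsEdge lam i J J') : D.IsAdmissible lam J := by cases h <;> assumption

theorem IsEdge.right (h : IsEdge lam i J J') : D.IsAdmissible lam J' := by cases h <;> assumption

section MoveFacts

variable {L₁ L₂ L₃ X Y : List D.Fold} {a m : D.Fold}

theorem IsMove.sig_left (h : IsMove lam i J J' L₁ L₂ L₃ a m)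
    (hJ : D.openFolds lam i J = X ++ a :: Y) : D.sig lam i J' X = D.sig lam i J X := by
  have hp := pairwise_openFolds (J := J) (lam := lam) (i := i)
  rw [hJ, List.pairwise_append] at hp
  exact sig_congr fun x hx => h.gamma_eq (.inl (chainLT_asymm (hp.2.2 x hx a (by simp))))

theorem IsMove.sig_right (h : IsMove lam i J J' L₁ L₂ L₃ a m)
    (hJ' : D.openFolds lam i J' = X ++ m :: Y) : D.sig lam i J' Y = D.sig lam i J Y := by
  have hp := pairwise_openFolds (J := J') (lam := lam) (i := i)
  rw [hJ', List.pairwise_append, List.pairwise_cons] at hp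
  exact sig_congr fun x hx => h.gamma_eq (.inr (hp.2.1.1 x hx))

theorem IsInsert.sig_left (h : IsInsert lam i J J' L₁ L₂ a)
    (hJ : D.openFolds lam i J = X ++ [a]) : D.sig lam i J' X = D.sig lam i J X := by
  have hp := pairwise_openFolds (J := J) (lam := lam) (i := i)
  rw [hJ, List.pairwise_append] at hp
  exact sig_congr fun x hx => h.gamma_eq (chainLT_asymm (hp.2.2 x hx a (by simp)))

theorem IsMove.gamma_start (h : IsMove lam i J J' L₁ L₂ L₃ a m) :
    D.gamma lam J a = D.simpleRoot i := by
  rw [← h.gamma_eq (.inl (chainLT_irrefl a)), h.gamma_left]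

theorem IsInsert.gamma_start (h : IsInsert lam i J J' L₁ L₂ a) :
    D.gamma lam J a = D.simpleRoot i := by
  rw [← h.gamma_eq (chainLT_irrefl a), h.gamma_left]

theorem IsMove.sig_start (h : IsMove lam i J J' L₁ L₂ L₃ a m)
    (hJ : D.openFolds lam i J = X ++ a :: Y)
    (hX : (D.sig lam i J X).2 = []) (hY : (D.sig lam i J Y).1 = []) :
    D.sig lam i J (D.openFolds lam i J) = ((D.sig lam i J X).1 ++ [a], (D.sig lam i J Y).2) := by
  rw [hJ, sig_append_pos h.gamma_start hX hY]

theorem IsMove.sig_end (h : IsMove lam i J J' L₁ L₂ L₃ a m)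
    (hJ : D.openFolds lam i J = X ++ a :: Y) (hJ' : D.openFolds lam i J' = X ++ m :: Y)
    (hX : (D.sig lam i J X).2 = []) (hY : (D.sig lam i J Y).1 = []) :
    D.sig lam i J' (D.openFolds lam i J') = ((D.sig lam i J X).1, m :: (D.sig lam i J Y).2) := by
  rw [hJ', sig_append_neg h.gamma_right' (by rw [h.sig_left hJ, hX])
    (by rw [h.sig_right hJ', hY]), h.sig_left hJ, h.sig_right hJ']

theorem IsInsert.sig_start (h : IsInsert lam i J J' L₁ L₂ a)
    (hJ : D.openFolds lam i J = X ++ [a]) (hX : (D.sig lam i J X).2 = []) :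
    D.sig lam i J (D.openFolds lam i J) = ((D.sig lam i J X).1 ++ [a], []) := by
  rw [hJ, sig_append_pos h.gamma_start hX rfl]
  rfl

theorem IsInsert.sig_end (h : IsInsert lam i J J' L₁ L₂ a)
    (hJ : D.openFolds lam i J = X ++ [a]) (hJ' : D.openFolds lam i J' = X)
    (hX : (D.sig lam i J X).2 = []) :
    D.sig lam i J' (D.openFolds lam i J') = ((D.sig lam i J X).1, []) := by
  rw [hJ', h.sig_left hJ, ← hX]

end MoveFacts

theorem IsEdge.sig_left (h : IsEdge lam i J J') :
    ∃ a, (D.sig lam i J (D.openFolds lam i J)).1 =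
        (D.sig lam i J' (D.openFolds lam i J')).1 ++ [a] := by
  rcases h with ⟨L₁, L₂, L₃, X, Y, a, m, h, hJ, hJ', hX, hY, -, -⟩ |
    ⟨L₁, L₂, X, a, h, hJ, hJ', hX, -, -⟩
  · exact ⟨a, by rw [h.sig_start hJ hX hY, h.sig_end hJ hJ' hX hY]⟩
  · exact ⟨a, by rw [h.sig_start hJ hX, h.sig_end hJ hJ' hX]⟩

/-- The number of `-` in the reduced signature, including the final sign. -/
noncomputable def negCount (lam : P) (i : I) (J : Finset D.Fold) : ℕ :=
  open Classical in
  (D.sig lam i J (D.openFolds lam i J)).2.length + if D.IsAscent i (D.tau lam J) then 0 else 1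

/-- The number of `+` in the reduced signature. -/
noncomputable def posCount (lam : P) (i : I) (J : Finset D.Fold) : ℕ :=
  (D.sig lam i J (D.openFolds lam i J)).1.length

theorem IsEdge.posCount_eq (h : IsEdge lam i J J') : posCount lam i J = posCount lam i J' + 1 := by
  obtain ⟨a, ha⟩ := h.sig_left
  rw [posCount, ha, List.length_append]
  rfl

/-- A move turns the last surviving `+` into a `-`. An insertion removes this `+` from the word and
turns `τ` from an ascent into a descent, so it is the final sign that changes. -/
theorem IsEdge.negCount_eq (h : IsEdge lam i J J') :
    negCount lam i J' = negCount lam i J + 1 := by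
  rcases h with ⟨L₁, L₂, L₃, X, Y, a, m, h, hJ, hJ', hX, hY, -, -⟩ |
    ⟨L₁, L₂, X, a, h, hJ, hJ', hX, hc, -⟩
  · rw [negCount, negCount, h.sig_start hJ hX hY, h.sig_end hJ hJ' hX hY, h.tau_eq,
      List.length_cons]
    dsimp only
    omega
  · have ha := h.isAscent hc.coverChain
    rw [negCount, negCount, h.sig_start hJ hX, h.sig_end hJ hJ' hX, h.tau_eq, if_pos ha, if_neg]
    rw [isAscent_simpleReflection_mul (tau_mem J), not_not]
    exact ha

theorem IsEdge.exists_weight (h : IsEdge lam i J J') :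
    ∃ n : ℤ, D.weight lam J' = D.weight lam J + n • D.simpleRoot i := by
  cases h with
  | move _ _ _ _ _ _ _ h => exact h.exists_weight
  | insert _ _ _ _ h => exact h.exists_weight

theorem not_mem_foldSet_of_noFold {A M B : List D.Fold} (hJ : ∀ x ∈ J, x ∈ D.chainSet lam)
    (h : D.sorted lam J = A ++ (M ++ B)) (hn : D.NoFold i (D.reflProd A) M) :
    ∀ x ∈ M, x ∉ D.foldSet lam J i := by
  intro x hx hxI
  obtain ⟨p, q, rfl⟩ := List.append_of_mem hx
  have hb : D.before lam J x = A ++ p := before_of_mem_split hJ (B := q ++ B) (by rw [h]; simp)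
  refine noFold_iff.1 hn p x q rfl ?_
  have := hxI.2
  rw [gamma, hb, reflProd_append] at this
  exact this

theorem finset_eq_of_sorted {K : Finset D.Fold} (h : ∀ x, x ∈ D.sorted lam J' ↔ x ∈ K) :
    K = J' := by
  ext x; rw [← h, mem_sorted]

theorem IsEdge.fOp_eq_some (h : IsEdge lam i J J') : D.fOp lam i J = some J' := by
  classical
  rw [fOp_eq]
  rcases h with ⟨L₁, L₂, L₃, X, Y, a, m, h, hJ, hJ', hX, hY, -, -⟩ |
    ⟨L₁, L₂, X, a, h, hJ, hJ', hX, -, -⟩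
  · obtain ⟨o1, o2, o3, o4⟩ := h.order
    have hno := not_mem_foldSet_of_noFold h.mem h.sorted_eq h.noFold
    have hm : m ∈ D.foldSet lam J i := by
      rw [← h.foldSet_eq]
      exact (mem_openFolds.1 (by rw [hJ']; simp : m ∈ D.openFolds lam i J')).1
    have hmJ' : m ∉ J' :=
      (mem_openFolds.1 (by rw [hJ']; simp : m ∈ D.openFolds lam i J')).2
    have hhead : ((D.sorted lam J).filter
        fun j => j ∈ D.foldSet lam J i ∧ D.chainLT lam a j).head? = some m := by
      rw [h.sorted_eq, List.filter_append, List.filter_append,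
        List.filter_eq_nil_iff.2 (fun x hx => by simpa using fun _ => chainLT_asymm (o1 x hx)),
        List.filter_eq_nil_iff.2 (fun x hx => by simpa using fun hh => absurd hh (hno x hx)),
        List.filter_cons_of_pos (by simpa using ⟨hm, h.lt⟩)]
      rfl
    rw [h.sig_start hJ hX hY]
    simp only [List.getLast?_append, List.getLast?_singleton, Option.some_or]
    rw [hhead, Option.elim_some, Option.some.injEq]
    refine finset_eq_of_sorted (lam := lam) fun x => ?_
    have hx : x ∈ J ↔ x ∈ L₁ ∨ x ∈ L₂ ∨ x = m ∨ x ∈ L₃ := by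
      rw [← mem_sorted (lam := lam), h.sorted_eq]; simp
    have hmL : m ∉ L₁ ∧ m ∉ L₂ ∧ m ∉ L₃ := by
      rw [← mem_sorted (lam := lam), h.sorted_eq'] at hmJ'
      simp only [List.mem_append, List.mem_cons] at hmJ'
      tauto
    rw [h.sorted_eq', Finset.mem_insert, Finset.mem_erase, hx]
    simp only [List.mem_append, List.mem_cons]
    by_cases hxm : x = m
    · subst hxm; tauto
    · tauto
  · obtain ⟨o1, o2⟩ := h.order
    have hno := not_mem_foldSet_of_noFold h.mem (B := [])
      (by rw [List.append_nil, h.sorted_eq]) h.noFold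
    have hhead : ((D.sorted lam J).filter
        fun j => j ∈ D.foldSet lam J i ∧ D.chainLT lam a j).head? = none := by
      rw [h.sorted_eq, List.filter_append,
        List.filter_eq_nil_iff.2 (fun x hx => by simpa using fun _ => chainLT_asymm (o1 x hx)),
        List.filter_eq_nil_iff.2 (fun x hx => by simpa using fun hh => absurd hh (hno x hx))]
      rfl
    rw [h.sig_start hJ hX]
    simp only [List.getLast?_append, List.getLast?_singleton, Option.some_or]
    rw [hhead, Option.elim_none, Option.some.injEq]
    refine finset_eq_of_sorted (lam := lam) fun x => ?_
    rw [h.sorted_eq', Finset.mem_insert, ← mem_sorted (lam := lam) (J := J), h.sorted_eq]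
    simp only [List.mem_append, List.mem_cons]
    tauto

theorem IsEdge.eOp_eq_some (h : IsEdge lam i J J') : D.eOp lam i J' = some J := by
  classical
  rw [eOp_eq]
  rcases h with ⟨L₁, L₂, L₃, X, Y, a, m, h, hJ, hJ', hX, hY, -, -⟩ |
    ⟨L₁, L₂, X, a, h, hJ, hJ', hX, hc, -⟩
  · obtain ⟨o1, o2, o3, o4⟩ := h.order
    have hno := not_mem_foldSet_of_noFold h.mem h.sorted_eq h.noFold
    have ha : a ∈ D.foldSet lam J i ∧ a ∉ J :=
      mem_openFolds.1 (by rw [hJ]; simp : a ∈ D.openFolds lam i J)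
    have hlast : ((D.sorted lam J').filter
        fun j => j ∈ D.foldSet lam J' i ∧ D.chainLT lam j m).getLast? = some a := by
      rw [h.sorted_eq', h.foldSet_eq, List.filter_append,
        List.filter_cons_of_pos (by simpa using ⟨ha.1, h.lt⟩), List.filter_append,
        (List.filter_eq_nil_iff (l := L₂)).2 (fun x hx => by
          simpa using fun hh => absurd hh (hno x hx)),
        (List.filter_eq_nil_iff (l := L₃)).2 (fun x hx => by simpa using fun _ => chainLT_asymm (o4 x hx))]
      simp
    rw [h.sig_end hJ hJ' hX hY]
    simp only [List.head?_cons]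
    rw [hlast, Option.elim_some, Option.some.injEq]
    refine finset_eq_of_sorted (lam := lam) fun x => ?_
    have hx : x ∈ J' ↔ x ∈ L₁ ∨ x = a ∨ x ∈ L₂ ∨ x ∈ L₃ := by
      rw [← mem_sorted (lam := lam), h.sorted_eq']; simp
    have haL : a ∉ L₁ ∧ a ∉ L₂ ∧ a ∉ L₃ := by
      have := ha.2
      rw [← mem_sorted (lam := lam), h.sorted_eq] at this
      simp only [List.mem_append, List.mem_cons] at this
      tauto
    rw [h.sorted_eq, Finset.mem_insert, Finset.mem_erase, hx]
    simp only [List.mem_append, List.mem_cons]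
    by_cases hxm : x = a
    · subst hxm
      have : x ≠ m := fun he => chainLT_irrefl m (he ▸ h.lt)
      tauto
    · tauto
  · have ht : ¬ D.IsAscent i (D.tau lam J') := by
      rw [h.tau_eq, isAscent_simpleReflection_mul (tau_mem J), not_not]
      exact h.isAscent hc.coverChain
    obtain ⟨o1, o2⟩ := h.order
    have hno := not_mem_foldSet_of_noFold h.mem (B := [])
      (by rw [List.append_nil, h.sorted_eq]) h.noFold
    have ha : a ∈ D.foldSet lam J i ∧ a ∉ J :=
      mem_openFolds.1 (by rw [hJ]; simp : a ∈ D.openFolds lam i J)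
    have hlast : ((D.sorted lam J').filter fun j => j ∈ D.foldSet lam J' i).getLast? = some a := by
      rw [h.sorted_eq', h.foldSet_eq, List.filter_append,
        List.filter_cons_of_pos (by simpa using ha.1),
        (List.filter_eq_nil_iff (l := L₂)).2 (fun x hx => by simpa using hno x hx)]
      simp
    rw [h.sig_end hJ hJ' hX]
    simp only [List.head?_nil]
    rw [hlast, Option.elim_some, if_pos ((simpleCoroot_rho_neg_iff (tau_mem J')).2 ht),
      Option.some.injEq]
    refine finset_eq_of_sorted (lam := lam) fun x => ?_
    have haL := ha.2
    rw [← mem_sorted (lam := lam), h.sorted_eq, List.mem_append] at haL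
    rw [h.sorted_eq, Finset.mem_erase, ← mem_sorted (lam := lam) (J := J'), h.sorted_eq']
    simp only [List.mem_append, List.mem_cons]
    by_cases hxm : x = a
    · subst hxm; tauto
    · tauto

theorem IsMove.mem_foldSet_right {L₁ L₂ L₃ : List D.Fold} {a m : D.Fold}
    (h : IsMove lam i J J' L₁ L₂ L₃ a m) : m ∈ D.foldSet lam J i ∧ m ∈ J := by
  have hm : m ∈ J := by rw [← mem_sorted (lam := lam), h.sorted_eq]; simp
  exact ⟨⟨h.mem m hm, .inl h.gamma_right⟩, hm⟩

/-- In the list of open positions `m` takes the place of `a`; this needs every open position after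
`a` to lie after `m`. -/
theorem IsMove.openFolds_end {L₁ L₂ L₃ X Y : List D.Fold} {a m : D.Fold}
    (h : IsMove lam i J J' L₁ L₂ L₃ a m) (hJ : D.openFolds lam i J = X ++ a :: Y)
    (hJ' : J' = insert a (J.erase m)) (hY : ∀ y ∈ Y, D.chainLT lam m y) :
    D.openFolds lam i J' = X ++ m :: Y := by
  have hpS := pairwise_openFolds (J := J) (lam := lam) (i := i)
  rw [hJ, List.pairwise_append, List.pairwise_cons] at hpS
  have ham := h.lt
  refine openFolds_eq ?_ fun x => ?_
  · rw [List.pairwise_append, List.pairwise_cons]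
    refine ⟨hpS.1, ⟨hY, hpS.2.1.2⟩, fun x hx y hy => ?_⟩
    rcases List.mem_cons.1 hy with rfl | hy
    · exact chainLT_trans (hpS.2.2 x hx a (by simp)) ham
    · exact hpS.2.2 x hx y (by simp [hy])
  · have hx : x ∈ X ++ a :: Y ↔ x ∈ D.foldSet lam J i ∧ x ∉ J := by rw [← hJ, mem_openFolds]
    have haX : a ∉ X := fun h' => chainLT_irrefl a (hpS.2.2 a h' a (by simp))
    have haY : a ∉ Y := fun h' => chainLT_irrefl a (hpS.2.1.1 a h')
    have hma : m ≠ a := by rintro h'; rw [h'] at ham; exact chainLT_irrefl a ham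
    obtain ⟨hm, -⟩ := h.mem_foldSet_right
    rw [h.foldSet_eq, hJ', Finset.mem_insert, Finset.mem_erase]
    simp only [List.mem_append, List.mem_cons] at hx ⊢
    clear hpS hJ hJ' h hY ham
    by_cases hxm : x = m
    · subst hxm; tauto
    · by_cases hxa : x = a
      · subst hxa; tauto
      · tauto

theorem IsInsert.openFolds_end {L₁ L₂ X : List D.Fold} {a : D.Fold}
    (h : IsInsert lam i J J' L₁ L₂ a) (hJ : D.openFolds lam i J = X ++ [a])
    (hJ' : J' = insert a J) : D.openFolds lam i J' = X := by
  have hpS := pairwise_openFolds (J := J) (lam := lam) (i := i)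
  rw [hJ, List.pairwise_append] at hpS
  refine openFolds_eq hpS.1 fun x => ?_
  have hx : x ∈ X ++ [a] ↔ x ∈ D.foldSet lam J i ∧ x ∉ J := by rw [← hJ, mem_openFolds]
  have haX : a ∉ X := fun h' => chainLT_irrefl a (hpS.2.2 a h' a (by simp))
  rw [h.foldSet_eq, hJ', Finset.mem_insert]
  simp only [List.mem_append, List.mem_singleton] at hx
  clear hpS hJ hJ' h
  by_cases hxa : x = a
  · subst hxa; tauto
  · tauto

/-- The rightmost surviving `+` is at `a`. If folds over `αᵢ` come after `a`, the first one is moved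
to `a`; if none does, a fold is added at `a`. The work lies in showing that the next open position
comes after the moved fold, or does not exist. -/
theorem exists_isEdge_of_pos (hc : D.IsAdmissible lam J)
    (h : (D.sig lam i J (D.openFolds lam i J)).1 ≠ []) : ∃ J', IsEdge lam i J J' := by
  classical
  obtain ⟨X, Y, hXY, ha, hX, hY⟩ := exists_split_of_last_pos _ (List.getLast?_eq_some_getLast h)
  set a := (D.sig lam i J (D.openFolds lam i J)).1.getLast h
  have haI := mem_openFolds.1 (by rw [hXY]; simp : a ∈ D.openFolds lam i J)
  have hpS := pairwise_openFolds (J := J) (lam := lam) (i := i)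
  rw [hXY, List.pairwise_append, List.pairwise_cons] at hpS
  have hS := sorted_eq_before_append hc.mem a
  set L₁ := D.before lam J a with hL₁
  set R := (D.sorted lam J).filter fun x => ¬ D.chainLT lam x a with hR
  have hRa : ∀ x ∈ R, D.chainLT lam a x := by
    intro x hx
    rw [hR, List.mem_filter, mem_sorted] at hx
    refine chainLT_of_not_of_ne (hc.mem x hx.1) haI.1.1 (by simpa using hx.2) ?_
    rintro rfl
    exact haI.2 hx.1
  have hL₁a : ∀ x ∈ L₁, D.chainLT lam x a := fun x hx => (mem_before.1 hx).2
  have hpJ := pairwise_sorted hc.mem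
  have hasc : D.IsAscent i (D.reflProd L₁) := isAscent_of_map_root ha
  by_cases hex : ∃ x ∈ R, x ∈ D.foldSet lam J i
  · obtain ⟨L₂, m, L₃, hsplit, hm, hL₂⟩ := List.exists_first_split _ R hex
    rw [hsplit] at hS hRa
    have hmJ : m ∈ J := by rw [← mem_sorted (lam := lam), hS]; simp
    have ham : D.chainLT lam a m := hRa m (by simp)
    rw [hS, List.pairwise_append, List.pairwise_append, List.pairwise_cons] at hpJ
    have hmL₁ : m ∉ L₁ := fun h' => chainLT_asymm ham (hL₁a m h')
    have hmL₂ : m ∉ L₂ := fun h' => hL₂ m h' hm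
    have hmL₃ : m ∉ L₃ := fun h' => chainLT_irrefl m (hpJ.2.1.2.1.1 m h')
    have hYm : ∀ y ∈ Y, D.chainLT lam m y := by
      rcases Y with - | ⟨y, Y⟩
      · simp
      have hyI := mem_openFolds.1 (by rw [hXY]; simp : y ∈ D.openFolds lam i J)
      -- The first letter of `Y` is `-`. Were it before `m`, no fold over `αᵢ` would lie between `a`
      -- and it, and the `+` at `a` would persist.
      have hmy : D.chainLT lam m y := by
        by_contra hcon
        have hym : D.chainLT lam y m := by
          refine chainLT_of_not_of_ne (hc.mem m hmJ) hyI.1.1 hcon ?_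
          rintro rfl
          exact hyI.2 hmJ
        refine not_pos_head _ hY ?_
        rw [gamma_eq_iff_isAscent hyI.1]
        refine isAscent_before_of_isAscent_before hc (hpS.2.1.1 y (by simp)) ?_ hasc
        intro j hj hja hjy
        rw [← mem_sorted (lam := lam), hS] at hj
        simp only [List.mem_append, List.mem_cons] at hj
        rcases hj with hj | hj | rfl | hj
        · exact absurd (hL₁a j hj) hja
        · exact hL₂ j hj
        · exact absurd hym (chainLT_asymm hjy)
        · exact absurd (chainLT_trans hym (hpJ.2.1.2.1.1 j hj)) (chainLT_asymm hjy)
      intro z hz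
      rcases List.mem_cons.1 hz with rfl | hz
      · exact hmy
      · have := hpS.2.1.2
        rw [List.pairwise_cons] at this
        exact chainLT_trans hmy (this.1 z hz)
    set J' := insert a (J.erase m) with hJ'
    have hmem' : ∀ x ∈ J', x ∈ D.chainSet lam := by
      intro x hx
      rw [hJ', Finset.mem_insert, Finset.mem_erase] at hx
      rcases hx with rfl | hx
      · exact haI.1.1
      · exact hc.mem x hx.2
    have hsort' : D.sorted lam J' = L₁ ++ a :: (L₂ ++ L₃) := by
      refine sorted_eq hmem' ?_ fun x => ?_
      · rw [List.pairwise_append, List.pairwise_cons, List.pairwise_append]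
        refine ⟨hpJ.1, ⟨fun x hx => hRa x ?_, hpJ.2.1.1, hpJ.2.1.2.1.2, fun x hx y hy =>
          hpJ.2.1.2.2 x hx y (by simp [hy])⟩, fun x hx y hy => ?_⟩
        · simp only [List.mem_append, List.mem_cons] at hx ⊢
          tauto
        · refine (List.mem_cons.1 hy).elim (fun h' => h' ▸ hL₁a x hx) fun h' =>
            hpJ.2.2 x hx y ?_
          simp only [List.mem_append, List.mem_cons] at h' ⊢
          tauto
      · rw [hJ', Finset.mem_insert, Finset.mem_erase, ← mem_sorted (lam := lam) (J := J), hS]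
        simp only [List.mem_append, List.mem_cons]
        by_cases hxm : x = m
        · subst hxm; tauto
        · tauto
    have hmove : IsMove lam i J J' L₁ L₂ L₃ a m := by
      refine ⟨hc.mem, hmem', hS, hsort', ham, ha, ?_, noFold_of_not_mem hc.mem
        (B := m :: L₃) (by rw [hS, List.append_assoc]) hL₂⟩
      rw [← hc.gamma_of_mem hmJ hm, gamma, before_of_mem_split hc.mem (A := L₁ ++ L₂) (B := L₃)
        (by rw [hS, List.append_assoc])]
    exact ⟨J', .move L₁ L₂ L₃ X Y a m hmove hXY (hmove.openFolds_end hXY hJ' hYm) hX hY hc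
      (isAdmissible_iff.2 ⟨hmem', hmove.coverChain hc.coverChain⟩)⟩
  · push Not at hex
    -- Without folds over `αᵢ` after `a`, the `+` at `a` persists, so the first letter of `Y` would
    -- be `+`.
    have hYnil : Y = [] := by
      rcases Y with - | ⟨y, Y⟩
      · rfl
      exfalso
      have hyI := mem_openFolds.1 (by rw [hXY]; simp : y ∈ D.openFolds lam i J)
      refine not_pos_head _ hY ?_
      rw [gamma_eq_iff_isAscent hyI.1]
      refine isAscent_before_of_isAscent_before hc (hpS.2.1.1 y (by simp)) ?_ hasc
      intro j hj hja hjy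
      exact hex j (by rw [hR, List.mem_filter, mem_sorted]; simpa using ⟨hj, hja⟩)
    subst hYnil
    set J' := insert a J with hJ'
    have hmem' : ∀ x ∈ J', x ∈ D.chainSet lam := by
      intro x hx
      rw [hJ', Finset.mem_insert] at hx
      rcases hx with rfl | hx
      · exact haI.1.1
      · exact hc.mem x hx
    rw [hS, List.pairwise_append] at hpJ
    have hsort' : D.sorted lam J' = L₁ ++ a :: R := by
      refine sorted_eq hmem' ?_ fun x => ?_
      · rw [List.pairwise_append, List.pairwise_cons]
        refine ⟨hpJ.1, ⟨hRa, hpJ.2.1⟩, fun x hx y hy => ?_⟩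
        exact (List.mem_cons.1 hy).elim (fun h' => h' ▸ hL₁a x hx) fun h' => hpJ.2.2 x hx y h'
      · rw [hJ', Finset.mem_insert, ← mem_sorted (lam := lam) (J := J), hS]
        simp only [List.mem_append, List.mem_cons]
        tauto
    have hins : IsInsert lam i J J' L₁ R a :=
      ⟨hc.mem, hmem', hS, hsort', ha, noFold_of_not_mem hc.mem (B := [])
        (by rw [List.append_nil]; exact hS) hex⟩
    exact ⟨J', .insert L₁ R X a hins hXY (hins.openFolds_end hXY hJ') hX hc
      (isAdmissible_iff.2 ⟨hmem', hins.coverChain hc.coverChain⟩)⟩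

end KacMoodyDatum

end AlcovePath

/-! ### Edges into a given admissible set and the operator `eᵢ`. -/

namespace AlcovePath

namespace KacMoodyDatum

set_option linter.unusedSectionVars false

variable {I P : Type*} [Fintype I] [AddCommGroup P] {D : KacMoodyDatum I P}
  [LinearOrder I] {lam : P} {i : I} {J J' : Finset D.Fold}

theorem gamma_neg_of_ne {k : D.Fold} (hk : k ∈ D.foldSet lam J i)
    (h : D.gamma lam J k ≠ D.simpleRoot i) : D.gamma lam J k = -D.simpleRoot i :=
  hk.2.resolve_left h

theorem IsMove.openFolds_start {L₁ L₂ L₃ X Y : List D.Fold} {a m : D.Fold}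
    (h : IsMove lam i J J' L₁ L₂ L₃ a m) (hJ' : D.openFolds lam i J' = X ++ m :: Y)
    (hJ : J = insert m (J'.erase a)) (hX : ∀ x ∈ X, D.chainLT lam x a) :
    D.openFolds lam i J = X ++ a :: Y := by
  have hpS := pairwise_openFolds (J := J') (lam := lam) (i := i)
  rw [hJ', List.pairwise_append, List.pairwise_cons] at hpS
  have ham := h.lt
  refine openFolds_eq ?_ fun x => ?_
  · rw [List.pairwise_append, List.pairwise_cons]
    refine ⟨hpS.1, ⟨fun y hy => chainLT_trans ham (hpS.2.1.1 y hy), hpS.2.1.2⟩,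
      fun x hx y hy => ?_⟩
    rcases List.mem_cons.1 hy with rfl | hy
    · exact hX x hx
    · exact hpS.2.2 x hx y (by simp [hy])
  · have hx : x ∈ X ++ m :: Y ↔ x ∈ D.foldSet lam J' i ∧ x ∉ J' := by rw [← hJ', mem_openFolds]
    have hmX : m ∉ X := fun h' => chainLT_irrefl m (hpS.2.2 m h' m (by simp))
    have hmY : m ∉ Y := fun h' => chainLT_irrefl m (hpS.2.1.1 m h')
    have hma : m ≠ a := by rintro h'; rw [h'] at ham; exact chainLT_irrefl a ham
    have haJ : a ∈ J' := by rw [← mem_sorted (lam := lam), h.sorted_eq']; simp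
    have ha : a ∈ D.foldSet lam J' i := ⟨h.mem' a haJ, .inl h.gamma_left⟩
    rw [← h.foldSet_eq, hJ, Finset.mem_insert, Finset.mem_erase]
    simp only [List.mem_append, List.mem_cons] at hx ⊢
    clear hpS hJ hJ' h hX ham
    by_cases hxm : x = a
    · subst hxm; tauto
    · by_cases hxa : x = m
      · subst hxa; tauto
      · tauto

theorem IsInsert.openFolds_start {L₁ L₂ X : List D.Fold} {a : D.Fold}
    (h : IsInsert lam i J J' L₁ L₂ a) (hJ' : D.openFolds lam i J' = X)
    (hJ : J = J'.erase a) (hX : ∀ x ∈ X, D.chainLT lam x a) :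
    D.openFolds lam i J = X ++ [a] := by
  have hpS := pairwise_openFolds (J := J') (lam := lam) (i := i)
  rw [hJ'] at hpS
  refine openFolds_eq ?_ fun x => ?_
  · rw [List.pairwise_append]
    refine ⟨hpS, List.pairwise_singleton _ _, fun x hx y hy => ?_⟩
    rw [List.mem_singleton.1 hy]
    exact hX x hx
  · have hx : x ∈ X ↔ x ∈ D.foldSet lam J' i ∧ x ∉ J' := by rw [← hJ', mem_openFolds]
    have haJ : a ∈ J' := by rw [← mem_sorted (lam := lam), h.sorted_eq']; simp
    have ha : a ∈ D.foldSet lam J' i := ⟨h.mem' a haJ, .inl h.gamma_left⟩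
    rw [← h.foldSet_eq, hJ, Finset.mem_erase]
    simp only [List.mem_append, List.mem_singleton]
    clear hpS hJ hJ' h hX
    by_cases hxa : x = a
    · subst hxa; tauto
    · tauto

/-- With no `-` surviving in `X`, its last letter is `+`. As no `+` comes after `a`, this letter,
and with it all of `X`, lies before `a`. -/
theorem lt_of_pos_last (hc : D.IsAdmissible lam J') {X : List D.Fold} {a : D.Fold}
    (hp : X.Pairwise (D.chainLT lam)) (hX : (D.sig lam i J' X).2 = [])
    (hXI : ∀ x ∈ X, x ∈ D.foldSet lam J' i ∧ x ∉ J') (ha : a ∈ J')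
    (h : ∀ x ∈ X, D.chainLT lam a x → ¬ D.IsAscent i (D.reflProd (D.before lam J' x))) :
    ∀ x ∈ X, D.chainLT lam x a := by
  classical
  rcases List.eq_nil_or_concat X with rfl | ⟨X, y, rfl⟩
  · simp
  rw [List.concat_eq_append] at *
  have hy : D.IsAscent i (D.reflProd (D.before lam J' y)) := by
    rw [← gamma_eq_iff_isAscent (hXI y (by simp)).1]
    exact pos_last (fun k => D.gamma lam J' k = D.simpleRoot i) hX
  have hya : D.chainLT lam y a := by
    refine chainLT_of_not_of_ne (hc.mem a ha) (hXI y (by simp)).1.1 (fun h' =>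
      h y (by simp) h' hy) ?_
    rintro rfl
    exact (hXI a (by simp)).2 ha
  intro x hx
  rw [List.pairwise_append] at hp
  simp only [List.mem_append, List.mem_singleton] at hx
  rcases hx with hx | rfl
  · exact chainLT_trans (hp.2.2 x hx y (by simp)) hya
  · exact hya

/-- The leftmost surviving `-` is at `m`. The identity is an ascent, so some fold over `αᵢ` must
precede `m`; the last such fold is the one that was moved. -/
theorem exists_isEdge_of_neg (hc : D.IsAdmissible lam J')
    (h : (D.sig lam i J' (D.openFolds lam i J')).2 ≠ []) : ∃ J, IsEdge lam i J J' := by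
  classical
  obtain ⟨X, Y, hXY, hb, hX, hY⟩ := exists_split_of_head_neg _ (List.head?_eq_some_head h)
  set m := (D.sig lam i J' (D.openFolds lam i J')).2.head h
  have hmI := mem_openFolds.1 (by rw [hXY]; simp : m ∈ D.openFolds lam i J')
  have hpS := pairwise_openFolds (J := J') (lam := lam) (i := i)
  rw [hXY, List.pairwise_append, List.pairwise_cons] at hpS
  have hna : ¬ D.IsAscent i (D.reflProd (D.before lam J' m)) := by
    rwa [← gamma_eq_iff_isAscent hmI.1]
  obtain ⟨L₁, a, L₂, hsplit, ha, hL₂⟩ :=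
    List.exists_last_split (fun x => x ∈ D.foldSet lam J' i) (D.before lam J' m) (by
      by_contra! hcon
      exact hna (isAscent_before hc fun j hj hjm => hcon j (mem_before.2 ⟨hj, hjm⟩)))
  have hS := sorted_eq_before_append hc.mem m
  set R := (D.sorted lam J').filter fun x => ¬ D.chainLT lam x m with hR
  have hRm : ∀ x ∈ R, D.chainLT lam m x := by
    intro x hx
    rw [hR, List.mem_filter, mem_sorted] at hx
    refine chainLT_of_not_of_ne (hc.mem x hx.1) hmI.1.1 (by simpa using hx.2) ?_
    rintro rfl
    exact hmI.2 hx.1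
  have hlt : ∀ x ∈ L₁ ++ a :: L₂, D.chainLT lam x m := fun x hx =>
    (mem_before.1 (by rw [hsplit]; exact hx)).2
  rw [hsplit] at hS
  have hS' : D.sorted lam J' = L₁ ++ a :: (L₂ ++ R) := by rw [hS]; simp
  have haJ : a ∈ J' := by rw [← mem_sorted (lam := lam), hS]; simp
  have ham : D.chainLT lam a m := hlt a (by simp)
  have hpJ := pairwise_sorted hc.mem
  rw [hS', List.pairwise_append, List.pairwise_cons, List.pairwise_append] at hpJ
  have hba : D.before lam J' a = L₁ := before_of_mem_split hc.mem hS'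
  have hleft : D.reflProd L₁ a.posRoot.root = D.simpleRoot i := by
    rw [← hc.gamma_of_mem haJ ha, gamma, hba]
  -- A `+` between `a` and `m` would persist up to `m`, since `a` is the last fold over `αᵢ` before
  -- `m`.
  have hXa : ∀ x ∈ X, D.chainLT lam x a := by
    refine lt_of_pos_last hc hpS.1 hX (fun x hx => mem_openFolds.1 (by rw [hXY]; simp [hx])) haJ
      fun x hx hax hasc => hna ?_
    refine isAscent_before_of_isAscent_before hc (hpS.2.2 x hx m (by simp)) ?_ hasc
    intro j hj hjx hjm
    have hj' : j ∈ L₁ ++ a :: L₂ := by rw [← hsplit]; exact mem_before.2 ⟨hj, hjm⟩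
    simp only [List.mem_append, List.mem_cons] at hj'
    rcases hj' with hj' | rfl | hj'
    · exact absurd (chainLT_trans (hpJ.2.2 j hj' a (by simp)) hax) hjx
    · exact absurd hax hjx
    · exact hL₂ j hj'
  set J := insert m (J'.erase a) with hJ
  have hmem : ∀ x ∈ J, x ∈ D.chainSet lam := by
    intro x hx
    rw [hJ, Finset.mem_insert, Finset.mem_erase] at hx
    rcases hx with rfl | hx
    · exact hmI.1.1
    · exact hc.mem x hx.2
  have hnd := nodup_of_pairwise (pairwise_sorted hc.mem)
  rw [hS'] at hnd
  have hsort : D.sorted lam J = L₁ ++ (L₂ ++ m :: R) := by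
    refine sorted_eq hmem ?_ fun x => ?_
    · rw [List.pairwise_append, List.pairwise_append, List.pairwise_cons]
      refine ⟨hpJ.1, ⟨hpJ.2.1.2.1, ⟨hRm, hpJ.2.1.2.2.1⟩, fun x hx y hy => ?_⟩, fun x hx y hy => ?_⟩
      · rcases List.mem_cons.1 hy with rfl | hy
        · exact hlt x (by simp [hx])
        · exact hpJ.2.1.2.2.2 x hx y hy
      · simp only [List.mem_append, List.mem_cons] at hy
        rcases hy with hy | rfl | hy
        · exact hpJ.2.2 x hx y (by simp [hy])
        · exact hlt x (by simp [hx])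
        · exact hpJ.2.2 x hx y (by simp [hy])
    · rw [hJ, Finset.mem_insert, Finset.mem_erase, ← mem_sorted (lam := lam) (J := J'), hS']
      have hax : a ∉ L₁ ∧ a ∉ L₂ ∧ a ∉ R := by
        rw [List.nodup_append, List.nodup_cons] at hnd
        refine ⟨fun h' => hnd.2.2 a h' a (by simp) rfl, ?_⟩
        simpa using hnd.2.1.1
      simp only [List.mem_append, List.mem_cons]
      clear_value R J m
      clear hnd hpJ hpS hS' hS hsplit hlt hJ hRm hXY hX hY hR h hXa hmem
      by_cases hxa : x = a
      · subst hxa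
        have : x ≠ m := fun he => chainLT_irrefl m (he ▸ ham)
        tauto
      · tauto
  have hmove : IsMove lam i J J' L₁ L₂ R a m := by
    have hno : D.NoFold i (D.reflProd (L₁ ++ [a])) L₂ :=
      noFold_of_not_mem hc.mem (B := R) (by rw [hS']; simp) hL₂
    rw [reflProd_insert hleft, List.append_nil, noFold_simpleReflection_mul] at hno
    refine ⟨hmem, hc.mem, hsort, hS', ham, hleft, ?_, hno⟩
    -- At `m` the set `J'` gives `-αᵢ`; removing the fold at `a` takes away a factor `sᵢ`, which
    -- leaves `αᵢ`.
    have h1 := gamma_neg_of_ne hmI.1 hb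
    rw [gamma, hsplit, reflProd_insert hleft, LinearEquiv.mul_apply, ← simpleReflection_simpleRoot,
      (D.simpleReflection i).injective.eq_iff] at h1
    exact h1
  have hJJ := hmove.openFolds_start hXY hJ hXa
  exact ⟨J, .move L₁ L₂ R X Y a m hmove hJJ hXY
    (by rw [← hmove.sig_left hJJ]; exact hX) (by rw [← hmove.sig_right hXY]; exact hY)
    (isAdmissible_iff.2 ⟨hmem, hmove.coverChain_symm hc.coverChain⟩) hc⟩

/-- With no surviving `-`, the descent of `τ` plays the role of a `-` at infinity: the last fold
over `αᵢ` was added by `fᵢ`, and a later open `+` would make `τ` an ascent. -/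
theorem exists_isEdge_of_not_isAscent (hc : D.IsAdmissible lam J')
    (h : (D.sig lam i J' (D.openFolds lam i J')).2 = []) (ht : ¬ D.IsAscent i (D.tau lam J')) :
    ∃ J, IsEdge lam i J J' := by
  classical
  obtain ⟨L₁, a, L₂, hS, ha, hL₂⟩ :=
    List.exists_last_split (fun x => x ∈ D.foldSet lam J' i) (D.sorted lam J') (by
      by_contra! hcon
      exact ht (isAscent_tau hc fun j hj => hcon j (mem_sorted.2 hj)))
  have haJ : a ∈ J' := by rw [← mem_sorted (lam := lam), hS]; simp
  have hpJ := pairwise_sorted hc.mem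
  rw [hS, List.pairwise_append, List.pairwise_cons] at hpJ
  have hba : D.before lam J' a = L₁ := before_of_mem_split hc.mem hS
  have hleft : D.reflProd L₁ a.posRoot.root = D.simpleRoot i := by
    rw [← hc.gamma_of_mem haJ ha, gamma, hba]
  have hXa : ∀ x ∈ D.openFolds lam i J', D.chainLT lam x a := by
    refine lt_of_pos_last hc pairwise_openFolds h (fun x hx => mem_openFolds.1 hx) haJ
      fun x hx hax hasc => ht ?_
    refine isAscent_tau_of_isAscent_before hc ?_ hasc
    intro j hj hjx
    rw [← mem_sorted (lam := lam), hS] at hj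
    simp only [List.mem_append, List.mem_cons] at hj
    rcases hj with hj | rfl | hj
    · exact absurd (chainLT_trans (hpJ.2.2 j hj a (by simp)) hax) hjx
    · exact absurd hax hjx
    · exact hL₂ j hj
  set J := J'.erase a with hJ
  have hmem : ∀ x ∈ J, x ∈ D.chainSet lam := fun x hx =>
    hc.mem x (Finset.mem_of_mem_erase hx)
  have hnd := nodup_of_pairwise (pairwise_sorted hc.mem)
  rw [hS] at hnd
  have hsort : D.sorted lam J = L₁ ++ L₂ := by
    refine sorted_eq hmem ?_ fun x => ?_
    · rw [List.pairwise_append]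
      exact ⟨hpJ.1, hpJ.2.1.2, fun x hx y hy => hpJ.2.2 x hx y (by simp [hy])⟩
    · rw [hJ, Finset.mem_erase, ← mem_sorted (lam := lam) (J := J'), hS]
      have hax : a ∉ L₁ ∧ a ∉ L₂ := by
        rw [List.nodup_append, List.nodup_cons] at hnd
        exact ⟨fun h' => hnd.2.2 a h' a (by simp) rfl, hnd.2.1.1⟩
      simp only [List.mem_append, List.mem_cons]
      clear hnd hpJ hS hJ h hXa hmem
      by_cases hxa : x = a
      · subst hxa; tauto
      · tauto
  have hins : IsInsert lam i J J' L₁ L₂ a := by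
    have hno : D.NoFold i (D.reflProd (L₁ ++ [a])) L₂ :=
      noFold_of_not_mem hc.mem (B := []) (by rw [hS]; simp) hL₂
    rw [reflProd_insert hleft, List.append_nil, noFold_simpleReflection_mul] at hno
    exact ⟨hmem, hc.mem, hsort, hS, hleft, hno⟩
  have hJJ := hins.openFolds_start rfl hJ hXa
  exact ⟨J, .insert L₁ L₂ _ a hins hJJ rfl (by rw [← hins.sig_left hJJ]; exact h)
    (isAdmissible_iff.2 ⟨hmem, hins.coverChain_symm hc.coverChain ht⟩) hc⟩

theorem fOp_eq_some_iff (hc : D.IsAdmissible lam J) :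
    D.fOp lam i J = some J' ↔ IsEdge lam i J J' := by
  refine ⟨fun h => ?_, fun h => h.fOp_eq_some⟩
  by_cases h0 : (D.sig lam i J (D.openFolds lam i J)).1 = []
  · rw [fOp_eq, h0] at h
    simp at h
  · obtain ⟨K, hK⟩ := exists_isEdge_of_pos hc h0
    rw [hK.fOp_eq_some, Option.some.injEq] at h
    exact h ▸ hK

theorem fOp_eq_none_iff (hc : D.IsAdmissible lam J) :
    D.fOp lam i J = none ↔ posCount lam i J = 0 := by
  constructor
  · intro h
    by_contra h0
    obtain ⟨K, hK⟩ := exists_isEdge_of_pos hc (i := i) (fun h' => h0 (by rw [posCount, h']; rfl))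
    rw [hK.fOp_eq_some] at h
    simp at h
  · intro h
    rw [posCount, List.length_eq_zero_iff] at h
    rw [fOp_eq, h]
    rfl

theorem exists_isEdge_of_negCount (hc : D.IsAdmissible lam J') (h : negCount lam i J' ≠ 0) :
    ∃ J, IsEdge lam i J J' := by
  by_cases h0 : (D.sig lam i J' (D.openFolds lam i J')).2 = []
  · refine exists_isEdge_of_not_isAscent hc h0 fun ht => h ?_
    rw [negCount, h0, if_pos ht]
    rfl
  · exact exists_isEdge_of_neg hc h0

theorem eOp_eq_none_of_negCount (h : negCount lam i J' = 0) : D.eOp lam i J' = none := by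
  rw [negCount, Nat.add_eq_zero_iff, List.length_eq_zero_iff] at h
  rw [eOp_eq, h.1]
  simp only [List.head?_nil]
  rw [if_neg]
  rw [simpleCoroot_rho_neg_iff (tau_mem J'), not_not]
  by_contra ht
  rw [if_neg ht] at h
  simp at h

theorem eOp_eq_some_iff (hc : D.IsAdmissible lam J') :
    D.eOp lam i J' = some J ↔ IsEdge lam i J J' := by
  refine ⟨fun h => ?_, fun h => h.eOp_eq_some⟩
  by_cases h0 : negCount lam i J' = 0
  · rw [eOp_eq_none_of_negCount h0] at h
    simp at h
  · obtain ⟨K, hK⟩ := exists_isEdge_of_negCount hc h0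
    rw [hK.eOp_eq_some, Option.some.injEq] at h
    exact h ▸ hK

theorem eOp_eq_none_iff (hc : D.IsAdmissible lam J') :
    D.eOp lam i J' = none ↔ negCount lam i J' = 0 := by
  refine ⟨fun h => ?_, eOp_eq_none_of_negCount⟩
  by_contra h0
  obtain ⟨K, hK⟩ := exists_isEdge_of_negCount hc h0
  rw [hK.eOp_eq_some] at h
  simp at h

end KacMoodyDatum

end AlcovePath

/-! ### Signed counts as integral parts in a lexicographic group. -/

namespace AlcovePath

namespace KacMoodyDatum

set_option linter.unusedSectionVars false

variable {I P : Type*} [Fintype I] [AddCommGroup P] {D : KacMoodyDatum I P}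
  [LinearOrder I] {lam : P} {i : I} {J K : Finset D.Fold}

/-! ### Counting the positions after a given one -/

/-- The integer `m` in the lexicographically ordered group `ℤ × ℤ^I`. -/
def lexInt (I : Type*) (m : ℤ) : ℤ ×ₗ Lex (I → ℤ) := toLex (m, 0)

theorem lexInt_lt_iff {m n : ℤ} : lexInt I m < lexInt I n ↔ m < n := by
  rw [lexInt, lexInt, Prod.Lex.toLex_lt_toLex]
  exact ⟨fun h => h.resolve_right fun h' => lt_irrefl _ h'.2, .inl⟩

theorem lexInt_le_iff {m n : ℤ} : lexInt I m ≤ lexInt I n ↔ m ≤ n := by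
  rw [← not_lt, lexInt_lt_iff, not_lt]

theorem neg_lexInt (m : ℤ) : -lexInt I m = lexInt I (-m) := by
  rw [lexInt, lexInt, ← toLex_neg, Prod.neg_mk, neg_zero]

theorem lexInt_sub (m n : ℤ) : lexInt I m - lexInt I n = lexInt I (m - n) := by
  rw [lexInt, lexInt, lexInt, ← toLex_sub, Prod.mk_sub_mk, sub_zero]

/-- Division with remainder in the first coordinate, except that when `b` divides it and the second
coordinate is negative the quotient drops by one. -/
theorem exists_lexInt_floor (v : ℤ ×ₗ Lex (I → ℤ)) {b : ℤ} (hb : 0 < b) :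
    ∃ n : ℤ, lexInt I (n * b) ≤ v ∧ v < lexInt I ((n + 1) * b) := by
  obtain ⟨⟨x, y⟩, rfl⟩ := toLex.surjective v
  have h1 := Int.emod_nonneg x hb.ne'
  have h2 := Int.emod_lt_of_pos x hb
  have h3 := Int.emod_add_mul_ediv x b
  simp only [lexInt, Prod.Lex.toLex_lt_toLex, Prod.Lex.toLex_le_toLex]
  by_cases h : 0 < x % b ∨ 0 ≤ y
  · refine ⟨x / b, ?_, .inl (by nlinarith)⟩
    rcases h with h | h
    · exact .inl (by nlinarith)
    · rcases h1.lt_or_eq with h1 | h1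
      · exact .inl (by nlinarith)
      · exact .inr ⟨by nlinarith, h⟩
  · push Not at h
    have h0 : x % b = 0 := le_antisymm h.1 h1
    exact ⟨x / b - 1, .inl (by nlinarith), .inr ⟨by nlinarith, h.2⟩⟩

theorem lexInt_floor_unique {v : ℤ ×ₗ Lex (I → ℤ)} {b m n : ℤ} (hb : 0 < b)
    (hm : lexInt I (m * b) < v) (hm' : v < lexInt I ((m + 1) * b))
    (hn : lexInt I (n * b) < v) (hn' : v < lexInt I ((n + 1) * b)) : m = n := by
  have h1 := lexInt_lt_iff.1 (hm.trans hn')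
  have h2 := lexInt_lt_iff.1 (hn.trans hm')
  have h3 := lt_of_mul_lt_mul_right h1 hb.le
  have h4 := lt_of_mul_lt_mul_right h2 hb.le
  omega

/-- The distance of a folding position from the top level `⟨λ, β^∨⟩`. -/
noncomputable def colevel (lam : P) (j : D.Fold) : ℤ := j.posRoot.coroot lam - j.level

/-- The crossing time, scaled by `⟨λ, β_j^∨⟩`, with the wall through `j` of the functional `f` with
`f λ = x` and coordinates `c`. -/
noncomputable def crossing (lam : P) (j : D.Fold) (x : ℤ) (c : I → ℤ) : ℤ ×ₗ Lex (I → ℤ) :=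
  toLex (colevel lam j * x,
    toLex fun t => j.posRoot.coroot lam * c t - x * j.posRoot.coeff t)

theorem crossing_neg (j : D.Fold) (x : ℤ) (c : I → ℤ) :
    crossing lam j (-x) (-c) = -crossing lam j x c := by
  rw [crossing, crossing, ← toLex_neg, Prod.neg_mk, ← toLex_neg]
  congr 2
  · ring
  · congr 1
    funext t
    simp only [Pi.neg_apply]
    ring

/-- Subtracting a multiple of the coroot of `j` shifts the value by a multiple of `⟨λ, β_j^∨⟩` and
leaves the tie-breaking coordinates alone. Hence a reflection changes the integral part by a known
integer. -/
theorem crossing_sub (j : D.Fold) (x m : ℤ) (c : I → ℤ) :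
    crossing lam j (x - m * j.posRoot.coroot lam) (c - m • j.posRoot.coeff) =
      crossing lam j x c - lexInt I (m * colevel lam j * j.posRoot.coroot lam) := by
  rw [crossing, crossing, lexInt, ← toLex_sub, Prod.mk_sub_mk, sub_zero]
  congr 2
  · ring
  · congr 1
    funext t
    simp only [Pi.sub_apply, Pi.smul_apply, smul_eq_mul]
    ring

/-- The order of the chain with denominators cleared, and with levels counted down from the top. For
fixed `j` and fixed root of `k`, the right side does not involve the level of `k`. -/
theorem chainLT_iff {j k : D.Fold} (hj : j ∈ D.chainSet lam) (hk : k ∈ D.chainSet lam) :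
    D.chainLT lam j k ↔ lexInt I (colevel lam k * j.posRoot.coroot lam) <
      crossing lam j (k.posRoot.coroot lam) k.posRoot.coeff := by
  have hb : (0 : ℚ) < j.posRoot.coroot lam := by exact_mod_cast coroot_pos_of_mem hj
  have hx : (0 : ℚ) < k.posRoot.coroot lam := by exact_mod_cast coroot_pos_of_mem hk
  rw [chainLT, lexKey, lexKey, crossing, lexInt, Prod.Lex.toLex_lt_toLex,
    Prod.Lex.toLex_lt_toLex, div_lt_div_iff₀ hb hx, div_eq_div_iff hb.ne' hx.ne']
  simp only [colevel]
  refine or_congr ?_ (and_congr ?_ ?_)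
  · norm_cast
    constructor <;> intro h <;> linarith
  · norm_cast
    constructor <;> intro h <;> linarith
  · refine exists_congr fun t => and_congr (forall_congr' fun s => imp_congr_right fun _ => ?_) ?_
    · change (j.posRoot.coeff s : ℚ) / _ = (k.posRoot.coeff s : ℚ) / _ ↔ (0 : ℤ) =
        j.posRoot.coroot lam * k.posRoot.coeff s - k.posRoot.coroot lam * j.posRoot.coeff s
      rw [div_eq_div_iff hb.ne' hx.ne']
      norm_cast
      constructor <;> intro h <;> linarith
    · change (j.posRoot.coeff t : ℚ) / _ < (k.posRoot.coeff t : ℚ) / _ ↔ (0 : ℤ) <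
        j.posRoot.coroot lam * k.posRoot.coeff t - k.posRoot.coroot lam * j.posRoot.coeff t
      rw [div_lt_div_iff₀ hb hx]
      norm_cast
      constructor <;> intro h <;> linarith

theorem colevel_pos {j : D.Fold} (hj : j ∈ D.chainSet lam) : 0 < colevel lam j :=
  sub_pos.2 hj.2

theorem colevel_le {j : D.Fold} (hj : j ∈ D.chainSet lam) :
    colevel lam j ≤ j.posRoot.coroot lam := sub_le_self _ hj.1

theorem crossing_self (j : D.Fold) :
    crossing lam j (j.posRoot.coroot lam) j.posRoot.coeff =
      lexInt I (colevel lam j * j.posRoot.coroot lam) := by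
  rw [crossing, lexInt]
  congr 2
  exact congrArg toLex (funext fun t => by simp)

theorem crossing_pos (hlam : D.IsDominant lam) {j : D.Fold} (hj : j ∈ D.chainSet lam)
    (δ : D.PosRoot) : lexInt I 0 < crossing lam j (δ.coroot lam) δ.coeff := by
  have hd := colevel_pos hj
  have hb := coroot_pos_of_mem hj
  rw [crossing, lexInt, Prod.Lex.toLex_lt_toLex]
  rcases (δ.coroot_nonneg hlam).lt_or_eq with h | h
  · exact .inl (mul_pos hd h)
  · refine .inr ⟨by simp [← h], ?_⟩
    refine lt_of_le_of_ne (Pi.toLex_monotone fun t => ?_) fun h' => ?_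
    · simp only [← h, zero_mul, sub_zero]
      exact mul_nonneg hb.le (δ.coeff_nonneg t)
    · refine δ.coeff_ne_zero (funext fun t => ?_)
      have : (0 : ℤ) = j.posRoot.coroot lam * δ.coeff t - δ.coroot lam * j.posRoot.coeff t :=
        congrFun (toLex.injective h') t
      rw [← h, zero_mul, sub_zero, eq_comm, mul_eq_zero] at this
      exact this.resolve_left hb.ne'

/-- Equality would kill the second coordinate and make the two coroots proportional. It gives the
strict inequalities that let integral parts change sign in a controlled way. -/
theorem crossing_ne {j : D.Fold} (hlam : D.IsDominant lam) (hj : j ∈ D.chainSet lam)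
    {δ : D.PosRoot} (hδ : δ ≠ j.posRoot) (m : ℤ) :
    crossing lam j (δ.coroot lam) δ.coeff ≠ lexInt I m := by
  intro h
  have hb := coroot_pos_of_mem hj
  have h2 := congrArg Prod.snd (toLex.injective h)
  have h3 : ∀ t, j.posRoot.coroot lam * δ.coeff t = δ.coroot lam * j.posRoot.coeff t := fun t => by
    have : j.posRoot.coroot lam * δ.coeff t - δ.coroot lam * j.posRoot.coeff t = 0 :=
      congrFun (toLex.injective h2) t
    linarith
  rcases (δ.coroot_nonneg hlam).lt_or_eq with h0 | h0
  · exact hδ (PosRoot.eq_of_smul_coeff_eq hb h0 h3)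
  · refine δ.coeff_ne_zero (funext fun t => ?_)
    have := h3 t
    rw [← h0, zero_mul, mul_eq_zero] at this
    exact this.resolve_left hb.ne'

/-- The folding position with a given root and level. -/
def Fold.mk (β : D.PosRoot) (h : ℤ) : D.Fold := (β, h)

@[simp] theorem Fold.posRoot_mk (β : D.PosRoot) (h : ℤ) : (Fold.mk β h).posRoot = β := rfl

@[simp] theorem Fold.level_mk (β : D.PosRoot) (h : ℤ) : (Fold.mk β h).level = h := rfl

theorem root_injective_of_map {u : P ≃ₗ[ℤ] P} {β δ : D.PosRoot} (hβ : D.Hits i u β)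
    (hδ : D.Hits i u δ) : β = δ := by
  rcases hβ with h | h <;> rcases hδ with h' | h'
  · exact PosRoot.ext_root (u.injective (h.trans h'.symm))
  · have : β.root = -δ.root := u.injective (by rw [map_neg, h, h', neg_neg])
    exact absurd (this ▸ β.isNonneg) δ.not_isNonneg_neg
  · have : β.root = -δ.root := u.injective (by rw [map_neg, h, h'])
    exact absurd (this ▸ β.isNonneg) δ.not_isNonneg_neg
  · exact PosRoot.ext_root (u.injective (h.trans h'.symm))

open Classical in
/-- The signed number of positions after `j` that lie over `αᵢ` when no fold comes after `j`. -/
theorem sum_tail {j : D.Fold} (hj : j ∈ D.chainSet lam) {u : P ≃ₗ[ℤ] P} {δ : D.PosRoot}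
    (hδ : D.Hits i u δ) {t : ℕ}
    (ht : ∀ d : ℤ, 1 ≤ d → (lexInt I (d * j.posRoot.coroot lam) <
      crossing lam j (δ.coroot lam) δ.coeff ↔ d ≤ t)) {F : Finset D.Fold}
    (hF : ∀ k, k ∈ F ↔ k ∈ D.chainSet lam ∧ D.chainLT lam j k ∧ D.Hits i u k.posRoot) :
    ∑ k ∈ F, (if u k.posRoot.root = D.simpleRoot i then (1 : ℤ) else -1) =
      if D.IsAscent i u then (t : ℤ) else -t := by
  have hb := coroot_pos_of_mem hj
  -- All these positions have the same root `δ`, and `d` is their distance from the top level.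
  have hFeq : F = (Finset.Icc (1 : ℤ) t).image fun d => Fold.mk δ (δ.coroot lam - d) := by
    ext k
    rw [hF, Finset.mem_image]
    constructor
    · rintro ⟨hk, hjk, hh⟩
      obtain rfl := root_injective_of_map hh hδ
      rw [chainLT_iff hj hk, ht _ (colevel_pos hk)] at hjk
      exact ⟨colevel lam k, Finset.mem_Icc.2 ⟨colevel_pos hk, hjk⟩,
        root_ext rfl (sub_sub_cancel _ _)⟩
    · rintro ⟨d, hd, rfl⟩
      rw [Finset.mem_Icc] at hd
      have hlt := (ht d hd.1).2 hd.2
      -- This bound, with the distance of `j` at most `⟨λ, β_j^∨⟩`, keeps the level `⟨λ, δ^∨⟩ - d`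
      -- nonnegative.
      have hle : d * j.posRoot.coroot lam ≤ colevel lam j * δ.coroot lam := by
        rw [lexInt, crossing, Prod.Lex.toLex_lt_toLex] at hlt
        rcases hlt with hlt | hlt
        · exact hlt.le
        · exact hlt.1.le
      have h1 : 0 < δ.coroot lam :=
        pos_of_mul_pos_right ((mul_pos (by omega) hb).trans_le hle) (colevel_pos hj).le
      have h2 : d ≤ δ.coroot lam := by
        have : d * j.posRoot.coroot lam ≤ δ.coroot lam * j.posRoot.coroot lam := by
          rw [mul_comm (δ.coroot lam)]
          exact hle.trans (mul_le_mul_of_nonneg_right (colevel_le hj) h1.le)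
        exact le_of_mul_le_mul_right this hb
      have hk : Fold.mk δ (δ.coroot lam - d) ∈ D.chainSet lam :=
        ⟨sub_nonneg.2 h2, sub_lt_self _ (by omega)⟩
      refine ⟨hk, (chainLT_iff hj hk).2 ?_, hδ⟩
      have : colevel lam (Fold.mk δ (δ.coroot lam - d)) = d := sub_sub_cancel _ _
      rw [this]
      exact hlt
  have hval : ∀ k ∈ F, (if u k.posRoot.root = D.simpleRoot i then (1 : ℤ) else -1) =
      if D.IsAscent i u then 1 else -1 := by
    intro k hk
    have hh := ((hF k).1 hk).2.2
    by_cases ha : D.IsAscent i u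
    · rw [if_pos ha, if_pos (ha.map_root_eq hh)]
    · rw [if_neg ha, if_neg fun h => ha (isAscent_of_map_root h)]
  have hcard : F.card = t := by
    rw [hFeq, Finset.card_image_of_injective, Int.card_Icc]
    · omega
    · intro d d' h
      have := congrArg Fold.level h
      simp only [Fold.level_mk] at this
      omega
  rw [Finset.sum_congr rfl hval, Finset.sum_const, hcard]
  split_ifs <;> simp

open Classical in
/-- The signed number of positions after `j` over `αᵢ`, corrected by the final sign, is the integral
part of the crossing time of `αᵢ^∨ ∘ u`. -/
theorem sum_tail_floor (hlam : D.IsDominant lam) {j : D.Fold} (hj : j ∈ D.chainSet lam)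
    {u : P ≃ₗ[ℤ] P} (hu : u ∈ D.weylGroup) (hne : ¬ D.Hits i u j.posRoot) {F : Finset D.Fold}
    (hF : ∀ k, k ∈ F ↔ k ∈ D.chainSet lam ∧ D.chainLT lam j k ∧ D.Hits i u k.posRoot)
    {c : I → ℤ} (hc : (D.simpleCoroot i).comp u.toLinearMap = ∑ t, c t • D.simpleCoroot t) :
    ∃ n : ℤ, ∑ k ∈ F, (if u k.posRoot.root = D.simpleRoot i then (1 : ℤ) else -1) =
        n + (if D.IsAscent i u then 0 else 1) ∧
      lexInt I (n * j.posRoot.coroot lam) < crossing lam j (D.simpleCoroot i (u lam)) c ∧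
      crossing lam j (D.simpleCoroot i (u lam)) c < lexInt I ((n + 1) * j.posRoot.coroot lam) := by
  have hb := coroot_pos_of_mem hj
  obtain ⟨δ, hδ⟩ := exists_posRoot (inv_mem hu) i
  have hδ' : D.Hits i u δ := by
    rcases hδ with h | h
    · exact .inl (by rw [← h, apply_inv_apply])
    · exact .inr (by rw [← neg_eq_iff_eq_neg, ← map_neg, ← h, apply_inv_apply])
  have hδj : δ ≠ j.posRoot := by rintro rfl; exact hne hδ'
  obtain ⟨n, hn, hn'⟩ := exists_lexInt_floor (crossing lam j (δ.coroot lam) δ.coeff) hb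
  have hn := lt_of_le_of_ne hn (crossing_ne hlam hj hδj _).symm
  have hn0 : 0 ≤ n := by
    have h1 := lexInt_lt_iff.1 ((crossing_pos hlam hj δ).trans hn')
    have := pos_of_mul_pos_left h1 hb.le
    omega
  obtain ⟨t, rfl⟩ := Int.eq_ofNat_of_zero_le hn0
  have hsum := sum_tail hj hδ' (t := t) (fun d _ => by
    constructor
    · intro h
      have := lt_of_mul_lt_mul_right (lexInt_lt_iff.1 (h.trans hn')) hb.le
      omega
    · intro h
      exact (lexInt_le_iff.2 (mul_le_mul_of_nonneg_right h hb.le)).trans_lt hn) hF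
  rw [hsum]
  rcases hδ' with h | h
  · have h1 : ∀ x, D.simpleCoroot i (u x) = δ.coroot x := fun x => by
      simpa using PosRoot.coroot_apply_of_map (γ := simplePosRoot i) hu h x
    have hcδ : c = δ.coeff := D.eq_of_sum_simpleCoroot_eq (by
      rw [← hc, ← δ.coroot_eq_sum]
      ext x
      exact h1 x)
    rw [h1, hcδ, if_pos (isAscent_of_map_root h), if_pos (isAscent_of_map_root h)]
    exact ⟨t, by ring, hn, hn'⟩
  · have h1 : ∀ x, D.simpleCoroot i (u x) = -δ.coroot x := fun x => by
      simpa using PosRoot.coroot_apply_of_map_neg (γ := simplePosRoot i) hu h x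
    have hcδ : c = -δ.coeff := D.eq_of_sum_simpleCoroot_eq (by
      rw [← hc]
      simp only [Pi.neg_apply, neg_smul, Finset.sum_neg_distrib, ← δ.coroot_eq_sum]
      ext x
      exact h1 x)
    rw [h1, hcδ, crossing_neg, if_neg (not_isAscent_of_map_root h),
      if_neg (not_isAscent_of_map_root h)]
    -- Negation turns a value strictly between `t` and `t + 1`, in units of `⟨λ, β_j^∨⟩`, into one
    -- with integral part `-t - 1`. The final sign of a descent makes up for the extra `-1`.
    refine ⟨-t - 1, by ring, ?_, ?_⟩
    · rw [lt_neg, neg_lexInt]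
      rwa [show -((-(t : ℤ) - 1) * j.posRoot.coroot lam) = (t + 1) * j.posRoot.coroot lam by ring]
    · rw [neg_lt, neg_lexInt]
      rwa [show -((-(t : ℤ) - 1 + 1) * j.posRoot.coroot lam) = t * j.posRoot.coroot lam by ring]

theorem exists_coeff_comp {u : P ≃ₗ[ℤ] P} (hu : u ∈ D.weylGroup) (i : I) :
    ∃ c : I → ℤ, (D.simpleCoroot i).comp u.toLinearMap = ∑ t, c t • D.simpleCoroot t := by
  obtain ⟨l, hl⟩ := D.exists_word (inv_mem hu)
  obtain ⟨n, c, -, hc, -⟩ := D.exists_coordinates l i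
  rw [hl, inv_inv] at hc
  exact ⟨c, hc⟩

open Classical in
/-- The effect of one more fold on the signed number of positions. -/
theorem sum_tail_fold (hlam : D.IsDominant lam) {j : D.Fold} (hj : j ∈ D.chainSet lam)
    {w : P ≃ₗ[ℤ] P} (hw : w ∈ D.weylGroup)
    (hcov : D.BruhatCover w (w * j.posRoot.reflection)) {F F' : Finset D.Fold}
    (hF : ∀ k, k ∈ F ↔ k ∈ D.chainSet lam ∧ D.chainLT lam j k ∧ D.Hits i w k.posRoot)
    (hF' : ∀ k, k ∈ F' ↔ k ∈ D.chainSet lam ∧ D.chainLT lam j k ∧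
      D.Hits i (w * j.posRoot.reflection) k.posRoot) :
    ((∑ k ∈ F', if (w * j.posRoot.reflection) k.posRoot.root = D.simpleRoot i
        then (1 : ℤ) else -1) -
      if D.IsAscent i (w * j.posRoot.reflection) then 0 else 1) =
    (((∑ k ∈ F, if w k.posRoot.root = D.simpleRoot i then (1 : ℤ) else -1) -
      if D.IsAscent i w then 0 else 1) + if D.Hits i w j.posRoot then 1 else 0) -
      colevel lam j * D.simpleCoroot i (w j.posRoot.root) := by
  have hb := coroot_pos_of_mem hj
  have hw' := mul_mem hw j.posRoot.reflection_mem
  have hd := colevel_pos hj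
  by_cases hh : D.Hits i w j.posRoot
  · have hpos : w j.posRoot.root = D.simpleRoot i := by
      refine hh.resolve_right fun h => ?_
      obtain ⟨γ, hγ⟩ := BruhatCover.exists_map_root hw hcov
      rw [h] at hγ
      exact (simplePosRoot i : D.PosRoot).not_isNonneg_neg
        (show D.IsNonneg (-D.simpleRoot i) from hγ ▸ γ.isNonneg)
    have hr := simpleReflection_mul_eq hw hh
    have hh' : D.Hits i (w * j.posRoot.reflection) j.posRoot := by
      rwa [hr, hits_simpleReflection_mul]
    have ha := isAscent_of_map_root hpos
    have ha' : ¬ D.IsAscent i (w * j.posRoot.reflection) := by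
      rw [hr, isAscent_simpleReflection_mul hw, not_not]
      exact ha
    -- When `j` lies over `αᵢ`, the later positions are those of the same root nearer to the top.
    -- The distance of `j` itself is excluded, whence the `- 1`.
    have ht : ∀ d : ℤ, 1 ≤ d → (lexInt I (d * j.posRoot.coroot lam) <
        crossing lam j (j.posRoot.coroot lam) j.posRoot.coeff ↔
          d ≤ ((colevel lam j - 1).toNat : ℤ)) := by
      intro d hd1
      rw [crossing_self, lexInt_lt_iff, mul_lt_mul_iff_left₀ hb]
      omega
    rw [sum_tail hj hh ht hF, sum_tail hj hh' ht hF', if_pos ha, if_neg ha', if_pos ha,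
      if_neg ha', if_pos hh, hpos, D.cartan_self]
    omega
  · have hh' : ¬ D.Hits i (w * j.posRoot.reflection) j.posRoot := by
      intro h
      apply hh
      rcases h with h | h <;> rw [LinearEquiv.mul_apply, PosRoot.reflection_root, map_neg] at h
      · exact .inr (neg_eq_iff_eq_neg.1 h)
      · exact .inl (neg_injective h)
    obtain ⟨c, hc⟩ := exists_coeff_comp hw i
    set m := D.simpleCoroot i (w j.posRoot.root) with hm
    have hc' : (D.simpleCoroot i).comp (w * j.posRoot.reflection).toLinearMap =
        ∑ t, (c - m • j.posRoot.coeff) t • D.simpleCoroot t := by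
      simp only [Pi.sub_apply, Pi.smul_apply, sub_smul, smul_assoc, Finset.sum_sub_distrib,
        ← Finset.smul_sum, ← j.posRoot.coroot_eq_sum, ← hc]
      ext x
      simp [PosRoot.reflection_apply, hm, mul_comm]
    obtain ⟨n, hn1, hn2, hn3⟩ := sum_tail_floor hlam hj hw hh hF hc
    obtain ⟨n', hn1', hn2', hn3'⟩ := sum_tail_floor hlam hj hw' hh' hF' hc'
    have hx : D.simpleCoroot i ((w * j.posRoot.reflection) lam) =
        D.simpleCoroot i (w lam) - m * j.posRoot.coroot lam := by
      simp [PosRoot.reflection_apply, hm, mul_comm]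
    rw [hx, crossing_sub] at hn2' hn3'
    -- The two values differ by exactly `m * colevel lam j` units, so their integral parts do too.
    have key : n' = n - m * colevel lam j := by
      refine lexInt_floor_unique hb hn2' hn3' ?_ ?_
      · rw [sub_mul, ← lexInt_sub]
        exact sub_lt_sub_right hn2 _
      · rw [show (n - m * colevel lam j + 1) * j.posRoot.coroot lam =
          (n + 1) * j.posRoot.coroot lam - m * colevel lam j * j.posRoot.coroot lam by ring,
          ← lexInt_sub]
        exact sub_lt_sub_right hn3 _
    rw [hn1, hn1', if_neg hh, key]
    ring

end KacMoodyDatum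

end AlcovePath

/-! ### The weight identity; `A(λ)` is an abstract crystal. -/

namespace AlcovePath

namespace KacMoodyDatum

set_option linter.unusedSectionVars false

variable {I P : Type*} [Fintype I] [AddCommGroup P] {D : KacMoodyDatum I P}
  [LinearOrder I] {lam : P} {i : I} {J J' K : Finset D.Fold}

/-! ### The weight and the signature -/

open Classical in
theorem posCount_sub_negCount : (posCount lam i J : ℤ) - negCount lam i J =
    (∑ k ∈ (D.foldSet_finite lam J i).toFinset \ J,
      if D.gamma lam J k = D.simpleRoot i then (1 : ℤ) else -1) -
      if D.IsAscent i (D.tau lam J) then 0 else 1 := by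
  have h := signature_length_sub (fun k => D.gamma lam J k = D.simpleRoot i)
    (D.openFolds lam i J)
  have hp : (D.openFolds lam i J).Perm ((D.foldSet_finite lam J i).toFinset \ J).toList :=
    List.perm_insertionSort _ _
  rw [(hp.map _).sum_eq, Finset.sum_map_toList] at h
  rw [← h, posCount, negCount, sig]
  split_ifs <;> push_cast <;> ring

theorem isAdmissible_empty : D.IsAdmissible lam ∅ :=
  ⟨by simp, by simp⟩

theorem sorted_empty : D.sorted lam ∅ = [] := by
  rw [← List.length_eq_zero_iff, length_sorted, Finset.card_empty]

theorem weight_empty : D.weight lam ∅ = lam := by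
  rw [weight_eq, sorted_empty]
  exact neg_neg lam

theorem before_empty (k : D.Fold) : D.before lam ∅ k = [] := by
  rw [before, sorted_empty]; rfl

theorem mem_foldSet_empty {k : D.Fold} : k ∈ D.foldSet lam ∅ i ↔
    k ∈ D.chainSet lam ∧ k.posRoot = simplePosRoot i := by
  rw [mem_foldSet_iff, before_empty, reflProd_nil]
  refine and_congr_right fun _ => ⟨fun h => ?_, fun h => .inl (by rw [h]; rfl)⟩
  exact root_injective_of_map h (.inl rfl)

theorem posCount_sub_negCount_empty (hlam : D.IsDominant lam) :
    (posCount lam i (∅ : Finset D.Fold) : ℤ) - negCount lam i (∅ : Finset D.Fold) =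
      D.simpleCoroot i lam := by
  classical
  rw [posCount_sub_negCount, tau, sorted_empty, reflProd_nil, if_pos (isAscent_one i),
    Finset.sdiff_empty, sub_zero]
  have h1 : ∀ k ∈ (D.foldSet_finite lam ∅ i).toFinset,
      (if D.gamma lam ∅ k = D.simpleRoot i then (1 : ℤ) else -1) = 1 := by
    intro k hk
    rw [Set.Finite.mem_toFinset, mem_foldSet_empty] at hk
    rw [if_pos]
    rw [gamma, before_empty, hk.2]
    rfl
  have h2 : (D.foldSet_finite lam ∅ i).toFinset =
      (Finset.Ico 0 (D.simpleCoroot i lam)).image (Fold.mk (simplePosRoot i)) := by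
    ext k
    rw [Set.Finite.mem_toFinset, mem_foldSet_empty, Finset.mem_image]
    constructor
    · rintro ⟨hk, h⟩
      refine ⟨k.level, Finset.mem_Ico.2 ⟨hk.1, ?_⟩, by rw [← h]; rfl⟩
      have := hk.2
      rwa [h, coroot_simplePosRoot] at this
    · rintro ⟨h, hh, rfl⟩
      rw [Finset.mem_Ico] at hh
      refine ⟨⟨hh.1, ?_⟩, rfl⟩
      rw [Fold.posRoot_mk, coroot_simplePosRoot]
      exact hh.2
  rw [Finset.sum_congr rfl h1, h2, Finset.sum_const, Finset.card_image_of_injective,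
    Int.card_Ico, sub_zero]
  · have := hlam i
    simp [this]
  · intro a b h
    exact congrArg Fold.level h

/-- Adding a last fold `j` leaves the signs before `j` alone, removes `j` itself from the open
positions, and changes the signs after `j` together with the final sign as computed in
`sum_tail_fold`. -/
theorem posCount_sub_negCount_insert (hlam : D.IsDominant lam) (hJ : D.IsAdmissible lam J)
    {j : D.Fold} (hs : D.sorted lam J = D.sorted lam K ++ [j]) :
    (posCount lam i J : ℤ) - negCount lam i J = (posCount lam i K : ℤ) - negCount lam i K -
      colevel lam j * D.simpleCoroot i (D.tau lam K j.posRoot.root) := by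
  classical
  have hJmem : ∀ x, x ∈ J ↔ x ∈ K ∨ x = j := fun x => by
    rw [← mem_sorted (lam := lam), hs, ← mem_sorted (lam := lam) (J := K)]
    simp
  have hj : j ∈ D.chainSet lam := hJ.mem j ((hJmem j).2 (.inr rfl))
  have hp := pairwise_sorted hJ.mem
  rw [hs, List.pairwise_append] at hp
  have hKj : ∀ x ∈ K, D.chainLT lam x j := fun x hx => hp.2.2 x (mem_sorted.2 hx) j (by simp)
  have hjK : j ∉ K := fun h => chainLT_irrefl j (hKj j h)
  set w := D.tau lam K with hw
  have hwW : w ∈ D.weylGroup := tau_mem K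
  have htau : D.tau lam J = w * j.posRoot.reflection := by
    rw [tau, hs, reflProd_append]
    simp [hw, tau]
  have hcov : D.BruhatCover w (w * j.posRoot.reflection) := by
    have := hJ.coverChain
    rw [hs, coverChain_append, one_mul] at this
    exact this.2.1
  have hlow : ∀ k, ¬ D.chainLT lam j k → D.before lam J k = D.before lam K k := fun k hk =>
    before_eq_of_le (R := []) (R' := [j]) (by rw [List.append_nil]) hs (by simp) (by simpa using hk)
  have hhighK : ∀ k, D.chainLT lam j k → D.reflProd (D.before lam K k) = w := fun k hk => by
    rw [before_of_split (A := D.sorted lam K) (B := []) (List.append_nil _).symm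
      (fun x hx => chainLT_trans (hKj x (mem_sorted.1 hx)) hk) (by simp)]
    rfl
  have hhighJ : ∀ k, D.chainLT lam j k →
      D.reflProd (D.before lam J k) = w * j.posRoot.reflection := fun k hk => by
    rw [before_of_split (A := D.sorted lam J) (B := []) (List.append_nil _).symm
      (fun x hx => ?_) (by simp)]
    · exact htau
    · rcases (hJmem x).1 (mem_sorted.1 hx) with hx | rfl
      · exact chainLT_trans (hKj x hx) hk
      · exact hk
  have hbj : D.before lam K j = D.sorted lam K :=
    before_of_split (B := []) (List.append_nil _).symm (fun x hx => hKj x (mem_sorted.1 hx))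
      (by simp)
  set FK := (D.foldSet_finite lam K i).toFinset \ K with hFK
  set FJ := (D.foldSet_finite lam J i).toFinset \ J with hFJ
  have hmK : ∀ k, k ∈ FK ↔ k ∈ D.foldSet lam K i ∧ k ∉ K := fun k => by
    rw [hFK, Finset.mem_sdiff, Set.Finite.mem_toFinset]
  have hmJ : ∀ k, k ∈ FJ ↔ k ∈ D.foldSet lam J i ∧ k ∉ J := fun k => by
    rw [hFJ, Finset.mem_sdiff, Set.Finite.mem_toFinset]
  have h1 : ∀ k, k ∈ FK.filter (fun k => D.chainLT lam j k) ↔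
      k ∈ D.chainSet lam ∧ D.chainLT lam j k ∧ D.Hits i w k.posRoot := by
    intro k
    rw [Finset.mem_filter, hmK, mem_foldSet_iff]
    constructor
    · rintro ⟨⟨⟨h1, h2⟩, -⟩, h3⟩
      rw [hhighK k h3] at h2
      exact ⟨h1, h3, h2⟩
    · rintro ⟨h1, h3, h2⟩
      rw [hhighK k h3]
      exact ⟨⟨⟨h1, h2⟩, fun h => chainLT_asymm h3 (hKj k h)⟩, h3⟩
  have h2 : ∀ k, k ∈ FJ.filter (fun k => D.chainLT lam j k) ↔
      k ∈ D.chainSet lam ∧ D.chainLT lam j k ∧ D.Hits i (w * j.posRoot.reflection) k.posRoot := by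
    intro k
    rw [Finset.mem_filter, hmJ, mem_foldSet_iff]
    constructor
    · rintro ⟨⟨⟨h1, h2⟩, -⟩, h3⟩
      rw [hhighJ k h3] at h2
      exact ⟨h1, h3, h2⟩
    · rintro ⟨h1, h3, h2⟩
      rw [hhighJ k h3]
      refine ⟨⟨⟨h1, h2⟩, fun h => ?_⟩, h3⟩
      rcases (hJmem k).1 h with h | rfl
      · exact chainLT_asymm h3 (hKj k h)
      · exact chainLT_irrefl _ h3
  have h3 : FJ.filter (fun k => ¬ D.chainLT lam j k) =
      (FK.filter (fun k => ¬ D.chainLT lam j k)).erase j := by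
    ext k
    rw [Finset.mem_erase, Finset.mem_filter, Finset.mem_filter, hmJ, hmK, hJmem]
    by_cases hk : D.chainLT lam j k
    · simp [hk]
    · rw [mem_foldSet_iff, mem_foldSet_iff, hlow k hk]
      tauto
  -- If `j` lies over `αᵢ`, it was an open `+` of `K`; this is the only difference up to `j`.
  have h4 : ∑ k ∈ FJ.filter (fun k => ¬ D.chainLT lam j k),
      (if D.gamma lam J k = D.simpleRoot i then (1 : ℤ) else -1) =
      ∑ k ∈ FK.filter (fun k => ¬ D.chainLT lam j k),
        (if D.gamma lam K k = D.simpleRoot i then (1 : ℤ) else -1) -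
        if D.Hits i w j.posRoot then 1 else 0 := by
    have h5 : ∀ k ∈ FJ.filter (fun k => ¬ D.chainLT lam j k),
        (if D.gamma lam J k = D.simpleRoot i then (1 : ℤ) else -1) =
          if D.gamma lam K k = D.simpleRoot i then (1 : ℤ) else -1 := fun k hk => by
      rw [gamma, gamma, hlow k (Finset.mem_filter.1 hk).2]
    rw [Finset.sum_congr rfl h5, h3]
    by_cases hh : D.Hits i w j.posRoot
    · have hjF : j ∈ FK.filter (fun k => ¬ D.chainLT lam j k) := by
        rw [Finset.mem_filter, hmK, mem_foldSet_iff, hbj]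
        exact ⟨⟨⟨hj, hh⟩, hjK⟩, chainLT_irrefl j⟩
      have hg : D.gamma lam K j = D.simpleRoot i := by
        have h6 := hlow j (chainLT_irrefl j)
        rw [gamma, ← h6]
        exact hJ.gamma_of_mem ((hJmem j).2 (.inr rfl)) ⟨hj, by rw [gamma, h6, hbj]; exact hh⟩
      rw [← Finset.sum_erase_add _ _ hjF, if_pos hg, if_pos hh]
      ring
    · rw [if_neg hh, sub_zero, Finset.erase_eq_of_notMem]
      rw [Finset.mem_filter, hmK, mem_foldSet_iff, hbj]
      exact fun h => hh h.1.1.2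
  have h5 : ∑ k ∈ FJ.filter (fun k => D.chainLT lam j k),
      (if D.gamma lam J k = D.simpleRoot i then (1 : ℤ) else -1) =
      ∑ k ∈ FJ.filter (fun k => D.chainLT lam j k),
      if (w * j.posRoot.reflection) k.posRoot.root = D.simpleRoot i then (1 : ℤ) else -1 :=
    Finset.sum_congr rfl fun k hk => by rw [gamma, hhighJ k (Finset.mem_filter.1 hk).2]
  have h6 : ∑ k ∈ FK.filter (fun k => D.chainLT lam j k),
      (if D.gamma lam K k = D.simpleRoot i then (1 : ℤ) else -1) =
      ∑ k ∈ FK.filter (fun k => D.chainLT lam j k),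
      if w k.posRoot.root = D.simpleRoot i then (1 : ℤ) else -1 :=
    Finset.sum_congr rfl fun k hk => by rw [gamma, hhighK k (Finset.mem_filter.1 hk).2]
  have h7 := sum_tail_fold (i := i) hlam hj hwW hcov h1 h2
  rw [posCount_sub_negCount, posCount_sub_negCount, htau,
    ← Finset.sum_filter_add_sum_filter_not FJ (fun k => D.chainLT lam j k),
    ← Finset.sum_filter_add_sum_filter_not FK (fun k => D.chainLT lam j k), h4, h5, h6]
  linarith

/-- The innermost affine reflection moves `-λ` by `⟨λ, β_j^∨⟩ - ℓ_j` times `β_j`, and the others act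
on this difference by their linear parts. -/
theorem weight_insert {j : D.Fold} (hs : D.sorted lam J = D.sorted lam K ++ [j]) :
    D.weight lam J = D.weight lam K - colevel lam j • D.tau lam K j.posRoot.root := by
  have h : affineProd [j] (-lam) = -lam - (-colevel lam j) • j.posRoot.root := by
    change j.posRoot.affineReflection (-j.level) (-lam) = _
    rw [PosRoot.affineReflection, map_neg, colevel]
    congr 2
    ring
  rw [weight_eq, weight_eq, hs, affineProd_append, h, affineProd_sub, map_smul, tau]
  module

/-- Induction on the number of folds: an initial piece of an admissible set is admissible, and a
last fold changes both sides by the same amount. -/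
theorem simpleCoroot_weight (hlam : D.IsDominant lam) (hJ : D.IsAdmissible lam J) :
    (posCount lam i J : ℤ) - negCount lam i J = D.simpleCoroot i (D.weight lam J) := by
  classical
  induction hn : J.card generalizing J with
  | zero =>
    rw [Finset.card_eq_zero] at hn
    subst hn
    rw [posCount_sub_negCount_empty hlam, weight_empty]
  | succ n ih =>
    rcases List.eq_nil_or_concat (D.sorted lam J) with h | ⟨L, j, h⟩
    · have := length_sorted (lam := lam) J
      rw [h, hn] at this
      simp at this
    rw [List.concat_eq_append] at h
    have hp := pairwise_sorted hJ.mem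
    rw [h, List.pairwise_append] at hp
    have hmem : ∀ x, x ∈ J ↔ x ∈ L ∨ x = j := fun x => by
      rw [← mem_sorted (lam := lam), h]; simp
    have hjL : j ∉ L := fun h' => chainLT_irrefl j (hp.2.2 j h' j (by simp))
    have hKmem : ∀ x ∈ J.erase j, x ∈ D.chainSet lam := fun x hx =>
      hJ.mem x (Finset.mem_of_mem_erase hx)
    have hsK : D.sorted lam (J.erase j) = L := sorted_eq hKmem hp.1 fun x => by
      rw [Finset.mem_erase, hmem]
      constructor
      · intro hx
        exact ⟨fun hxj => hjL (hxj ▸ hx), .inl hx⟩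
      · rintro ⟨h1, h2 | h2⟩
        · exact h2
        · exact absurd h2 h1
    have hs : D.sorted lam J = D.sorted lam (J.erase j) ++ [j] := by rw [hsK, h]
    have hK : D.IsAdmissible lam (J.erase j) := by
      refine isAdmissible_iff.2 ⟨hKmem, ?_⟩
      have := hJ.coverChain
      rw [hs, coverChain_append] at this
      exact this.1
    rw [posCount_sub_negCount_insert hlam hJ hs, weight_insert hs,
      ih hK (by rw [Finset.card_erase_of_mem ((hmem j).2 (.inr rfl)), hn]; rfl), map_sub, map_smul,
      smul_eq_mul]

/-- The weight changes by some `n αᵢ`. One `+` is lost and one `-` gained, so pairing with `αᵢ^∨`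
gives `2n = -2`. -/
theorem IsEdge.weight_eq (hlam : D.IsDominant lam) (h : IsEdge lam i J J') :
    D.weight lam J' = D.weight lam J - D.simpleRoot i := by
  obtain ⟨n, hn⟩ := h.exists_weight
  have h1 := simpleCoroot_weight (i := i) hlam h.left
  have h2 := simpleCoroot_weight (i := i) hlam h.right
  rw [hn, map_add, map_smul, D.cartan_self, smul_eq_mul, ← h1, h.posCount_eq, h.negCount_eq] at h2
  push_cast at h2
  have : n = -1 := by linarith
  rw [hn, this]
  module

/-! ### The crystal -/

theorem toAl_of_isAdmissible (h : D.IsAdmissible lam J) : D.toAl lam J = some ⟨J, h⟩ := dif_pos h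

theorem toAl_eq_some_iff {x : D.Al lam} : D.toAl lam J = some x ↔ x.1 = J := by
  constructor
  · intro h
    rw [toAl] at h
    split_ifs at h
    exact congrArg Subtype.val (Option.some.inj h).symm
  · rintro rfl
    exact toAl_of_isAdmissible x.2

theorem alF_eq_some_iff {x y : D.Al lam} : D.alF lam i x = some y ↔ IsEdge lam i x.1 y.1 := by
  rw [alF, Option.bind_eq_some_iff]
  constructor
  · rintro ⟨K, hK, h⟩
    rw [toAl_eq_some_iff] at h
    rw [h]
    exact (fOp_eq_some_iff x.2).1 hK
  · intro h
    exact ⟨y.1, h.fOp_eq_some, toAl_eq_some_iff.2 rfl⟩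

theorem alE_eq_some_iff {x y : D.Al lam} : D.alE lam i x = some y ↔ IsEdge lam i y.1 x.1 := by
  rw [alE, Option.bind_eq_some_iff]
  constructor
  · rintro ⟨K, hK, h⟩
    rw [toAl_eq_some_iff] at h
    rw [h]
    exact (eOp_eq_some_iff x.2).1 hK
  · intro h
    exact ⟨y.1, h.eOp_eq_some, toAl_eq_some_iff.2 rfl⟩

theorem alF_eq_none_iff {x : D.Al lam} : D.alF lam i x = none ↔ posCount lam i x.1 = 0 := by
  rw [← fOp_eq_none_iff x.2, alF]
  constructor
  · intro h
    by_contra hne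
    obtain ⟨K, hK⟩ := Option.ne_none_iff_exists'.1 hne
    rw [hK, Option.bind_some, toAl_of_isAdmissible ((fOp_eq_some_iff x.2).1 hK).right] at h
    simp at h
  · intro h
    rw [h]
    rfl

theorem alE_eq_none_iff {x : D.Al lam} : D.alE lam i x = none ↔ negCount lam i x.1 = 0 := by
  rw [← eOp_eq_none_iff x.2, alE]
  constructor
  · intro h
    by_contra hne
    obtain ⟨K, hK⟩ := Option.ne_none_iff_exists'.1 hne
    rw [hK, Option.bind_some, toAl_of_isAdmissible ((eOp_eq_some_iff x.2).1 hK).left] at h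
    simp at h
  · intro h
    rw [h]
    rfl

theorem iter_succ' {B : Type*} (g : B → Option B) (n : ℕ) (b : B) :
    iter g (n + 1) b = (g b).bind (iter g n) := by
  induction n with
  | zero => simp [iter]
  | succ n ih =>
    change (iter g (n + 1) b).bind g = (g b).bind fun c => (iter g n c).bind g
    rw [ih, Option.bind_assoc]

/-- A statistic that drops by one at each application and vanishes exactly where the operator does
is the length of the string. -/
theorem stringLength_eq {B : Type*} {g : B → Option B} {m : B → ℕ}
    (h0 : ∀ b, g b = none ↔ m b = 0) (h1 : ∀ b b', g b = some b' → m b = m b' + 1) (b : B) :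
    stringLength g b = m b := by
  have key : ∀ n b, iter g n b ≠ none ↔ n ≤ m b := by
    intro n
    induction n with
    | zero => intro b; simp [iter]
    | succ n ih =>
      intro b
      rw [iter_succ']
      rcases hg : g b with - | c
      · have := (h0 b).1 hg
        exact iff_of_false (by simp) (by omega)
      · rw [Option.bind_some, ih, h1 b c hg]
        omega
  rw [stringLength]
  simp only [key]
  exact csSup_Iic

theorem stringLength_alF (x : D.Al lam) : stringLength (D.alF lam i) x = posCount lam i x.1 :=
  stringLength_eq (m := fun x : D.Al lam => posCount lam i x.1) (fun _ => alF_eq_none_iff)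
    (fun _ _ h => (alF_eq_some_iff.1 h).posCount_eq) x

theorem stringLength_alE (x : D.Al lam) : stringLength (D.alE lam i) x = negCount lam i x.1 :=
  stringLength_eq (m := fun x : D.Al lam => negCount lam i x.1) (fun _ => alE_eq_none_iff)
    (fun _ _ h => (alE_eq_some_iff.1 h).negCount_eq) x

theorem crystalAl_ε (x : D.Al lam) :
    (D.crystalAl lam).ε i x = ((negCount lam i x.1 : ℤ) : WithBot ℤ) := by
  rw [crystalAl, ← stringLength_alE]

theorem crystalAl_φ (x : D.Al lam) :
    (D.crystalAl lam).φ i x = ((posCount lam i x.1 : ℤ) : WithBot ℤ) := by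
  rw [crystalAl, ← stringLength_alF]

theorem isAbstractCrystal_crystalAl (hlam : D.IsDominant lam) :
    IsAbstractCrystal D (D.crystalAl lam) where
  nonempty := ⟨⟨∅, isAdmissible_empty⟩⟩
  φ_eq i x := by
    rw [crystalAl_φ, crystalAl_ε, ← WithBot.coe_add]
    congr 1
    have := simpleCoroot_weight (i := i) hlam x.2
    change _ = _ + D.simpleCoroot i (D.weight lam x.1)
    linarith
  ε_e i x y h := by
    have := (alE_eq_some_iff.1 h).negCount_eq
    rw [crystalAl_ε, crystalAl_ε, ← WithBot.coe_add]
    congr 1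
    omega
  φ_e i x y h := by
    have := (alE_eq_some_iff.1 h).posCount_eq
    rw [crystalAl_φ, crystalAl_φ, ← WithBot.coe_add]
    congr 1
    omega
  wt_e i x y h := by
    have := (alE_eq_some_iff.1 h).weight_eq hlam
    change D.weight lam y.1 = D.weight lam x.1 + _
    rw [this, sub_add_cancel]
  ε_f i x y h := by
    have := (alF_eq_some_iff.1 h).negCount_eq
    rw [crystalAl_ε, crystalAl_ε, ← WithBot.coe_add]
    congr 1
    omega
  φ_f i x y h := by
    have := (alF_eq_some_iff.1 h).posCount_eq
    rw [crystalAl_φ, crystalAl_φ, ← WithBot.coe_add]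
    congr 1
    omega
  wt_f i x y h := (alF_eq_some_iff.1 h).weight_eq hlam
  f_eq_iff i x y := by
    change D.alF lam i x = some y ↔ D.alE lam i y = some x
    rw [alF_eq_some_iff, alE_eq_some_iff]
  of_φ_eq_bot i x h := by
    rw [crystalAl_φ] at h
    exact absurd h (WithBot.coe_ne_bot)

end KacMoodyDatum

/-! ### Tensoring with a one-element crystal -/

section Tensor

variable {I P B : Type*} [Fintype I] [AddCommGroup P] {D : KacMoodyDatum I P}
  {C : CrystalData I P B} {nu : P} {i : I}

theorem tensor_crystalT_e (b : Unit × B) :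
    (tensor D (crystalT I nu) C).e i b = (C.e i b.2).map fun y => ((), y) := by
  simp [tensor, crystalT]

/-- The rule for `f` compares with `≤`, so for the value `-∞` of `φ` the operator would act on
`t_ν`; the hypothesis rules this out. The rule for `e` is strict and needs no such assumption. -/
theorem tensor_crystalT_f (h : ∀ i b, C.φ i b ≠ ⊥) (b : Unit × B) :
    (tensor D (crystalT I nu) C).f i b = (C.f i b.2).map fun y => ((), y) := by
  simp [tensor, crystalT, h]

theorem tensor_crystalT_ε (b : Unit × B) :
    (tensor D (crystalT I nu) C).ε i b = C.ε i b.2 := by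
  simp [tensor, crystalT]

theorem tensor_crystalT_φ (b : Unit × B) : (tensor D (crystalT I nu) C).φ i b =
    C.φ i b.2 + ((D.simpleCoroot i nu : ℤ) : WithBot ℤ) := by
  simp [tensor, crystalT]

theorem tensor_crystalT_wt (b : Unit × B) :
    (tensor D (crystalT I nu) C).wt b = nu + C.wt b.2 := rfl

theorem IsAbstractCrystal.tensor_crystalT (hC : IsAbstractCrystal D C)
    (h : ∀ i b, C.φ i b ≠ ⊥) : IsAbstractCrystal D (tensor D (crystalT I nu) C) where
  nonempty := hC.nonempty.map fun b => ((), b)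
  φ_eq i b := by
    rw [tensor_crystalT_φ, tensor_crystalT_ε, tensor_crystalT_wt, hC.φ_eq, map_add, add_assoc,
      ← WithBot.coe_add, add_comm (D.simpleCoroot i nu)]
  ε_e i b b' hb := by
    rw [tensor_crystalT_e, Option.map_eq_some_iff] at hb
    obtain ⟨y, hy, rfl⟩ := hb
    rw [tensor_crystalT_ε, tensor_crystalT_ε, hC.ε_e i _ _ hy]
  φ_e i b b' hb := by
    rw [tensor_crystalT_e, Option.map_eq_some_iff] at hb
    obtain ⟨y, hy, rfl⟩ := hb
    rw [tensor_crystalT_φ, tensor_crystalT_φ, hC.φ_e i _ _ hy, add_right_comm]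
  wt_e i b b' hb := by
    rw [tensor_crystalT_e, Option.map_eq_some_iff] at hb
    obtain ⟨y, hy, rfl⟩ := hb
    rw [tensor_crystalT_wt, tensor_crystalT_wt, hC.wt_e i _ _ hy, add_assoc]
  ε_f i b b' hb := by
    rw [tensor_crystalT_f h, Option.map_eq_some_iff] at hb
    obtain ⟨y, hy, rfl⟩ := hb
    rw [tensor_crystalT_ε, tensor_crystalT_ε, hC.ε_f i _ _ hy]
  φ_f i b b' hb := by
    rw [tensor_crystalT_f h, Option.map_eq_some_iff] at hb
    obtain ⟨y, hy, rfl⟩ := hb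
    rw [tensor_crystalT_φ, tensor_crystalT_φ, hC.φ_f i _ _ hy, add_right_comm]
  wt_f i b b' hb := by
    rw [tensor_crystalT_f h, Option.map_eq_some_iff] at hb
    obtain ⟨y, hy, rfl⟩ := hb
    rw [tensor_crystalT_wt, tensor_crystalT_wt, hC.wt_f i _ _ hy, add_sub_assoc]
  f_eq_iff i b b' := by
    obtain ⟨⟨⟩, b⟩ := b
    obtain ⟨⟨⟩, b'⟩ := b'
    rw [tensor_crystalT_f h, tensor_crystalT_e]
    simpa using hC.f_eq_iff i b b'
  of_φ_eq_bot i b hb := by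
    rw [tensor_crystalT_φ] at hb
    rcases WithBot.add_eq_bot.1 hb with hb | hb
    · exact absurd hb (h i b.2)
    · exact absurd hb WithBot.coe_ne_bot

end Tensor

end AlcovePath

/-! ### Translation of the chain when the weight is stretched. -/

namespace AlcovePath

namespace KacMoodyDatum

set_option linter.unusedSectionVars false

variable {I P : Type*} [Fintype I] [AddCommGroup P] {D : KacMoodyDatum I P}
  [LinearOrder I] {lam lam' nu : P} {i : I} {J J' K : Finset D.Fold}

/-! ### Translating folding positions -/

/-- The translation `(β, h) ↦ (β, ⟨ν, β^∨⟩ + h)`. -/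
noncomputable def Fold.translate (nu : P) (x : D.Fold) : D.Fold :=
  Fold.mk x.posRoot (x.posRoot.coroot nu + x.level)

@[simp] theorem Fold.posRoot_translate (x : D.Fold) : (x.translate nu).posRoot = x.posRoot := rfl

@[simp] theorem Fold.level_translate (x : D.Fold) :
    (x.translate nu).level = x.posRoot.coroot nu + x.level := rfl

theorem Fold.translate_neg_translate (x : D.Fold) : (x.translate nu).translate (-nu) = x :=
  root_ext rfl (by simp)

theorem Fold.translate_translate_neg (x : D.Fold) : (x.translate (-nu)).translate nu = x :=
  root_ext rfl (by simp)

theorem Fold.translate_injective : Function.Injective (Fold.translate (D := D) nu) :=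
  Function.LeftInverse.injective (g := Fold.translate (-nu)) Fold.translate_neg_translate

theorem shiftSet_eq (J : Finset D.Fold) : D.shiftSet nu J = J.image (Fold.translate nu) := rfl

theorem shiftSet_injective : Function.Injective (D.shiftSet nu) :=
  Finset.image_injective Fold.translate_injective

theorem shiftSet_shiftSet_neg (J : Finset D.Fold) : D.shiftSet nu (D.shiftSet (-nu) J) = J := by
  rw [shiftSet_eq, shiftSet_eq, Finset.image_image]
  exact (Finset.image_congr fun x _ => Fold.translate_translate_neg x).trans Finset.image_id

theorem shiftSet_neg_shiftSet (J : Finset D.Fold) : D.shiftSet (-nu) (D.shiftSet nu J) = J := by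
  have := shiftSet_shiftSet_neg (nu := -nu) J
  rwa [neg_neg] at this

theorem shiftSet_empty : D.shiftSet nu ∅ = ∅ := rfl

theorem mem_shiftSet {x : D.Fold} : x.translate nu ∈ D.shiftSet nu J ↔ x ∈ J :=
  Fold.translate_injective.mem_finset_image

theorem reflProd_map_translate (L : List D.Fold) :
    D.reflProd (L.map (Fold.translate nu)) = D.reflProd L := by
  rw [reflProd, reflProd, List.map_map]
  rfl

theorem coverChain_map_translate {u : P ≃ₗ[ℤ] P} {L : List D.Fold} :
    D.CoverChain u (L.map (Fold.translate nu)) ↔ D.CoverChain u L := by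
  induction L generalizing u with
  | nil => rfl
  | cons x L ih => exact and_congr_right fun _ => ih

/-- Translating every hyperplane by `-ν` conjugates the affine reflections by the translation. -/
theorem affineProd_map_translate (L : List D.Fold) (x : P) :
    affineProd (L.map (Fold.translate nu)) (x - nu) = affineProd L x - nu := by
  induction L with
  | nil => rfl
  | cons j L ih =>
    rw [List.map_cons, affineProd_cons, affineProd_cons, ih, PosRoot.affineReflection,
      PosRoot.affineReflection, Fold.posRoot_translate, Fold.level_translate, map_sub]
    module

/-! ### Stretching a dominant weight by a factor `k ≥ 1` -/

/-- The weight `λ` is dominant, and `λ' = k λ` with `k ≥ 1`. -/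
structure IsStretch (D : KacMoodyDatum I P) (lam lam' : P) : Prop where
  isDominant : D.IsDominant lam
  exists_scale : ∃ k : ℚ, 1 ≤ k ∧ ∀ f : Module.Dual ℤ P, (f lam' : ℚ) = k * f lam

namespace IsStretch

theorem coroot_nonneg (h : D.IsStretch lam (lam + nu)) (β : D.PosRoot) : 0 ≤ β.coroot nu := by
  obtain ⟨k, hk, hf⟩ := h.exists_scale
  have h1 := hf β.coroot
  have h2 : (0 : ℚ) ≤ β.coroot lam := by exact_mod_cast β.coroot_nonneg h.isDominant
  rw [map_add] at h1
  push_cast at h1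
  have h3 : (0 : ℚ) ≤ β.coroot nu := by nlinarith
  exact_mod_cast h3

theorem coroot_pos (h : D.IsStretch lam lam') {β : D.PosRoot} (hβ : 0 < β.coroot lam') :
    0 < β.coroot lam := by
  obtain ⟨k, hk, hf⟩ := h.exists_scale
  refine lt_of_le_of_ne (β.coroot_nonneg h.isDominant) fun h0 => ?_
  have h1 := hf β.coroot
  rw [← h0, Int.cast_zero, mul_zero, Int.cast_eq_zero] at h1
  omega

/-- As `ν` pairs with coroots like `(k - 1)λ`, translation acts on keys by an increasing affine map
in the first coordinate and by the factor `1/k` in the others. -/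
theorem chainLT_translate_iff (h : D.IsStretch lam (lam + nu)) {x y : D.Fold}
    (hx : 0 < x.posRoot.coroot lam) (hy : 0 < y.posRoot.coroot lam) :
    D.chainLT (lam + nu) (x.translate nu) (y.translate nu) ↔ D.chainLT lam x y := by
  obtain ⟨k, hk, hf⟩ := h.exists_scale
  have hk0 : (0 : ℚ) < k := by linarith
  have hlex : ∀ v w : I → ℚ, (toLex fun j => v j / k) < (toLex fun j => w j / k) ↔
      toLex v < toLex w := fun v w => by
    refine exists_congr fun j => and_congr (forall_congr' fun l => forall_congr' fun _ => ?_) ?_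
    · exact div_left_inj' hk0.ne'
    · exact div_lt_div_iff_of_pos_right hk0
  have hlex' : ∀ v w : I → ℚ, (v = w) ↔ (fun j => v j / k) = fun j => w j / k := fun v w => by
    simp only [funext_iff, div_left_inj' hk0.ne']
  have hfst : ∀ z : D.Fold, 0 < z.posRoot.coroot lam →
      (((z.translate nu).level : ℚ) / ((z.translate nu).posRoot.coroot (lam + nu) : ℚ)) =
      ((z.level : ℚ) / (z.posRoot.coroot lam : ℚ)) / k + (k - 1) / k := fun z hz => by
    have hz' : (0 : ℚ) < z.posRoot.coroot lam := by exact_mod_cast hz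
    have h1 := hf z.posRoot.coroot
    have h2 : (z.posRoot.coroot nu : ℚ) = (k - 1) * z.posRoot.coroot lam := by
      rw [map_add] at h1
      push_cast at h1
      linarith
    rw [Fold.posRoot_translate, h1, Fold.level_translate]
    push_cast
    rw [h2]
    field_simp
    ring
  have hsnd : ∀ z : D.Fold, (fun j => (((z.translate nu).posRoot.coeff j : ℚ) /
      ((z.translate nu).posRoot.coroot (lam + nu) : ℚ))) =
      fun j => ((z.posRoot.coeff j : ℚ) / (z.posRoot.coroot lam : ℚ)) / k := fun z => by
    funext j
    rw [Fold.posRoot_translate, hf z.posRoot.coroot, div_div, mul_comm k]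
  rw [chainLT, chainLT, lexKey, lexKey, lexKey, lexKey, Prod.Lex.toLex_lt_toLex,
    Prod.Lex.toLex_lt_toLex]
  simp only
  rw [hfst x hx, hfst y hy, hsnd, hsnd, hlex, add_lt_add_iff_right,
    div_lt_div_iff_of_pos_right hk0, add_left_inj, div_left_inj' hk0.ne']

/-- The first coordinate `(k - 1)/k` separates the two kinds of positions: that of `x` is smaller,
that of the translate of `y` is at least this. -/
theorem chainLT_translate_of_level_lt (h : D.IsStretch lam (lam + nu)) {x y : D.Fold}
    (hx : 0 < x.posRoot.coroot lam) (hxl : x.level < x.posRoot.coroot nu)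
    (hy : y ∈ D.chainSet lam) : D.chainLT (lam + nu) x (y.translate nu) := by
  obtain ⟨k, hk, hf⟩ := h.exists_scale
  have hk0 : (0 : ℚ) < k := by linarith
  have hnu : ∀ z : D.Fold, (z.posRoot.coroot nu : ℚ) = (k - 1) * z.posRoot.coroot lam := fun z => by
    have h1 := hf z.posRoot.coroot
    rw [map_add] at h1
    push_cast at h1
    linarith
  have hx' : (0 : ℚ) < x.posRoot.coroot lam := by exact_mod_cast hx
  have hy' : (0 : ℚ) < y.posRoot.coroot lam := by exact_mod_cast coroot_pos_of_mem hy
  have hxl' : (x.level : ℚ) < (k - 1) * x.posRoot.coroot lam := by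
    rw [← hnu]; exact_mod_cast hxl
  have hyl : (0 : ℚ) ≤ y.level := by exact_mod_cast hy.1
  refine Prod.Lex.toLex_lt_toLex.2 (.inl ?_)
  change (x.level : ℚ) / (x.posRoot.coroot (lam + nu) : ℚ) <
    ((y.posRoot.coroot nu + y.level : ℤ) : ℚ) / (y.posRoot.coroot (lam + nu) : ℚ)
  rw [hf, hf]
  push_cast
  rw [hnu]
  refine lt_of_lt_of_le (b := (k - 1) / k) ?_ ?_
  · rw [div_lt_div_iff₀ (mul_pos hk0 hx') hk0]
    nlinarith
  · rw [div_le_div_iff₀ hk0 (mul_pos hk0 hy')]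
    nlinarith [mul_nonneg hyl hk0.le]

theorem translate_mem_iff (h : D.IsStretch lam (lam + nu)) {x : D.Fold} :
    x ∈ D.chainSet lam ↔ x.translate nu ∈ D.chainSet (lam + nu) ∧ 0 ≤ x.level := by
  have := h.coroot_nonneg x.posRoot
  change 0 ≤ x.level ∧ x.level < x.posRoot.coroot lam ↔ (0 ≤ x.posRoot.coroot nu + x.level ∧
    x.posRoot.coroot nu + x.level < x.posRoot.coroot (lam + nu)) ∧ 0 ≤ x.level
  rw [map_add]
  omega

theorem translate_mem (h : D.IsStretch lam (lam + nu)) {x : D.Fold} (hx : x ∈ D.chainSet lam) :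
    x.translate nu ∈ D.chainSet (lam + nu) := (h.translate_mem_iff.1 hx).1

theorem exists_translate (h : D.IsStretch lam (lam + nu)) {y : D.Fold}
    (hy : y ∈ D.chainSet (lam + nu)) :
    y.level < y.posRoot.coroot nu ∨ ∃ x ∈ D.chainSet lam, x.translate nu = y := by
  refine or_iff_not_imp_left.2 fun hl => ⟨y.translate (-nu), ?_, y.translate_translate_neg⟩
  rw [h.translate_mem_iff, Fold.translate_translate_neg]
  refine ⟨hy, ?_⟩
  rw [Fold.level_translate, map_neg]
  omega

theorem shiftSet_mem (h : D.IsStretch lam (lam + nu)) (hJ : ∀ x ∈ J, x ∈ D.chainSet lam) :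
    ∀ x ∈ D.shiftSet nu J, x ∈ D.chainSet (lam + nu) := fun x hx => by
  obtain ⟨y, hy, rfl⟩ := Finset.mem_image.1 hx
  exact h.translate_mem (hJ y hy)

theorem pairwise_map (h : D.IsStretch lam (lam + nu)) {L : List D.Fold}
    (hL : ∀ x ∈ L, x ∈ D.chainSet lam) (hp : L.Pairwise (D.chainLT lam)) :
    (L.map (Fold.translate nu)).Pairwise (D.chainLT (lam + nu)) := by
  rw [List.pairwise_map]
  exact hp.imp_of_mem fun ha hb hab => (h.chainLT_translate_iff (coroot_pos_of_mem (hL _ ha))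
    (coroot_pos_of_mem (hL _ hb))).2 hab

theorem sorted_shiftSet (h : D.IsStretch lam (lam + nu)) (hJ : ∀ x ∈ J, x ∈ D.chainSet lam) :
    D.sorted (lam + nu) (D.shiftSet nu J) = (D.sorted lam J).map (Fold.translate nu) := by
  refine sorted_eq (h.shiftSet_mem hJ)
    (h.pairwise_map (fun x hx => hJ x (mem_sorted.1 hx)) (pairwise_sorted hJ)) fun x => ?_
  rw [List.mem_map, shiftSet_eq, Finset.mem_image]
  simp only [mem_sorted]

theorem isAdmissible_shiftSet (h : D.IsStretch lam (lam + nu)) (hJ : D.IsAdmissible lam J) :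
    D.IsAdmissible (lam + nu) (D.shiftSet nu J) := by
  rw [isAdmissible_iff, h.sorted_shiftSet hJ.mem, coverChain_map_translate]
  exact ⟨h.shiftSet_mem hJ.mem, hJ.coverChain⟩

theorem weight_shiftSet (h : D.IsStretch lam (lam + nu)) (hJ : ∀ x ∈ J, x ∈ D.chainSet lam) :
    D.weight (lam + nu) (D.shiftSet nu J) = D.weight lam J + nu := by
  rw [weight_eq, weight_eq, h.sorted_shiftSet hJ, neg_add, ← sub_eq_add_neg,
    affineProd_map_translate, neg_sub, sub_eq_neg_add]

theorem tau_shiftSet (h : D.IsStretch lam (lam + nu)) (hJ : ∀ x ∈ J, x ∈ D.chainSet lam) :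
    D.tau (lam + nu) (D.shiftSet nu J) = D.tau lam J := by
  rw [tau, tau, h.sorted_shiftSet hJ, reflProd_map_translate]

theorem before_translate (h : D.IsStretch lam (lam + nu)) (hJ : ∀ x ∈ J, x ∈ D.chainSet lam)
    {x : D.Fold} (hx : x ∈ D.chainSet lam) :
    D.before (lam + nu) (D.shiftSet nu J) (x.translate nu) =
      (D.before lam J x).map (Fold.translate nu) := by
  rw [before, before, h.sorted_shiftSet hJ, List.filter_map]
  congr 1
  refine List.filter_congr fun y hy => ?_
  rw [Function.comp_apply, decide_eq_decide]
  exact h.chainLT_translate_iff (coroot_pos_of_mem (hJ y (mem_sorted.1 hy)))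
    (coroot_pos_of_mem hx)

theorem gamma_translate (h : D.IsStretch lam (lam + nu)) (hJ : ∀ x ∈ J, x ∈ D.chainSet lam)
    {x : D.Fold} (hx : x ∈ D.chainSet lam) :
    D.gamma (lam + nu) (D.shiftSet nu J) (x.translate nu) = D.gamma lam J x := by
  rw [gamma, h.before_translate hJ hx, reflProd_map_translate]
  rfl

theorem translate_mem_foldSet_iff (h : D.IsStretch lam (lam + nu))
    (hJ : ∀ x ∈ J, x ∈ D.chainSet lam) {x : D.Fold} (hx : x ∈ D.chainSet lam) :
    x.translate nu ∈ D.foldSet (lam + nu) (D.shiftSet nu J) i ↔ x ∈ D.foldSet lam J i := by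
  change _ ∧ _ ↔ _ ∧ _
  rw [h.gamma_translate hJ hx]
  exact and_congr_left fun _ => iff_of_true (h.translate_mem hx) hx

theorem before_eq_nil (h : D.IsStretch lam (lam + nu)) (hJ : ∀ x ∈ J, x ∈ D.chainSet lam)
    {x : D.Fold} (hx : x ∈ D.chainSet (lam + nu)) (hl : x.level < x.posRoot.coroot nu) :
    D.before (lam + nu) (D.shiftSet nu J) x = [] :=
  before_of_split (A := []) (List.nil_append _).symm (by simp) fun y hy => by
    rw [mem_sorted, shiftSet_eq, Finset.mem_image] at hy
    obtain ⟨z, hz, rfl⟩ := hy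
    exact chainLT_asymm (h.chainLT_translate_of_level_lt
      (h.coroot_pos (coroot_pos_of_mem hx)) hl (hJ z hz))

/-- No fold precedes such a position, so `γ` is the positive root itself. -/
theorem gamma_of_level_lt (h : D.IsStretch lam (lam + nu)) (hJ : ∀ x ∈ J, x ∈ D.chainSet lam)
    {x : D.Fold} (hx : x ∈ D.foldSet (lam + nu) (D.shiftSet nu J) i)
    (hl : x.level < x.posRoot.coroot nu) :
    D.gamma (lam + nu) (D.shiftSet nu J) x = D.simpleRoot i := by
  refine hx.2.resolve_right fun h' => ?_
  rw [gamma, h.before_eq_nil hJ hx.1 hl] at h'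
  exact (simplePosRoot i : D.PosRoot).not_isNonneg_neg (h' ▸ x.posRoot.isNonneg)

theorem exists_openFolds_shiftSet (h : D.IsStretch lam (lam + nu))
    (hJ : ∀ x ∈ J, x ∈ D.chainSet lam) : ∃ L : List D.Fold,
    (∀ x ∈ L, D.gamma (lam + nu) (D.shiftSet nu J) x = D.simpleRoot i) ∧
    D.openFolds (lam + nu) i (D.shiftSet nu J) =
      L ++ (D.openFolds lam i J).map (Fold.translate nu) := by
  classical
  have hmem : ∀ x ∈ D.openFolds lam i J, x ∈ D.chainSet lam := fun x hx => (mem_openFolds.1 hx).1.1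
  set L := (D.openFolds (lam + nu) i (D.shiftSet nu J)).filter fun x =>
    x.level < x.posRoot.coroot nu with hL
  have hLm : ∀ x, x ∈ L ↔ (x ∈ D.foldSet (lam + nu) (D.shiftSet nu J) i ∧ x ∉ D.shiftSet nu J) ∧
      x.level < x.posRoot.coroot nu := fun x => by
    rw [hL, List.mem_filter, mem_openFolds, decide_eq_true_iff]
  refine ⟨L, fun x hx => h.gamma_of_level_lt hJ ((hLm x).1 hx).1.1 ((hLm x).1 hx).2,
    openFolds_eq ?_ fun x => ?_⟩
  · refine List.pairwise_append.2 ⟨pairwise_openFolds.filter _, h.pairwise_map hmem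
      pairwise_openFolds, fun x hx y hy => ?_⟩
    obtain ⟨z, hz, rfl⟩ := List.mem_map.1 hy
    exact h.chainLT_translate_of_level_lt
      (h.coroot_pos (coroot_pos_of_mem ((hLm x).1 hx).1.1.1)) ((hLm x).1 hx).2 (hmem z hz)
  · rw [List.mem_append, hLm, List.mem_map]
    constructor
    · rintro (hx | ⟨y, hy, rfl⟩)
      · exact hx.1
      · rw [h.translate_mem_foldSet_iff hJ (hmem y hy), mem_shiftSet]
        exact mem_openFolds.1 hy
    · intro hx
      refine (h.exists_translate hx.1.1).imp (fun hl => ⟨hx, hl⟩) ?_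
      rintro ⟨y, hy, rfl⟩
      rw [h.translate_mem_foldSet_iff hJ hy, mem_shiftSet] at hx
      exact ⟨y, mem_openFolds.2 hx, rfl⟩

/-- The new positions contribute only `+` at the front of the word, and these cancel with nothing.
The surviving `+` may increase in number, so only the `-` are compared. -/
theorem sig_shiftSet (h : D.IsStretch lam (lam + nu)) (hJ : ∀ x ∈ J, x ∈ D.chainSet lam) :
    (D.sig (lam + nu) i (D.shiftSet nu J) (D.openFolds (lam + nu) i (D.shiftSet nu J))).2 =
      (D.sig lam i J (D.openFolds lam i J)).2.map (Fold.translate nu) := by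
  obtain ⟨L, hL, h1⟩ := h.exists_openFolds_shiftSet (i := i) hJ
  classical
  rw [h1, sig, signature_append_of_pos _ hL, sig,
    signature_map (fun k => D.gamma lam J k = D.simpleRoot i) _ fun x hx => by
      rw [h.gamma_translate hJ (mem_openFolds.1 hx).1.1]]

theorem negCount_shiftSet (h : D.IsStretch lam (lam + nu)) (hJ : ∀ x ∈ J, x ∈ D.chainSet lam) :
    negCount (lam + nu) i (D.shiftSet nu J) = negCount lam i J := by
  rw [negCount, negCount, h.sig_shiftSet hJ, h.tau_shiftSet hJ, List.length_map]

/-- The operator `eᵢ` depends only on the surviving `-`, on `τ` and on the folds of `J`, all of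
which are compatible with translation. For `fᵢ` this can fail, as an additional `+` may make it
nonzero. -/
theorem eOp_shiftSet (h : D.IsStretch lam (lam + nu)) (hJ : ∀ x ∈ J, x ∈ D.chainSet lam) :
    D.eOp (lam + nu) i (D.shiftSet nu J) = (D.eOp lam i J).map (D.shiftSet nu) := by
  classical
  have helim : ∀ o : Option D.Fold, (o.map (Fold.translate nu)).elim (D.shiftSet nu J)
      (D.shiftSet nu J).erase = D.shiftSet nu (o.elim J J.erase) := by
    rintro (- | a)
    · rfl
    · exact (Finset.image_erase Fold.translate_injective J a).symm
  have hJ' : ∀ y ∈ D.sorted lam J, y ∈ D.chainSet lam := fun y hy => hJ y (mem_sorted.1 hy)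
  rw [eOp_eq, eOp_eq, h.sig_shiftSet hJ, h.tau_shiftSet hJ, List.head?_map, h.sorted_shiftSet hJ]
  rcases ha : (D.sig lam i J (D.openFolds lam i J)).2.head? with - | a
  · simp only [Option.map_none, List.filter_map, List.getLast?_map, helim]
    rw [List.filter_congr fun y hy => by
      rw [Function.comp_apply, h.translate_mem_foldSet_iff hJ (hJ' y hy)]]
    split_ifs <;> rfl
  · have haI : a ∈ D.openFolds lam i J := by
      obtain ⟨X, Y, hXY, -⟩ := exists_split_of_head_neg _ ha
      rw [hXY]
      simp
    have haR : a ∈ D.chainSet lam := (mem_openFolds.1 haI).1.1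
    simp only [Option.map_some, List.filter_map, List.getLast?_map, helim]
    rw [List.filter_congr fun y hy => by
      rw [Function.comp_apply, h.translate_mem_foldSet_iff hJ (hJ' y hy),
        h.chainLT_translate_iff (coroot_pos_of_mem (hJ' y hy)) (coroot_pos_of_mem haR)]]
    exact congrArg some (Finset.image_insert _ _ _).symm

/-- An edge is `eᵢ` read backwards, so the compatibility of `eᵢ` also settles `fᵢ` between shifted
sets. -/
theorem isEdge_shiftSet_iff (h : D.IsStretch lam (lam + nu)) (hJ' : D.IsAdmissible lam J') :
    IsEdge (lam + nu) i (D.shiftSet nu J) (D.shiftSet nu J') ↔ IsEdge lam i J J' := by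
  rw [← eOp_eq_some_iff hJ', ← eOp_eq_some_iff (h.isAdmissible_shiftSet hJ'),
    h.eOp_shiftSet hJ'.mem, Option.map_eq_some_iff]
  constructor
  · rintro ⟨K, hK, hKJ⟩
    rwa [← shiftSet_injective hKJ]
  · exact fun hJ => ⟨J, hJ, rfl⟩

end IsStretch

end KacMoodyDatum

end AlcovePath

/-! ### The cases `k ≥ 1`, `0 < k ≤ 1` and `k = 0` of the shift. -/

namespace AlcovePath

namespace KacMoodyDatum

set_option linter.unusedSectionVars false

variable {I P : Type*} [Fintype I] [AddCommGroup P] {D : KacMoodyDatum I P}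
  [LinearOrder I] {lam mu : P} {i : I} {J J' K : Finset D.Fold} {k : ℚ}

/-! ### The shift morphism -/

/-- Apply `id ⊗ f`: the scaling relation enters the proof only through these pairings. -/
theorem dual_apply_of_tmul_eq
    (hmu : (TensorProduct.tmul ℤ (1 : ℚ) (mu + lam)) = k • TensorProduct.tmul ℤ (1 : ℚ) lam)
    (f : Module.Dual ℤ P) : (f (lam + mu) : ℚ) = k * f lam := by
  have h := congrArg (TensorProduct.rid ℤ ℚ ∘ f.lTensor ℚ) hmu
  rw [TensorProduct.smul_tmul'] at h
  simp only [Function.comp_apply, LinearMap.lTensor_tmul, TensorProduct.rid_tmul, smul_eq_mul,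
    zsmul_eq_mul, mul_one] at h
  rw [add_comm lam, h, mul_comm]

theorem isDominant_of_scale (hlam : D.IsDominant lam) (hk : 0 ≤ k)
    (hf : ∀ f : Module.Dual ℤ P, (f (lam + mu) : ℚ) = k * f lam) : D.IsDominant (lam + mu) := by
  intro i
  have h1 : (0 : ℚ) ≤ D.simpleCoroot i lam := by exact_mod_cast hlam i
  have h2 := mul_nonneg hk h1
  rw [← hf] at h2
  exact_mod_cast h2

theorem isStretch_neg (hlam : D.IsDominant lam) (hk : 0 < k) (hk1 : k ≤ 1)
    (hf : ∀ f : Module.Dual ℤ P, (f (lam + mu) : ℚ) = k * f lam) :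
    D.IsStretch (lam + mu) (lam + mu + -mu) :=
  ⟨isDominant_of_scale hlam hk.le hf, k⁻¹, (one_le_inv₀ hk).2 hk1, fun f => by
    rw [add_neg_cancel_right, hf, inv_mul_cancel_left₀ hk.ne']⟩

theorem eq_empty_of_scale_zero (hf : ∀ f : Module.Dual ℤ P, (f (lam + mu) : ℚ) = 0)
    (hK : D.IsAdmissible (lam + mu) K) : K = ∅ := by
  refine Finset.eq_empty_of_forall_notMem fun x hx => ?_
  have h1 := coroot_pos_of_mem (hK.mem x hx)
  have h2 := hf x.posRoot.coroot
  rw [Int.cast_eq_zero] at h2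
  omega

theorem negCount_empty : negCount lam i (∅ : Finset D.Fold) = 0 := by
  classical
  have h : ∀ x ∈ D.openFolds lam i ∅, D.gamma lam ∅ x = D.simpleRoot i := fun x hx => by
    have hx := (mem_foldSet_empty.1 (mem_openFolds.1 hx).1).2
    rw [gamma, before_empty, hx]
    rfl
  have h1 := signature_append_of_pos (fun x => D.gamma lam ∅ x = D.simpleRoot i) (l' := []) h
  rw [List.append_nil] at h1
  rw [negCount, sig, h1, tau, sorted_empty, reflProd_nil, if_pos (isAscent_one i)]
  rfl

/-- The compatibilities of the `μ`-shift between admissible subsets for `λ` and `λ + μ`. -/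
structure ShiftCompatible (D : KacMoodyDatum I P) (lam mu : P) : Prop where
  weight : ∀ J, D.IsAdmissible lam J → D.IsAdmissible (lam + mu) (D.shiftSet mu J) →
    D.weight (lam + mu) (D.shiftSet mu J) = D.weight lam J + mu
  negCount : ∀ i J, D.IsAdmissible lam J → D.IsAdmissible (lam + mu) (D.shiftSet mu J) →
    negCount (lam + mu) i (D.shiftSet mu J) = negCount lam i J
  isEdge : ∀ i J J', IsEdge lam i J J' → D.IsAdmissible (lam + mu) (D.shiftSet mu J) →
    D.IsAdmissible (lam + mu) (D.shiftSet mu J') →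
    IsEdge (lam + mu) i (D.shiftSet mu J) (D.shiftSet mu J')

theorem IsStretch.shiftCompatible (h : D.IsStretch lam (lam + mu)) : D.ShiftCompatible lam mu where
  weight _ hJ _ := h.weight_shiftSet hJ.mem
  negCount _ _ hJ _ := h.negCount_shiftSet hJ.mem
  isEdge _ _ _ hJ _ _ := (h.isEdge_shiftSet_iff hJ.right).2 hJ

/-- When `λ` is the stretched weight, the shift by `μ` undoes the shift by `-μ`, and the
compatibilities of the latter are read backwards. -/
theorem IsStretch.shiftCompatible_neg (h : D.IsStretch (lam + mu) (lam + mu + -mu)) :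
    D.ShiftCompatible lam mu where
  weight J _ hK := by
    have := h.weight_shiftSet hK.mem
    rw [add_neg_cancel_right, shiftSet_neg_shiftSet] at this
    rw [this, neg_add_cancel_right]
  negCount i J _ hK := by
    have := h.negCount_shiftSet (i := i) hK.mem
    rw [add_neg_cancel_right, shiftSet_neg_shiftSet] at this
    exact this.symm
  isEdge i J J' hJ _ hK := by
    rw [← h.isEdge_shiftSet_iff hK, add_neg_cancel_right, shiftSet_neg_shiftSet,
      shiftSet_neg_shiftSet]
    exact hJ

theorem shiftCompatible_of_scale_zero (hf : ∀ f : Module.Dual ℤ P, (f (lam + mu) : ℚ) = 0) :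
    D.ShiftCompatible lam mu := by
  have key : ∀ J, D.IsAdmissible (lam + mu) (D.shiftSet mu J) → J = ∅ := fun J hJ =>
    shiftSet_injective ((eq_empty_of_scale_zero hf hJ).trans shiftSet_empty.symm)
  refine ⟨fun J _ hK => ?_, fun i J _ hK => ?_, fun i J J' hJ hK hK' => ?_⟩
  · rw [key J hK, shiftSet_empty, weight_empty, weight_empty]
  · rw [key J hK, shiftSet_empty, negCount_empty, negCount_empty]
  -- Both ends would be empty, but an edge strictly lowers the number of surviving `+`.
  · have := hJ.posCount_eq
    rw [key J hK, key J' hK'] at this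
    omega

theorem shift_eq_some_iff {x : D.Al lam} {y : Unit × D.Al (lam + mu)} :
    D.shift lam mu (some x) = some y ↔ y.2.1 = D.shiftSet mu x.1 := by
  rw [shift, Option.bind_some, Option.map_eq_some_iff]
  constructor
  · rintro ⟨K, hK, rfl⟩
    exact toAl_eq_some_iff.1 hK
  · exact fun h => ⟨y.2, toAl_eq_some_iff.2 h, rfl⟩

/-- The nonvanishing conditions for `eᵢ` and `fᵢ` say that both ends of the edge in `A(λ)` have
admissible shifts, which is what the transport of edges requires. -/
theorem ShiftCompatible.isCrystalMorphism (h : D.ShiftCompatible lam mu)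
    (hlam : D.IsDominant lam) (hlam' : D.IsDominant (lam + mu)) :
    IsCrystalMorphism D (D.crystalAl lam)
      (tensor D (crystalT I (-mu)) (D.crystalAl (lam + mu))) (D.shift lam mu) := by
  have hφ : ∀ (i : I) (b : D.Al (lam + mu)), (D.crystalAl (lam + mu)).φ i b ≠ ⊥ := fun i b => by
    rw [crystalAl_φ]
    exact WithBot.coe_ne_bot
  have hC := isAbstractCrystal_crystalAl (D := D) hlam
  have hC' := (isAbstractCrystal_crystalAl (D := D) hlam').tensor_crystalT (nu := -mu) hφ
  have hwt : ∀ b b', D.shift lam mu (some b) = some b' →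
      (tensor D (crystalT I (-mu)) (D.crystalAl (lam + mu))).wt b' = (D.crystalAl lam).wt b := by
    intro b b' hb
    rw [shift_eq_some_iff] at hb
    rw [tensor_crystalT_wt]
    change -mu + D.weight (lam + mu) b'.2.1 = D.weight lam b.1
    rw [hb, h.weight b.1 b.2 (hb ▸ b'.2.2)]
    abel
  have hε : ∀ i b b', D.shift lam mu (some b) = some b' →
      (tensor D (crystalT I (-mu)) (D.crystalAl (lam + mu))).ε i b' =
        (D.crystalAl lam).ε i b := by
    intro i b b' hb
    rw [shift_eq_some_iff] at hb
    rw [tensor_crystalT_ε, crystalAl_ε, crystalAl_ε, hb, h.negCount i b.1 b.2 (hb ▸ b'.2.2)]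
  refine ⟨hC, hC', rfl, hwt, hε, fun i b b' hb => ?_, fun i b h1 h2 => ?_, fun i b h1 h2 => ?_⟩
  -- Preservation of `φ` follows from that of `ε` and the weight by the crystal axiom.
  · rw [hC.φ_eq, hC'.φ_eq, hwt b b' hb, hε i b b' hb]
  all_goals
    obtain ⟨b₁, hb₁⟩ := Option.ne_none_iff_exists'.1 h1
    obtain ⟨c, hc, -⟩ := Option.bind_eq_some_iff.1 (Option.ne_none_iff_exists'.1 h2).choose_spec
    rw [hb₁, hc, Option.bind_some]
    obtain ⟨b', hb', hb₁⟩ := Option.bind_eq_some_iff.1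
      (show (_ : Option (D.Al lam)).bind _ = _ from hb₁)
    have hb₁ : D.shift lam mu (some b') = some b₁ := hb₁
    rw [shift_eq_some_iff] at hb₁ hc
  · rw [tensor_crystalT_e, eq_comm, Option.map_eq_some_iff]
    refine ⟨b₁.2, alE_eq_some_iff.2 ?_, rfl⟩
    rw [hb₁, hc]
    exact h.isEdge i _ _ (alE_eq_some_iff.1 hb') (hb₁ ▸ b₁.2.2) (hc ▸ c.2.2)
  · rw [tensor_crystalT_f hφ, eq_comm, Option.map_eq_some_iff]
    refine ⟨b₁.2, alF_eq_some_iff.2 ?_, rfl⟩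
    rw [hb₁, hc]
    exact h.isEdge i _ _ (alF_eq_some_iff.1 hb') (hc ▸ c.2.2) (hb₁ ▸ b₁.2.2)

theorem IsStretch.shift_injective (h : D.IsStretch lam (lam + mu)) :
    Function.Injective (D.shift lam mu) := by
  have hs : ∀ x : D.Al lam, ∃ y, D.shift lam mu (some x) = some y := fun x =>
    ⟨((), ⟨_, h.isAdmissible_shiftSet x.2⟩), shift_eq_some_iff.2 rfl⟩
  rintro (- | x) (- | y) hxy
  · rfl
  · obtain ⟨z, hz⟩ := hs y
    rw [hz] at hxy
    cases hxy
  · obtain ⟨z, hz⟩ := hs x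
    rw [hz] at hxy
    cases hxy
  · obtain ⟨z, hz⟩ := hs y
    rw [hz, shift_eq_some_iff] at hxy
    rw [shift_eq_some_iff, hxy] at hz
    exact congrArg some (Subtype.ext (shiftSet_injective hz))

theorem shift_surjective (h : ∀ K, D.IsAdmissible (lam + mu) K →
    D.IsAdmissible lam (D.shiftSet (-mu) K)) : Function.Surjective (D.shift lam mu) := by
  rintro (- | y)
  · exact ⟨none, rfl⟩
  · exact ⟨some ⟨_, h y.2.1 y.2.2⟩, shift_eq_some_iff.2 (shiftSet_shiftSet_neg _).symm⟩

end KacMoodyDatum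

end AlcovePath

theorem mainTheorem7 {I P : Type*} [Fintype I] [LinearOrder I]
    [AddCommGroup P] [Module.Free ℤ P] [Module.Finite ℤ P]
    (D : AlcovePath.KacMoodyDatum I P) (lam mu : P) (hlam : D.IsDominant lam)
    (k : ℚ) (hk : 0 ≤ k)
    -- `mu + lam = k * lam` in `ℚ ⊗ P`, where `lam` is `1 ⊗ lam` and so on
    (hmu : (TensorProduct.tmul ℤ (1 : ℚ) (mu + lam)) = k • TensorProduct.tmul ℤ (1 : ℚ) lam) :
    AlcovePath.IsCrystalMorphism D (D.crystalAl lam)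
        (AlcovePath.tensor D (AlcovePath.crystalT I (-mu)) (D.crystalAl (lam + mu)))
        (D.shift lam mu) ∧
      (1 ≤ k → AlcovePath.IsCrystalEmbedding D (D.crystalAl lam)
        (AlcovePath.tensor D (AlcovePath.crystalT I (-mu)) (D.crystalAl (lam + mu)))
        (D.shift lam mu)) ∧
      (k ≤ 1 → AlcovePath.IsCrystalSurjection D (D.crystalAl lam)
        (AlcovePath.tensor D (AlcovePath.crystalT I (-mu)) (D.crystalAl (lam + mu)))
        (D.shift lam mu)) := by
  have hf := AlcovePath.KacMoodyDatum.dual_apply_of_tmul_eq hmu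
  have hlam' : D.IsDominant (lam + mu) :=
    AlcovePath.KacMoodyDatum.isDominant_of_scale hlam hk hf
  have hup : 1 ≤ k → D.IsStretch lam (lam + mu) := fun h => ⟨hlam, k, h, hf⟩
  have hzero : k = 0 → ∀ f : Module.Dual ℤ P, (f (lam + mu) : ℚ) = 0 := fun h f => by
    rw [hf, h, zero_mul]
  have hcompat : D.ShiftCompatible lam mu := by
    -- For `k = 0` the stretching factor `1/k` from `λ + μ` back to `λ` is not available, so this
    -- case is separate.
    rcases le_total 1 k with h1 | h1
    · exact (hup h1).shiftCompatible
    · rcases hk.eq_or_lt with h0 | h0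
      · exact AlcovePath.KacMoodyDatum.shiftCompatible_of_scale_zero (hzero h0.symm)
      · exact (AlcovePath.KacMoodyDatum.isStretch_neg hlam h0 h1 hf).shiftCompatible_neg
  have hmor := hcompat.isCrystalMorphism hlam hlam'
  refine ⟨hmor, fun h1 => ⟨hmor, (hup h1).shift_injective⟩, fun h1 => ⟨hmor, ?_⟩⟩
  refine AlcovePath.KacMoodyDatum.shift_surjective fun K hK => ?_
  rcases hk.eq_or_lt with h0 | h0
  · rw [AlcovePath.KacMoodyDatum.eq_empty_of_scale_zero (hzero h0.symm) hK]
    exact AlcovePath.KacMoodyDatum.isAdmissible_empty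
  · have := (AlcovePath.KacMoodyDatum.isStretch_neg hlam h0 h1 hf).isAdmissible_shiftSet hK
    rwa [add_neg_cancel_right] at this
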